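/- Setting. Let $\Sigma^+\subset \mathcal W_1^{\{0,1,2,\dots\}}$ be a compact one-sided Markov shift over a countable alphabet $\mathcal W_1$ (each letter of which occurs in $\Sigma^+$), with shift $\sigma$ topologically mixing. Let $R:\Sigma^+\to(0,\infty)$ with $\log R$ locally Hölder continuous and Gurevič pressure $P(\log R,\sigma)=0$; write $R_n(x)=\prod_{i<n}R(\sigma^i x)$. Let $G$ be a countable discrete group and $\mathfrak s:\mathcal W_1\to G$ a map such that the skew product $T_{\mathfrak s}(x,g)=(\sigma x,\mathfrak s(x_0)^{-1}g)$ on $\Sigma^+\times G$ is topologically transitive; for a word put $\underline{\mathfrak s}(w_1\cdots w_n)=\mathfrak s(w_1)\cdots\mathfrak s(w_n)$. Let $\rho$ be the unitary representation of $G$ by translations in $\mathcal H=\bigoplus_{i\in I}\ell^2(G/H_i,\mathbb R)$, where $I$ is countable and the $H_i\le G$ are subgroups, and let $\mathcal H_+$ be the cone of non-negative functions. Fix letters $A,a$, a point $x^{0}\in\sigma[a]$ and $0\ne f\in\mathcal H_+$. For $c:\mathbb N\to(0,\infty)$, $t>0$ and $N\in\mathbb N\cup\{\infty\}$ put $$\phi_{c;\le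 N}[t](g)=\sum_{n=1}^{N}t^{-n}c_n\sum_{w}R_n(wx^{0}),$$ the inner sum being over the admissible words $w$ of length $n$ with first letter $A$, last letter $a$ and $\underline{\mathfrak s}(w)=g$. Write $\phi_c=\phi_{c;\le\infty}$, $\phi_{\le N}=\phi_{1;\le N}$, $\varphi\ast_\rho f=\sum_{h\in G}\varphi(h)\rho(h)f$, and $$\gamma=\gamma(\phi\ast_\rho f)=\inf\Big\{t>0:\ \sup_{N\in\mathbb N}\|\phi_{\le N}[t]\ast_\rho f\|^2<\infty\Big\}.$$ Call $(c,(t_k),\Upsilon_c,\nu_c)$ *admissible data* if (i) $c$ is slowly increasing, i.e. positive, non-decreasing, with $c_{n+k}/c_n\to1$ as $n\to\infty$ for every $k$, and $\|\phi_c[t]\ast_\rho f\|\to\infty$ as $t\downarrow\gamma$; (ii) $t_k>\gamma$ and $t_k\to\gamma$; (iii) with $Q_k=\phi_c[t_k]\ast_\rho f$, for every $g\in G$ $$\Upsilon_c(g)=\lim_{k\to\infty}\frac{\langle\rho(g)Q_k,Q_k\rangle}{\langle Q_k,Q_k\rangle};$$ (iv) $\nu_c$ is a finite Borel measure on $\Sigma^+$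 that is the weak-$*$ limit, as $k\to\infty$, of the weighted sums of Dirac masses $$\sum_{n\ge1}t_k^{-n}c_n\sum_{v}R_n(vx^{0})\,\frac{\langle\rho(\underline{\mathfrak s}(v))f,Q_k\rangle}{\langle Q_k,Q_k\rangle}\,\delta_{vx^{0}},$$ where $v$ runs over the admissible words of length $n$ with last letter $a$ (and any first letter). Statement. Suppose that $\gamma=\gamma(\phi\ast_\rho f)<1$. Then admissible data exist, and for all admissible data $(c,(t_k),\Upsilon_c,\nu_c)$ the following hold. 1. For every $\epsilon\in(0,1)$ and every $v\in\mathcal H_+$, for $\nu_c$-almost every $x\in\Sigma^+$ there is $N$ such that $$n\ge N\ \Longrightarrow\ \langle\rho(\underline{\mathfrak s}(x_1\cdots x_n))f,v\rangle\le(1-\epsilon)^{-n}\,\Upsilon_c(\underline{\mathfrak s}(x_1\cdots x_n)).$$ 2. For $\nu_c$-almost every $x\in\Sigma^+$ there is $N$ such that $$n\ge N\ \Longrightarrow\ \Upsilon_c(\underline{\mathfrak s}(x_1\cdots x_n))\ge n^{-2}\,\gamma^n.$$ Both statements also hold with $x_0\cdots x_{n-1}$, the first $n$ letters of $x=(x_0,x_1,\dots)$,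 in place of $x_1\cdots x_n$. -/

import Mathlib

open MeasureTheory Filter Topology
open scoped ENNReal

namespace TwistedDecay

noncomputable section

/-! ### One-sided Markov shifts -/

/-- The one-sided Markov shift `Σ⁺` with alphabet `W` and transition relation `τ`. When `W` is
discrete, the topology (and σ-algebra) inherited from `ℕ → W` is generated by the cylinders. -/
abbrev MarkovShift {W : Type*} (τ : W → W → Prop) : Type _ :=
  {x : ℕ → W // ∀ i, τ (x i) (x (i + 1))}

section Shift

variable {W : Type*} {τ : W → W → Prop}

/-- The left shift `σ`. -/
def shift (x : MarkovShift τ) : MarkovShift τ :=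
  ⟨fun i => x.1 (i + 1), fun i => x.2 (i + 1)⟩

/-- `R_n(x) = R(x) R(σ x) ⋯ R(σ^{n-1} x)`. -/
def birkhoffProd (R : MarkovShift τ → ℝ) (n : ℕ) (x : MarkovShift τ) : ℝ :=
  ∏ i ∈ Finset.range n, R (shift^[i] x)

/-- Topological mixing of `σ : Σ⁺ → Σ⁺`. -/
def IsMixing [TopologicalSpace W] (τ : W → W → Prop) : Prop :=
  ∀ U V : Set (MarkovShift τ), IsOpen U → IsOpen V → U.Nonempty → V.Nonempty →
    ∃ N, ∀ n ≥ N, (shift^[n] '' U ∩ V).Nonempty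

/-- Local Hölder continuity: the variation over points that share their first `n` letters is at
most `C θ ^ n`, for all `n > 1`. -/
def LocallyHolder (r : MarkovShift τ → ℝ) : Prop :=
  ∃ C θ : ℝ, 0 < θ ∧ θ < 1 ∧ ∀ n : ℕ, 1 < n → ∀ x y : MarkovShift τ,
    (∀ i < n, x.1 i = y.1 i) → |r x - r y| ≤ C * θ ^ n

/-- The Gurevič pressure `P(log R, σ)`, computed with periodic points in the cylinder `[B]`. -/
def gurevicPressure (R : MarkovShift τ → ℝ) (B : W) : EReal :=
  limsup (fun n : ℕ =>
    ENNReal.log (∑' y : {y : MarkovShift τ // y.1 0 = B ∧ shift^[n] y = y},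
      ENNReal.ofReal (birkhoffProd R n y.1)) / (n : EReal)) atTop

variable {G : Type*} [Group G]

/-- The skew product `T_s(x, g) = (σ x, s(x₀)⁻¹ g)` on `Σ⁺ × G`. -/
def skewProduct (s : W → G) (p : MarkovShift τ × G) : MarkovShift τ × G :=
  (shift p.1, (s (p.1.1 0))⁻¹ * p.2)

/-- Topological transitivity of `T_s`, where `G` is discrete. -/
def IsTransitiveSkew [TopologicalSpace W] (τ : W → W → Prop) (s : W → G) : Prop :=
  ∀ U V : Set (MarkovShift τ), IsOpen U → IsOpen V → U.Nonempty → V.Nonempty →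
    ∀ g h : G, ∃ n : ℕ,
      ((skewProduct (τ := τ) s)^[n] '' (U ×ˢ {g}) ∩ (V ×ˢ {h})).Nonempty

/-- The group element `s(y_j) s(y_{j+1}) ⋯ s(y_{j+n-1})`. -/
def wordValue (s : W → G) (y : MarkovShift τ) (j n : ℕ) : G :=
  (List.ofFn fun i : Fin n => s (y.1 (j + i))).prod

end Shift

/-! ### Countable direct sums of quotient representations -/

section Representation

variable {G : Type*} [Group G] {I : Type*}

/-- The Hilbert space `⨁ᵢ ℓ²(G/Hᵢ)` (real scalars), realised as `ℓ²` of the disjoint union of the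
coset spaces. -/
abbrev QuotientSum (H : I → Subgroup G) : Type _ :=
  lp (fun _ : (Σ i, G ⧸ H i) => ℝ) 2

variable {H : I → Subgroup G}

theorem memlp_translate (g : G) (f : QuotientSum H) :
    Memℓp (fun p : (Σ i, G ⧸ H i) => f (g⁻¹ • p)) 2 := by
  have h2 : 0 < (2 : ℝ≥0∞).toReal := by norm_num
  have hf := (memℓp_gen_iff h2).1 (lp.memℓp f)
  exact (memℓp_gen_iff h2).2 (hf.comp_injective (MulAction.injective (g⁻¹ : G)))

/-- The operator `[ρ(g) f](p) = f(g⁻¹ p)`. -/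
def translate (g : G) (f : QuotientSum H) : QuotientSum H :=
  ⟨fun p => f (g⁻¹ • p), memlp_translate g f⟩

theorem translate_apply (g : G) (f : QuotientSum H) (p : Σ i, G ⧸ H i) :
    translate g f p = f (g⁻¹ • p) := rfl

theorem norm_translate (g : G) (f : QuotientSum H) : ‖translate g f‖ = ‖f‖ := by
  have h2 : 0 < (2 : ℝ≥0∞).toReal := by norm_num
  rw [lp.norm_eq_tsum_rpow h2, lp.norm_eq_tsum_rpow h2]
  congr 1
  exact (MulAction.toPerm (g⁻¹ : G)).tsum_eq (fun p => ‖f p‖ ^ (2 : ℝ≥0∞).toReal)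

theorem translate_mul (g h : G) (f : QuotientSum H) :
    translate (g * h) f = translate g (translate h f) := by
  ext p
  simp only [translate_apply, mul_inv_rev, mul_smul]

theorem translate_one (f : QuotientSum H) : translate 1 f = f := by
  ext p
  simp only [translate_apply, inv_one, one_smul]

/-- The unitary representation `ρ = ⨁ᵢ λ_{Hᵢ}` of `G` in `⨁ᵢ ℓ²(G/Hᵢ)`. -/
def rho (H : I → Subgroup G) : G →* (QuotientSum H ≃ₗᵢ[ℝ] QuotientSum H) where
  toFun g :=
    { toFun := translate g
      invFun := translate g⁻¹
      left_inv := fun f => by rw [← translate_mul, inv_mul_cancel, translate_one]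
      right_inv := fun f => by rw [← translate_mul, mul_inv_cancel, translate_one]
      map_add' := fun f f' => by ext p; rfl
      map_smul' := fun r f => by ext p; rfl
      norm_map' := norm_translate g }
  map_one' := by ext1 f; exact translate_one f
  map_mul' g h := by ext1 f; exact translate_mul g h f

/-- Membership in the cone `𝓗₊` of non-negative functions. -/
def InCone (f : QuotientSum H) : Prop := ∀ p, 0 ≤ f p

/-- `φ ∗_ρ f = ∑_h φ(h) ρ(h) f`. -/
def conv (φ : G → ℝ) (f : QuotientSum H) : QuotientSum H :=
  ∑' h : G, φ h • rho H h f

end Representation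

/-! ### Thermodynamic `G`-densities -/

section Density

variable {W : Type*} {τ : W → W → Prop} {G : Type*} [Group G]

/-- The summand of index `n ≥ 1` of the thermodynamic `G`-density:
`t⁻ⁿ c_n ∑ R_n(wx)` over the admissible words `w` of length `n` with first letter `A`, last letter
`a` and `s(w) = g`. For `x ∈ σ[a]` these words correspond, through `y = wx`, to the points `y` of
`Σ⁺` with `σⁿ y = x`, `y₀ = A`, `y_{n-1} = a`. -/
def phiTerm (R : MarkovShift τ → ℝ) (s : W → G) (A a : W) (x : MarkovShift τ)
    (c : ℕ → ℝ) (t : ℝ) (n : ℕ) (g : G) : ℝ :=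
  (t ^ n)⁻¹ * c n *
    ∑' y : {y : MarkovShift τ //
        shift^[n] y = x ∧ y.1 0 = A ∧ y.1 (n - 1) = a ∧ wordValue s y 0 n = g},
      birkhoffProd R n y.1

/-- The partial sums `φ^{A,a}_{c;≤N}[t]`. -/
def phiPartial (R : MarkovShift τ → ℝ) (s : W → G) (A a : W) (x : MarkovShift τ)
    (c : ℕ → ℝ) (N : ℕ) (t : ℝ) (g : G) : ℝ :=
  ∑ n ∈ Finset.Icc 1 N, phiTerm R s A a x c t n g

/-- The thermodynamic `G`-density `φ^{A,a}_c[t]`. -/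
def phi (R : MarkovShift τ → ℝ) (s : W → G) (A a : W) (x : MarkovShift τ)
    (c : ℕ → ℝ) (t : ℝ) (g : G) : ℝ :=
  ∑' n : ℕ, phiTerm R s A a x c t (n + 1) g

variable {I : Type*} {H : I → Subgroup G}

/-- The decay exponent `γ(φ ∗_ρ f)`. -/
def decayExponent (R : MarkovShift τ → ℝ) (s : W → G) (A a : W) (x : MarkovShift τ)
    (f : QuotientSum H) : ℝ :=
  sInf {t : ℝ | 0 < t ∧ BddAbove (Set.range fun N : ℕ =>
    inner ℝ (conv (phiPartial R s A a x (fun _ => 1) N t) f)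
      (conv (phiPartial R s A a x (fun _ => 1) N t) f))}

/-- Slowly increasing functions `c : ℕ → (0, ∞)`. -/
structure SlowlyIncreasing (c : ℕ → ℝ) : Prop where
  pos : ∀ n, 0 < c n
  mono : Monotone c
  slow : ∀ k : ℕ, Tendsto (fun n => c (n + k) / c n) atTop (𝓝 1)

/-- The vector `φ_c[t] ∗_ρ f`. -/
def phiVec (R : MarkovShift τ → ℝ) (s : W → G) (A a : W) (x : MarkovShift τ)
    (f : QuotientSum H) (c : ℕ → ℝ) (t : ℝ) : QuotientSum H :=
  conv (phi R s A a x c t) f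

/-- The normalised matrix coefficient
`⟨ρ(g) φ_c[t] ∗ f, φ_c[t] ∗ f⟩ / ⟨φ_c[t] ∗ f, φ_c[t] ∗ f⟩`. -/
def matrixCoeff (R : MarkovShift τ → ℝ) (s : W → G) (A a : W) (x : MarkovShift τ)
    (f : QuotientSum H) (c : ℕ → ℝ) (t : ℝ) (g : G) : ℝ :=
  inner ℝ (rho H g (phiVec R s A a x f c t)) (phiVec R s A a x f c t) /
    inner ℝ (phiVec R s A a x f c t) (phiVec R s A a x f c t)

/-- The weighted sum of Dirac masses
`ν_c[t] = ∑_{n ≥ 1} t⁻ⁿ c_n ∑_v R_n(vx) (⟨ρ(s(v)) f, Q⟩ / ⟨Q, Q⟩) D(vx)`, `Q = φ_c[t] ∗_ρ f`,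
the inner sum being over the admissible words `v` of length `n` with last letter `a` (and any first
letter), that is, over the points `y = vx` with `σⁿ y = x` and `y_{n-1} = a`. -/
def approxMeasure [MeasurableSpace W] (R : MarkovShift τ → ℝ) (s : W → G) (A a : W)
    (x : MarkovShift τ) (f : QuotientSum H) (c : ℕ → ℝ) (t : ℝ) : Measure (MarkovShift τ) :=
  Measure.sum fun n : ℕ =>
    Measure.sum fun y : {y : MarkovShift τ // shift^[n + 1] y = x ∧ y.1 n = a} =>
      ENNReal.ofReal ((t ^ (n + 1))⁻¹ * c (n + 1) * birkhoffProd R (n + 1) y.1 *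
        (inner ℝ (rho H (wordValue s y.1 0 (n + 1)) f) (phiVec R s A a x f c t) /
          inner ℝ (phiVec R s A a x f c t) (phiVec R s A a x f c t))) •
      Measure.dirac y.1

/-- `(Υ, ν)` is a pair `(Υ_c, ν_c^{φ ∗_ρ f})` obtained from a slowly increasing `c` that makes
`‖φ_c[t] ∗_ρ f‖` diverge at the decay exponent, along a sequence `t_k` decreasing to that exponent:
`Υ` is the pointwise limit of the normalised matrix coefficients, and `ν` the weak-* limit of the
measures `ν_c[t_k]`. -/
structure IsTwistedLimit [TopologicalSpace W] [MeasurableSpace W]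
    (R : MarkovShift τ → ℝ) (s : W → G) (A a : W) (x : MarkovShift τ) (f : QuotientSum H)
    (c : ℕ → ℝ) (t : ℕ → ℝ) (Υ : G → ℝ) (ν : Measure (MarkovShift τ)) : Prop where
  slowlyIncreasing : SlowlyIncreasing c
  diverges : Tendsto
    (fun u : ℝ => inner ℝ (phiVec R s A a x f c u) (phiVec R s A a x f c u))
    (𝓝[>] (decayExponent R s A a x f)) atTop
  lt_param : ∀ k, decayExponent R s A a x f < t k
  tendsto_param : Tendsto t atTop (𝓝 (decayExponent R s A a x f))
  tendsto_coeff : ∀ g, Tendsto (fun k => matrixCoeff R s A a x f c (t k) g) atTop (𝓝 (Υ g))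
  finite : IsFiniteMeasure ν
  tendsto_measure : ∀ F : C(MarkovShift τ, ℝ),
    Tendsto (fun k => ∫ z, F z ∂(approxMeasure R s A a x f c (t k))) atTop (𝓝 (∫ z, F z ∂ν))

end Density

end

end TwistedDecay

open TwistedDecay

namespace TwistedDecay

noncomputable section

/-! ### Combinatorics of the shift -/

section Words

variable {W : Type*} {τ : W → W → Prop}

/-! Everything rests on one cylinder estimate followed by Borel–Cantelli. Write `Q_t = φ_c[t] ∗ f`.
There is a constant `C` with `ν[x_0 ⋯ x_{n-1}] ≤ C γ⁻ⁿ R_n(x) Υ(s(x_0 ⋯ x_{n-1}))`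
(`IsTwistedLimit.exists_measure_cylinder_le`). To see this, split each long word of the cylinder as
`v = x_0 ⋯ x_{n-1} v'` and delete the prefix. Bounded distortion takes out the factor `R_n(x)`, the
weight changes by `t⁻ⁿ` and, since `c` is slowly increasing, by at most a factor 2; the group
element `g = s(x_0 ⋯ x_{n-1})` comes out as a translation. The remaining sum over `v'` has an
arbitrary first letter. By transitivity of the skew product it is dominated coordinatewise by a
multiple of `Q_t`, because a connecting word of value 1 can be put in front. What is left is `⟨ρ(g)
Q_t, Q_t⟩ / ⟨Q_t, Q_t⟩`, which tends to `Υ(g)`. The words of bounded length contribute `O(1 /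
‖Q_t‖)`, which tends to 0 by divergence at `γ`.

A set of the form `Υ(s(x_0 ⋯ x_{n-1})) < ψ_n(s(x_0 ⋯ x_{n-1}))` is a union of cylinders of length
`n`, so its measure is at most `C ∑_w γ⁻ⁿ R_n(w) ψ_n(s(w))`; if these bounds are summable in `n`,
almost every point leaves the sets (`ae_eventually_le_of_tsum_ne_top`). For `ψ_n(g) = (1-ε)ⁿ ⟨ρ(g)
f, v⟩` the double sum is, up to a constant, at most `⟨φ[t] ∗ f, v⟩` with `t = γ/(1-ε) > γ`, hence
finite (`tsum_words_inner_ne_top`). For `ψ_n = n⁻² γⁿ` it is at most `∑ n⁻² ∑_w R_n(w)`, and the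
inner sums are bounded because the pressure is zero (`exists_wordSum_le`). Dropping the letter `x_0`
costs a constant, since `Υ(gh) ≤ C_g Υ(h)` and the alphabet is finite by compactness.

Existence is Patterson's argument: a slowly increasing weight forces divergence at `γ`
(`exists_slowlyIncreasing_normSq_eq_top`), and compactness yields a convergent subsequence of
coefficients and measures. Positivity of the vectors allows the sums to be handled in `ℝ≥0∞`,
coordinate by coordinate, without prior summability questions. -/

theorem shift_apply (y : MarkovShift τ) (i : ℕ) : (shift y).1 i = y.1 (i + 1) := rfl

theorem shift_iterate_apply (k : ℕ) (y : MarkovShift τ) (i : ℕ) :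
    (shift^[k] y).1 i = y.1 (i + k) := by
  induction k generalizing y with
  | zero => rfl
  | succ k ih => rw [Function.iterate_succ_apply, ih, shift_apply]; congr 1

/-- The point `p₀ ⋯ p_{k-1} y`, defined when `p_k = y₀`. -/
def glue (p : MarkovShift τ) (k : ℕ) (y : MarkovShift τ) (h : p.1 k = y.1 0) : MarkovShift τ :=
  ⟨fun i => if i < k then p.1 i else y.1 (i - k), fun i => by
    rcases lt_trichotomy (i + 1) k with hi | hi | hi
    · simpa [hi, (Nat.lt_succ_self i).trans hi] using p.2 i
    · have := p.2 i
      rw [hi, h] at this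
      simpa [hi, show i < k by omega] using this
    · have := y.2 (i - k)
      rw [show i - k + 1 = i + 1 - k by omega] at this
      simpa [show ¬ i < k by omega, show ¬ i + 1 < k by omega] using this⟩

theorem glue_apply_lt {p y : MarkovShift τ} {k : ℕ} (h : p.1 k = y.1 0) {i : ℕ} (hi : i < k) :
    (glue p k y h).1 i = p.1 i := if_pos hi

theorem glue_apply_le {p y : MarkovShift τ} {k : ℕ} (h : p.1 k = y.1 0) {i : ℕ} (hi : i ≤ k) :
    (glue p k y h).1 i = p.1 i := by
  rcases hi.lt_or_eq with hi | rfl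
  · exact if_pos hi
  · simp [glue, h]

theorem glue_apply_add {p y : MarkovShift τ} {k : ℕ} (h : p.1 k = y.1 0) (i : ℕ) :
    (glue p k y h).1 (i + k) = y.1 i := by
  simp [glue]

theorem shift_iterate_glue {p y : MarkovShift τ} {k : ℕ} (h : p.1 k = y.1 0) :
    shift^[k] (glue p k y h) = y := by
  apply Subtype.ext
  funext i
  rw [shift_iterate_apply, glue_apply_add]

theorem ext_of_prefix_of_shift {y z : MarkovShift τ} (k : ℕ) (h : ∀ i < k, y.1 i = z.1 i)
    (hs : shift^[k] y = shift^[k] z) : y = z := by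
  apply Subtype.ext
  funext i
  rcases lt_or_ge i k with hi | hi
  · exact h i hi
  · have := congrArg (fun u : MarkovShift τ => u.1 (i - k)) hs
    simpa [shift_iterate_apply, Nat.sub_add_cancel hi] using this

/-- The periodic point with period word `y₀ ⋯ y_{n-1}`, defined when `y_n = y₀`. -/
def periodize (y : MarkovShift τ) (n : ℕ) (hn : 0 < n) (h : y.1 n = y.1 0) : MarkovShift τ :=
  ⟨fun i => y.1 (i % n), fun i => by
    have hlt := Nat.mod_lt i hn
    change τ (y.1 (i % n)) (y.1 ((i + 1) % n))
    rcases Nat.lt_or_ge (i % n + 1) n with h1 | h1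
    · rw [Nat.add_mod, Nat.mod_eq_of_lt (a := 1) (by omega), Nat.mod_eq_of_lt h1]
      exact y.2 _
    · have h2 : i % n + 1 = n := by omega
      have h3 : (i + 1) % n = 0 := by
        rw [← Nat.mod_add_mod, h2, Nat.mod_self]
      rw [h3, ← h]
      have := y.2 (i % n)
      rwa [h2] at this⟩

theorem periodize_apply_le {y : MarkovShift τ} {n : ℕ} (hn : 0 < n) (h : y.1 n = y.1 0) {i : ℕ}
    (hi : i ≤ n) : (periodize y n hn h).1 i = y.1 i := by
  rcases hi.lt_or_eq with hi | rfl
  · simp [periodize, Nat.mod_eq_of_lt hi]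
  · simp [periodize, h]

theorem shift_iterate_periodize {y : MarkovShift τ} {n : ℕ} (hn : 0 < n) (h : y.1 n = y.1 0) :
    shift^[n] (periodize y n hn h) = periodize y n hn h := by
  apply Subtype.ext
  funext i
  rw [shift_iterate_apply]
  simp [periodize]

theorem periodic_ext {y z : MarkovShift τ} {n : ℕ} (hn : 0 < n) (hy : shift^[n] y = y)
    (hz : shift^[n] z = z) (h : ∀ i < n, y.1 i = z.1 i) : y = z := by
  apply Subtype.ext
  funext i
  induction i using Nat.strong_induction_on with
  | _ i ih =>
    rcases lt_or_ge i n with hi | hi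
    · exact h i hi
    · have h1 := shift_iterate_apply n y (i - n)
      have h2 := shift_iterate_apply n z (i - n)
      rw [hy, Nat.sub_add_cancel hi] at h1
      rw [hz, Nat.sub_add_cancel hi] at h2
      rw [← h1, ← h2]
      exact ih _ (by omega)

theorem birkhoffProd_succ (R : MarkovShift τ → ℝ) (n : ℕ) (y : MarkovShift τ) :
    birkhoffProd R (n + 1) y = R y * birkhoffProd R n (shift y) := by
  rw [birkhoffProd, Finset.prod_range_succ', mul_comm]
  rfl

theorem birkhoffProd_add (R : MarkovShift τ → ℝ) (k n : ℕ) (y : MarkovShift τ) :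
    birkhoffProd R (k + n) y = birkhoffProd R k y * birkhoffProd R n (shift^[k] y) := by
  rw [birkhoffProd, Finset.prod_range_add]
  congr 1
  refine Finset.prod_congr rfl fun i _ => ?_
  rw [← Function.iterate_add_apply, add_comm]

theorem birkhoffProd_pos {R : MarkovShift τ → ℝ} (hR : ∀ y, 0 < R y) (n : ℕ)
    (y : MarkovShift τ) : 0 < birkhoffProd R n y := Finset.prod_pos fun _ _ => hR _

theorem pow_le_birkhoffProd {R : MarkovShift τ → ℝ} {r : ℝ} (hr : 0 < r) (hR : ∀ y, r ≤ R y)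
    (n : ℕ) (y : MarkovShift τ) : r ^ n ≤ birkhoffProd R n y := by
  calc r ^ n = ∏ i ∈ Finset.range n, r := by simp
    _ ≤ _ := Finset.prod_le_prod (fun _ _ => hr.le) fun _ _ => hR _

theorem birkhoffProd_le_pow {R : MarkovShift τ → ℝ} {r : ℝ} (hR0 : ∀ y, 0 < R y)
    (hR : ∀ y, R y ≤ r) (n : ℕ) (y : MarkovShift τ) : birkhoffProd R n y ≤ r ^ n := by
  calc _ ≤ ∏ i ∈ Finset.range n, r := Finset.prod_le_prod (fun _ _ => (hR0 _).le) fun _ _ => hR _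
    _ = _ := by simp

variable {G : Type*} [Group G]

theorem wordValue_zero (s : W → G) (y : MarkovShift τ) (j : ℕ) : wordValue s y j 0 = 1 := rfl

theorem wordValue_shift (s : W → G) (y : MarkovShift τ) (j n : ℕ) :
    wordValue s y j n = wordValue s (shift^[j] y) 0 n := by
  simp only [wordValue, shift_iterate_apply, Nat.zero_add, Nat.add_comm _ j]

theorem wordValue_succ (s : W → G) (y : MarkovShift τ) (n : ℕ) :
    wordValue s y 0 (n + 1) = s (y.1 0) * wordValue s (shift y) 0 n := by
  simp [wordValue, List.ofFn_succ, shift_apply]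

theorem wordValue_add (s : W → G) (y : MarkovShift τ) (k n : ℕ) :
    wordValue s y 0 (k + n) = wordValue s y 0 k * wordValue s (shift^[k] y) 0 n := by
  induction k generalizing y with
  | zero => simp [wordValue_zero]
  | succ k ih =>
    rw [show k + 1 + n = k + n + 1 by omega, wordValue_succ, ih, wordValue_succ, mul_assoc]
    rfl

theorem wordValue_congr (s : W → G) {y z : MarkovShift τ} {j n : ℕ}
    (h : ∀ i < j + n, y.1 i = z.1 i) : wordValue s y j n = wordValue s z j n := by
  unfold wordValue
  congr 2
  funext i
  rw [h _ (by omega)]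

theorem skewProduct_iterate (s : W → G) (n : ℕ) (y : MarkovShift τ) (g : G) :
    (skewProduct s)^[n] (y, g) = (shift^[n] y, (wordValue s y 0 n)⁻¹ * g) := by
  induction n generalizing y g with
  | zero => simp [wordValue_zero]
  | succ n ih =>
    rw [Function.iterate_succ_apply, wordValue_succ]
    simp only [skewProduct]
    rw [ih]
    simp [mul_assoc]

/-! ### Finiteness of the alphabet and connecting words -/

section Topology

variable [TopologicalSpace W] [DiscreteTopology W]

theorem isClopen_cylinder (z : ℕ → W) (n : ℕ) :
    IsClopen {y : MarkovShift τ | ∀ i < n, y.1 i = z i} := by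
  have : {y : MarkovShift τ | ∀ i < n, y.1 i = z i} =
      ⋂ i ∈ Set.Iio n, (fun y : MarkovShift τ => y.1 i) ⁻¹' {z i} := by
    ext y; simp
  rw [this]
  refine (Set.finite_Iio n).isClopen_biInter fun i _ => ?_
  exact (isClopen_discrete _).preimage ((continuous_apply i).comp continuous_subtype_val)

theorem isOpen_letter (B : W) : IsOpen {y : MarkovShift τ | y.1 0 = B} := by
  have : {y : MarkovShift τ | y.1 0 = B} = (fun y : MarkovShift τ => y.1 0) ⁻¹' {B} := rfl
  rw [this]
  exact (isOpen_discrete _).preimage ((continuous_apply 0).comp continuous_subtype_val)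

theorem finite_alphabet [CompactSpace (MarkovShift τ)]
    (hlive : ∀ B : W, ∃ y : MarkovShift τ, y.1 0 = B) : Finite W := by
  have hc : Continuous (fun y : MarkovShift τ => y.1 0) :=
    (continuous_apply 0).comp continuous_subtype_val
  have hr : IsCompact (Set.range (fun y : MarkovShift τ => y.1 0)) := isCompact_range hc
  rw [Set.range_eq_univ.2 hlive] at hr
  exact Set.finite_univ_iff.1 (hr.finite_of_discrete)

/-- Any two letters are joined by a word of prescribed value. -/
theorem exists_connector {s : W → G} (hlive : ∀ B : W, ∃ y : MarkovShift τ, y.1 0 = B)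
    (htrans : IsTransitiveSkew τ s) (B E : W) (g : G) :
    ∃ (p : MarkovShift τ) (k : ℕ), p.1 0 = B ∧ p.1 k = E ∧ wordValue s p 0 k = g := by
  -- Travelling from the fibre over `g` to the fibre over `1` forces the word read on the way to
  -- have value `g`.
  obtain ⟨n, q, ⟨⟨y, g'⟩, ⟨hy, hg'⟩, rfl⟩, hq⟩ :=
    htrans _ _ (isOpen_letter B) (isOpen_letter E) (hlive B) (hlive E) g 1
  rw [skewProduct_iterate] at hq
  obtain ⟨h1, h2⟩ := hq
  simp only [Set.mem_ofPred_eq, shift_iterate_apply, Nat.zero_add, Set.mem_singleton_iff]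
    at h1 h2 hg' hy
  refine ⟨y, n, hy, h1, ?_⟩
  rw [← hg']
  exact (inv_mul_eq_one.1 h2)

/-- All pairs of letters are joined by words of one common positive length. -/
theorem exists_uniform_connector [Finite W]
    (hlive : ∀ B : W, ∃ y : MarkovShift τ, y.1 0 = B) (hmix : IsMixing τ) :
    ∃ M : ℕ, 0 < M ∧ ∀ m ≥ M, ∀ B E : W, ∃ p : MarkovShift τ, p.1 0 = B ∧ p.1 m = E := by
  have h : ∀ q : W × W, ∃ N, ∀ n ≥ N, ∃ p : MarkovShift τ, p.1 0 = q.1 ∧ p.1 n = q.2 := by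
    rintro ⟨B, E⟩
    obtain ⟨N, hN⟩ := hmix _ _ (isOpen_letter B) (isOpen_letter E) (hlive B) (hlive E)
    refine ⟨N, fun n hn => ?_⟩
    obtain ⟨_, ⟨y, hy, rfl⟩, h2⟩ := hN n hn
    simp only [Set.mem_ofPred_eq, shift_iterate_apply, Nat.zero_add] at h2 hy
    exact ⟨y, hy, h2⟩
  choose N hN using h
  have := Fintype.ofFinite W
  refine ⟨Finset.univ.sup N + 1, by omega, fun m hm B E => hN (B, E) m ?_⟩
  have := Finset.le_sup (f := N) (Finset.mem_univ (B, E))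
  omega

end Topology

/-! ### Bounds for the potential -/

/-- Hölder control begins at two common letters, so on each two-letter cylinder `log R` is compared
with its value at one chosen point; there are finitely many such cylinders. -/
theorem exists_bounds [Finite W] {R : MarkovShift τ → ℝ}
    (hR : LocallyHolder fun y => Real.log (R y)) :
    ∃ L : ℝ, 0 < L ∧ ∀ y, |Real.log (R y)| ≤ L := by
  obtain ⟨C, θ, h0, h1, h⟩ := hR
  have := Fintype.ofFinite W
  classical
  let M : W × W → ℝ := fun q =>
    if hq : ∃ y : MarkovShift τ, y.1 0 = q.1 ∧ y.1 1 = q.2 then |Real.log (R hq.choose)| else 0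
  have hM : ∀ q, 0 ≤ M q := fun q => by
    dsimp only [M]; split_ifs <;> positivity
  refine ⟨∑ q, M q + |C| * θ ^ 2 + 1, by
    have := Finset.sum_nonneg (s := Finset.univ) fun q _ => hM q
    positivity, fun y => ?_⟩
  have hy : ∃ z : MarkovShift τ, z.1 0 = y.1 0 ∧ z.1 1 = y.1 1 := ⟨y, rfl, rfl⟩
  have h2 := h 2 (by norm_num) y hy.choose (by
    intro i hi
    interval_cases i
    · exact hy.choose_spec.1.symm
    · exact hy.choose_spec.2.symm)
  have h3 : M (y.1 0, y.1 1) = |Real.log (R hy.choose)| := dif_pos hy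
  have h4 : M (y.1 0, y.1 1) ≤ ∑ q, M q :=
    Finset.single_le_sum (f := M) (fun q _ => hM q) (Finset.mem_univ _)
  have h5 : C * θ ^ 2 ≤ |C| * θ ^ 2 := by gcongr; exact le_abs_self C
  have h6 := abs_sub_abs_le_abs_sub (Real.log (R y)) (Real.log (R hy.choose))
  simp only at h2
  linarith

/-- Along the orbit the number of common letters falls from `n` to `1`, so the variations of `log R`
add up to at most a geometric series. -/
theorem exists_distortion [Finite W] {R : MarkovShift τ → ℝ} (hRpos : ∀ y, 0 < R y)
    (hR : LocallyHolder fun y => Real.log (R y)) :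
    ∃ D : ℝ, 0 < D ∧ ∀ (n : ℕ) (y z : MarkovShift τ), (∀ i < n, y.1 i = z.1 i) →
      birkhoffProd R n y ≤ D * birkhoffProd R n z := by
  obtain ⟨L, hL0, hL⟩ := exists_bounds hR
  obtain ⟨C, θ, h0, h1, h⟩ := hR
  -- The second summand covers points with just one common letter, where only the bound `|log R| ≤
  -- L` is available.
  let K : ℝ := |C| + 2 * L / θ
  have hK : 0 ≤ K := by positivity
  have hvar : ∀ n : ℕ, 0 < n → ∀ y z : MarkovShift τ, (∀ i < n, y.1 i = z.1 i) →
      Real.log (R y) - Real.log (R z) ≤ K * θ ^ n := by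
    intro n hn y z hyz
    rcases Nat.lt_or_ge 1 n with h2 | h2
    · have h3 := (le_abs_self _).trans (h n h2 y z hyz)
      have h4 : C ≤ K := (le_abs_self C).trans (le_add_of_nonneg_right (by positivity))
      exact h3.trans (by gcongr)
    · obtain rfl : n = 1 := by omega
      have h5 : K * θ ^ 1 = |C| * θ + 2 * L := by
        dsimp only [K]; field_simp
      rw [h5]
      have h6 := abs_le.1 (hL y)
      have h7 := abs_le.1 (hL z)
      have : 0 ≤ |C| * θ := by positivity
      linarith
  have hstep : ∀ (n : ℕ) (y z : MarkovShift τ), (∀ i < n, y.1 i = z.1 i) →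
      birkhoffProd R n y ≤ Real.exp (K * ∑ i ∈ Finset.range n, θ ^ (i + 1)) *
        birkhoffProd R n z := by
    intro n
    induction n with
    | zero => intro y z _; simp [birkhoffProd]
    | succ n ih =>
      intro y z hyz
      rw [birkhoffProd_succ, birkhoffProd_succ, Finset.sum_range_succ, mul_add, Real.exp_add]
      have h2 := ih (shift y) (shift z) fun i hi => hyz (i + 1) (by omega)
      have h3 : R y ≤ Real.exp (K * θ ^ (n + 1)) * R z := by
        have := hvar (n + 1) (by omega) y z hyz
        rw [← Real.exp_log (hRpos y)]
        conv_rhs => rw [← Real.exp_log (hRpos z), ← Real.exp_add]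
        exact Real.exp_le_exp.2 (by linarith)
      calc R y * birkhoffProd R n (shift y)
          ≤ (Real.exp (K * θ ^ (n + 1)) * R z) *
            (Real.exp (K * ∑ i ∈ Finset.range n, θ ^ (i + 1)) * birkhoffProd R n (shift z)) :=
            mul_le_mul h3 h2 (birkhoffProd_pos hRpos _ _).le (by have := hRpos z; positivity)
        _ = _ := by ring
  refine ⟨Real.exp (K * (1 - θ)⁻¹), Real.exp_pos _, fun n y z hyz => ?_⟩
  refine (hstep n y z hyz).trans ?_
  have hp := (birkhoffProd_pos hRpos n z).le
  gcongr
  calc ∑ i ∈ Finset.range n, θ ^ (i + 1) ≤ ∑ i ∈ Finset.range n, θ ^ i :=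
        Finset.sum_le_sum fun i _ => pow_le_pow_of_le_one h0.le h1.le (by omega)
    _ ≤ ∑' i, θ ^ i := (summable_geometric_of_lt_one h0.le h1).sum_le_tsum _
        fun i _ => by positivity
    _ = _ := tsum_geometric_of_lt_one h0.le h1

end Words

/-! ### Word sums and pressure -/

section Pressure

variable {W : Type*} {τ : W → W → Prop}

variable (τ) in
/-- The admissible words of length `n`. -/
abbrev Words (n : ℕ) : Type _ :=
  {u : Fin n → W // ∃ z : MarkovShift τ, ∀ i : Fin n, z.1 i = u i}

/-- A point of `Σ⁺` that starts with the word `u`. -/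
def Words.rep {n : ℕ} (u : Words τ n) : MarkovShift τ := u.2.choose

theorem Words.rep_apply {n : ℕ} (u : Words τ n) {i : ℕ} (hi : i < n) :
    u.rep.1 i = u.1 ⟨i, hi⟩ := u.2.choose_spec ⟨i, hi⟩

/-- The word formed by the first `n` letters of `z`. -/
def wordOf (z : MarkovShift τ) (n : ℕ) : Words τ n := ⟨fun i => z.1 i, z, fun _ => rfl⟩

theorem Words.ext_rep {n : ℕ} {u v : Words τ n} (h : ∀ i < n, u.rep.1 i = v.rep.1 i) : u = v := by
  apply Subtype.ext
  funext i
  rw [← u.rep_apply i.2, ← v.rep_apply i.2, h i i.2]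

theorem rep_wordOf (z : MarkovShift τ) {n i : ℕ} (hi : i < n) : (wordOf z n).rep.1 i = z.1 i :=
  (wordOf z n).rep_apply hi

/-- The sum of `R_n` over the points of period `n` in the cylinder `[B]`. -/
def perSum (R : MarkovShift τ → ℝ) (B : W) (n : ℕ) : ℝ≥0∞ :=
  ∑' y : {y : MarkovShift τ // y.1 0 = B ∧ shift^[n] y = y}, ENNReal.ofReal (birkhoffProd R n y.1)

/-- Two period words based at `B` concatenate to a period word based at `B`, injectively once the
two lengths are fixed; each of the two factors costs one distortion constant. -/
theorem perSum_mul_le {R : MarkovShift τ → ℝ} (hRpos : ∀ y, 0 < R y) {D : ℝ} (hD : 0 < D)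
    (hdist : ∀ (n : ℕ) (y z : MarkovShift τ), (∀ i < n, y.1 i = z.1 i) →
      birkhoffProd R n y ≤ D * birkhoffProd R n z) (B : W) {n m : ℕ} (hn : 0 < n) (hm : 0 < m) :
    perSum R B n * perSum R B m ≤ ENNReal.ofReal (D ^ 2) * perSum R B (n + m) := by
  have per : ∀ {k : ℕ} (y : {y : MarkovShift τ // y.1 0 = B ∧ shift^[k] y = y}), y.1.1 k = B := by
    intro k y
    have := shift_iterate_apply k y.1 0
    rw [y.2.2, y.2.1, Nat.zero_add] at this
    exact this.symm
  let φ : {y : MarkovShift τ // y.1 0 = B ∧ shift^[n] y = y} ×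
      {y : MarkovShift τ // y.1 0 = B ∧ shift^[m] y = y} → MarkovShift τ :=
    fun p => glue p.1.1 n p.2.1 (by rw [per p.1, p.2.2.1])
  have φ0 : ∀ p, (φ p).1 0 = B := fun p => by
    rw [glue_apply_lt _ hn, p.1.2.1]
  have φn : ∀ p, (φ p).1 (n + m) = (φ p).1 0 := fun p => by
    rw [φ0, Nat.add_comm, glue_apply_add, per]
  have hnm : 0 < n + m := by omega
  let ψ : {y : MarkovShift τ // y.1 0 = B ∧ shift^[n] y = y} ×
      {y : MarkovShift τ // y.1 0 = B ∧ shift^[m] y = y} →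
      {y : MarkovShift τ // y.1 0 = B ∧ shift^[n + m] y = y} :=
    fun p => ⟨periodize (φ p) (n + m) hnm (φn p), by
      rw [periodize_apply_le hnm _ (by omega), φ0], shift_iterate_periodize hnm _⟩
  have ψl : ∀ p, ∀ i < n, (ψ p).1.1 i = p.1.1.1 i := fun p i hi => by
    rw [periodize_apply_le hnm _ (by omega), glue_apply_lt _ hi]
  have ψr : ∀ p, ∀ i < m, (shift^[n] (ψ p).1).1 i = p.2.1.1 i := fun p i hi => by
    rw [shift_iterate_apply, periodize_apply_le hnm _ (by omega), glue_apply_add]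
  have ψinj : Function.Injective ψ := by
    rintro p q h
    refine Prod.ext (Subtype.ext (periodic_ext hn p.1.2.2 q.1.2.2 fun i hi => ?_))
      (Subtype.ext ?_)
    · rw [← ψl p i hi, ← ψl q i hi, h]
    · refine periodic_ext hm p.2.2.2 q.2.2.2 fun i hi => ?_
      rw [← ψr p i hi, ← ψr q i hi, h]
  calc perSum R B n * perSum R B m
      = ∑' p : {y : MarkovShift τ // y.1 0 = B ∧ shift^[n] y = y} ×
        {y : MarkovShift τ // y.1 0 = B ∧ shift^[m] y = y},
        ENNReal.ofReal (birkhoffProd R n p.1.1) * ENNReal.ofReal (birkhoffProd R m p.2.1) := by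
        refine Eq.trans ?_ (ENNReal.tsum_prod (f := fun
          (y : {y : MarkovShift τ // y.1 0 = B ∧ shift^[n] y = y})
          (z : {y : MarkovShift τ // y.1 0 = B ∧ shift^[m] y = y}) =>
          ENNReal.ofReal (birkhoffProd R n y.1) * ENNReal.ofReal (birkhoffProd R m z.1))).symm
        rw [perSum, perSum, ← ENNReal.tsum_mul_right]
        simp_rw [ENNReal.tsum_mul_left]
    _ ≤ ∑' p, ENNReal.ofReal (D ^ 2) * ENNReal.ofReal (birkhoffProd R (n + m) (ψ p).1) := by
        refine ENNReal.tsum_le_tsum fun p => ?_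
        rw [← ENNReal.ofReal_mul (birkhoffProd_pos hRpos _ _).le,
          ← ENNReal.ofReal_mul (by positivity)]
        refine ENNReal.ofReal_le_ofReal ?_
        have h1 := hdist n p.1.1 (ψ p).1 fun i hi => (ψl p i hi).symm
        have h2 := hdist m p.2.1 (shift^[n] (ψ p).1) fun i hi => (ψr p i hi).symm
        rw [birkhoffProd_add]
        calc _ ≤ _ := mul_le_mul h1 h2 (birkhoffProd_pos hRpos _ _).le
              (by have := birkhoffProd_pos hRpos n (ψ p).1; positivity)
          _ = _ := by ring
    _ ≤ ENNReal.ofReal (D ^ 2) * perSum R B (n + m) := by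
        rw [ENNReal.tsum_mul_left]
        gcongr
        exact ENNReal.tsum_comp_le_tsum_of_injective ψinj
          fun y => ENNReal.ofReal (birkhoffProd R (n + m) y.1)

theorem perSum_pow_le {R : MarkovShift τ → ℝ} (hRpos : ∀ y, 0 < R y) {D : ℝ} (hD : 0 < D)
    (hdist : ∀ (n : ℕ) (y z : MarkovShift τ), (∀ i < n, y.1 i = z.1 i) →
      birkhoffProd R n y ≤ D * birkhoffProd R n z) (B : W) {n : ℕ} (hn : 0 < n) (k : ℕ) :
    perSum R B n ^ (k + 1) ≤ ENNReal.ofReal (D ^ 2) ^ k * perSum R B (n * (k + 1)) := by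
  induction k with
  | zero => simp
  | succ k ih =>
    calc perSum R B n ^ (k + 1 + 1) = perSum R B n ^ (k + 1) * perSum R B n := pow_succ _ _
      _ ≤ (ENNReal.ofReal (D ^ 2) ^ k * perSum R B (n * (k + 1))) * perSum R B n := by gcongr
      _ = ENNReal.ofReal (D ^ 2) ^ k * (perSum R B (n * (k + 1)) * perSum R B n) := mul_assoc _ _ _
      _ ≤ ENNReal.ofReal (D ^ 2) ^ k *
          (ENNReal.ofReal (D ^ 2) * perSum R B (n * (k + 1) + n)) := by
        exact mul_le_mul_right (perSum_mul_le hRpos hD hdist B (by positivity) hn) _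
      _ = _ := by rw [← mul_assoc, ← pow_succ]; rfl

/-- By almost supermultiplicativity, a single period sum exceeding `D ^ 2` would force exponential
growth along the multiples of `n`, hence positive pressure. -/
theorem perSum_le {R : MarkovShift τ → ℝ} (hRpos : ∀ y, 0 < R y) {D : ℝ} (hD : 1 ≤ D)
    (hdist : ∀ (n : ℕ) (y z : MarkovShift τ), (∀ i < n, y.1 i = z.1 i) →
      birkhoffProd R n y ≤ D * birkhoffProd R n z) (B : W) (hP : gurevicPressure R B = 0) {n : ℕ}
    (hn : 0 < n) : perSum R B n ≤ ENNReal.ofReal (D ^ 2) := by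
  have hD0 : 0 < D := by linarith
  by_contra! hlt
  obtain ⟨e, he1, he2⟩ := ENNReal.lt_iff_exists_nnreal_btwn.1 hlt
  have he : D ^ 2 < (e : ℝ) := by
    rw [← ENNReal.ofReal_coe_nnreal] at he1
    exact (ENNReal.ofReal_lt_ofReal_iff_of_nonneg (by positivity)).1 he1
  set b : ℝ := (e : ℝ) / D ^ 2 with hb
  have hb1 : 1 < b := by rw [hb, one_lt_div (by positivity)]; exact he
  have hlog : 0 < Real.log b := Real.log_pos hb1
  have hlow : ∀ k : ℕ, ENNReal.ofReal (b ^ (k + 1)) ≤ perSum R B (n * (k + 1)) := by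
    intro k
    have h1 : ENNReal.ofReal ((e : ℝ) ^ (k + 1)) ≤
        ENNReal.ofReal ((D ^ 2) ^ k) * perSum R B (n * (k + 1)) := by
      rw [ENNReal.ofReal_pow (by positivity), ENNReal.ofReal_pow (by positivity),
        ENNReal.ofReal_coe_nnreal]
      exact (pow_le_pow_left' he2.le _).trans (perSum_pow_le hRpos hD0 hdist B hn k)
    have h2 : b ^ (k + 1) ≤ ((D ^ 2) ^ k)⁻¹ * (e : ℝ) ^ (k + 1) := by
      rw [hb, div_pow, div_eq_inv_mul]
      gcongr
      · exact one_le_pow₀ hD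
      · omega
    calc ENNReal.ofReal (b ^ (k + 1))
        ≤ ENNReal.ofReal (((D ^ 2) ^ k)⁻¹) * ENNReal.ofReal ((e : ℝ) ^ (k + 1)) := by
          rw [← ENNReal.ofReal_mul (by positivity)]
          exact ENNReal.ofReal_le_ofReal h2
      _ ≤ ENNReal.ofReal (((D ^ 2) ^ k)⁻¹) *
          (ENNReal.ofReal ((D ^ 2) ^ k) * perSum R B (n * (k + 1))) := by gcongr
      _ = _ := by
          rw [← mul_assoc, ← ENNReal.ofReal_mul (by positivity), inv_mul_cancel₀ (by positivity),
            ENNReal.ofReal_one, one_mul]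
  have hle : ((Real.log b / n : ℝ) : EReal) ≤ gurevicPressure R B := by
    refine le_limsup_of_frequently_le ?_
    rw [frequently_atTop]
    intro N
    refine ⟨n * (N + 1), by nlinarith, ?_⟩
    have h3 := ENNReal.log_monotone (hlow N)
    rw [ENNReal.log_ofReal_of_pos (by positivity)] at h3
    have h4 : ((Real.log b / n : ℝ) : EReal) =
        ((Real.log (b ^ (N + 1)) : ℝ) : EReal) / ((n * (N + 1) : ℕ) : EReal) := by
      rw [← EReal.coe_natCast, ← EReal.coe_div, Real.log_pow]
      congr 1
      push_cast
      field_simp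
    rw [h4]
    exact EReal.div_le_div_right_of_nonneg (by positivity) h3
  rw [hP] at hle
  have : Real.log b / n ≤ 0 := by exact_mod_cast hle
  have h5 : 0 < Real.log b / n := by positivity
  linarith

/-- When the pressure vanishes, the sums of `R_n` over the words of length `n` are bounded. -/
theorem exists_wordSum_le [Finite W] [TopologicalSpace W] [DiscreteTopology W] [Nonempty W]
    (hlive : ∀ B : W, ∃ y : MarkovShift τ, y.1 0 = B) (hmix : IsMixing τ)
    {R : MarkovShift τ → ℝ} (hRpos : ∀ y, 0 < R y)
    (hR : LocallyHolder fun y => Real.log (R y)) (hP : ∀ B : W, gurevicPressure R B = 0) :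
    ∃ K : ℝ, 0 < K ∧ ∀ n : ℕ,
      ∑' u : Words τ n, ENNReal.ofReal (birkhoffProd R n u.rep) ≤ ENNReal.ofReal K := by
  obtain ⟨D₀, hD₀, hdist₀⟩ := exists_distortion hRpos hR
  obtain ⟨L, hL, hbd⟩ := exists_bounds hR
  set D := max D₀ 1 with hDdef
  have hD : 1 ≤ D := le_max_right _ _
  have hD0 : 0 < D := by linarith
  have hdist : ∀ (n : ℕ) (y z : MarkovShift τ), (∀ i < n, y.1 i = z.1 i) →
      birkhoffProd R n y ≤ D * birkhoffProd R n z := fun n y z h =>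
    (hdist₀ n y z h).trans (by
      have := (birkhoffProd_pos hRpos n z).le
      gcongr
      exact le_max_left _ _)
  have hr : ∀ y, Real.exp (-L) ≤ R y := fun y => by
    rw [← Real.exp_log (hRpos y)]
    exact Real.exp_le_exp.2 (abs_le.1 (hbd y)).1
  set r := Real.exp (-L)
  have hr0 : 0 < r := Real.exp_pos _
  obtain ⟨M, hM, hconn⟩ := exists_uniform_connector hlive hmix
  choose conn hc0 hcM using hconn M le_rfl
  let B : W := Classical.arbitrary W
  refine ⟨D * (r ^ (2 * M))⁻¹ * D ^ 2, by positivity, fun n => ?_⟩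
  -- Each word is completed to a loop at `B` by `M` letters on either side. The return path starts
  -- at the letter that follows the word in its representative. The added letters cost at most `r ^
  -- (2 * M)`.
  let z₁ : Words τ n → MarkovShift τ := fun u => glue u.rep n (conn (u.rep.1 n) B) (hc0 _ _).symm
  have z₁0 : ∀ u, (z₁ u).1 0 = u.rep.1 0 := fun u => glue_apply_le _ (Nat.zero_le _)
  let z₂ : Words τ n → MarkovShift τ := fun u =>
    glue (conn B (u.rep.1 0)) M (z₁ u) (by rw [hcM, z₁0])
  have z₂0 : ∀ u, (z₂ u).1 0 = B := fun u => by rw [glue_apply_lt _ hM, hc0]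
  have z₂l : ∀ u, (z₂ u).1 (M + n + M) = (z₂ u).1 0 := fun u => by
    rw [z₂0, glue_apply_add, glue_apply_add, hcM]
  have hpos : 0 < M + n + M := by omega
  let ψ : Words τ n → {y : MarkovShift τ // y.1 0 = B ∧ shift^[M + n + M] y = y} := fun u =>
    ⟨periodize (z₂ u) _ hpos (z₂l u), by rw [periodize_apply_le hpos _ (by omega), z₂0],
      shift_iterate_periodize hpos _⟩
  have hψ : ∀ u, ∀ i < n, (shift^[M] (ψ u).1).1 i = u.rep.1 i := fun u i hi => by
    rw [shift_iterate_apply, periodize_apply_le hpos _ (by omega), glue_apply_add,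
      glue_apply_lt _ hi]
  have ψinj : Function.Injective ψ := fun u v h => Words.ext_rep fun i hi => by
    rw [← hψ u i hi, ← hψ v i hi, h]
  have hle : ∀ u, birkhoffProd R n u.rep ≤
      D * (r ^ (2 * M))⁻¹ * birkhoffProd R (M + n + M) (ψ u).1 := fun u => by
    have h1 := hdist n u.rep (shift^[M] (ψ u).1) fun i hi => (hψ u i hi).symm
    rw [birkhoffProd_add, birkhoffProd_add]
    have h2 := pow_le_birkhoffProd hr0 hr M (ψ u).1
    have h3 := pow_le_birkhoffProd hr0 hr M (shift^[M + n] (ψ u).1)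
    have h4 := birkhoffProd_pos hRpos n (shift^[M] (ψ u).1)
    calc birkhoffProd R n u.rep ≤ D * birkhoffProd R n (shift^[M] (ψ u).1) := h1
      _ = D * (r ^ (2 * M))⁻¹ * (r ^ M * birkhoffProd R n (shift^[M] (ψ u).1) * r ^ M) := by
        rw [two_mul, pow_add]; field_simp
      _ ≤ _ := by
        have h5 := birkhoffProd_pos hRpos M (ψ u).1
        gcongr
  calc ∑' u : Words τ n, ENNReal.ofReal (birkhoffProd R n u.rep)
      ≤ ∑' u : Words τ n, ENNReal.ofReal (D * (r ^ (2 * M))⁻¹) *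
          ENNReal.ofReal (birkhoffProd R (M + n + M) (ψ u).1) :=
        ENNReal.tsum_le_tsum fun u => by
          rw [← ENNReal.ofReal_mul (by positivity)]
          exact ENNReal.ofReal_le_ofReal (hle u)
    _ ≤ ENNReal.ofReal (D * (r ^ (2 * M))⁻¹) * perSum R B (M + n + M) := by
        rw [ENNReal.tsum_mul_left]
        gcongr
        exact ENNReal.tsum_comp_le_tsum_of_injective ψinj
          fun y => ENNReal.ofReal (birkhoffProd R (M + n + M) y.1)
    _ ≤ ENNReal.ofReal (D * (r ^ (2 * M))⁻¹) * ENNReal.ofReal (D ^ 2) := by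
        gcongr
        exact perSum_le hRpos hD hdist B (hP B) hpos
    _ = _ := by rw [← ENNReal.ofReal_mul (by positivity)]

end Pressure

/-! ### Non-negative vectors of `ℓ²` -/

section Cone

variable {α : Type*}

theorem ofReal_inner_eq_tsum {u v : lp (fun _ : α => ℝ) 2} (hu : ∀ q, 0 ≤ u q)
    (hv : ∀ q, 0 ≤ v q) :
    ENNReal.ofReal (inner ℝ u v) = ∑' q, ENNReal.ofReal (u q) * ENNReal.ofReal (v q) := by
  have h := lp.hasSum_inner (𝕜 := ℝ) u v
  have h1 : ∀ q, inner ℝ (u q) (v q) = u q * v q := fun q => by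
    simp [mul_comm]
  simp_rw [h1] at h
  rw [← h.tsum_eq, ENNReal.ofReal_tsum_of_nonneg (fun q => mul_nonneg (hu q) (hv q)) h.summable]
  simp_rw [ENNReal.ofReal_mul (hu _)]

theorem inner_nonneg_of_nonneg {u v : lp (fun _ : α => ℝ) 2} (hu : ∀ q, 0 ≤ u q)
    (hv : ∀ q, 0 ≤ v q) : 0 ≤ inner ℝ u v := by
  rw [lp.inner_eq_tsum]
  refine tsum_nonneg fun q => ?_
  simpa using mul_nonneg (hv q) (hu q)

theorem tsum_apply_of_summable {ι : Type*} {u : ι → lp (fun _ : α => ℝ) 2} (hs : Summable u)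
    (hu : ∀ i q, 0 ≤ u i q) (q : α) :
    ENNReal.ofReal ((∑' i, u i) q) = ∑' i, ENNReal.ofReal (u i q) := by
  have h := (hs.hasSum.mapL (lp.evalCLM ℝ (fun _ : α => ℝ) 2 q))
  have h' : HasSum (fun i => u i q) ((∑' i, u i) q) := h
  rw [← h'.tsum_eq, ENNReal.ofReal_tsum_of_nonneg (fun i => hu i q) h'.summable]

/-- Monotone convergence in the cone of non-negative vectors of `ℓ²`. -/
theorem summable_of_tsum_sq_ne_top {ι : Type*} {u : ι → lp (fun _ : α => ℝ) 2}
    (hu : ∀ i q, 0 ≤ u i q)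
    (h : ∑' q, (∑' i, ENNReal.ofReal (u i q)) ^ 2 ≠ ∞) : Summable u := by
  have hfin : ∀ q, ∑' i, ENNReal.ofReal (u i q) ≠ ∞ := fun q hq => by
    refine ENNReal.ne_top_of_tsum_ne_top h q ?_
    rw [hq]; simp
  let U : α → ℝ := fun q => (∑' i, ENNReal.ofReal (u i q)).toReal
  have hU : ∀ q, HasSum (fun i => u i q) (U q) := fun q => by
    have := ENNReal.hasSum_toReal (hfin q)
    rw [← ENNReal.tsum_toReal_eq (fun i => ENNReal.ofReal_ne_top)] at this
    simpa only [ENNReal.toReal_ofReal (hu _ q)] using this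
  have hU2 : Summable fun q => U q ^ 2 := by
    have := ENNReal.summable_toReal h
    simpa [U, ENNReal.toReal_pow] using this
  have h2 : 0 < (2 : ℝ≥0∞).toReal := by norm_num
  have hmem : Memℓp (E := fun _ : α => ℝ) U 2 := by
    rw [memℓp_gen_iff h2]
    simpa using hU2
  let Ul : lp (fun _ : α => ℝ) 2 := ⟨U, hmem⟩
  refine HasSum.summable (a := Ul) ?_
  unfold HasSum
  rw [tendsto_iff_norm_sub_tendsto_zero]
  have hnorm : ∀ S : Finset ι, ‖∑ i ∈ S, u i - Ul‖ = √(∑' q, (∑ i ∈ S, u i q - U q) ^ 2) := by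
    intro S
    rw [lp.norm_eq_tsum_rpow h2, Real.sqrt_eq_rpow]
    simp only [ENNReal.toReal_ofNat, Real.rpow_ofNat, Real.norm_eq_abs, sq_abs]
    congr 1
    refine tsum_congr fun q => ?_
    congr 1
    simp only [Ul, lp.coeFn_sub, Pi.sub_apply, lp.coeFn_sum, Finset.sum_apply]
  simp_rw [SummationFilter.unconditional_filter, hnorm]
  rw [← Real.sqrt_zero]
  refine (Real.continuous_sqrt.tendsto 0).comp ?_
  have hz : (0 : ℝ) = ∑' q : α, (U q - U q) ^ 2 := by simp
  rw [hz]
  -- Partial sums lie between `0` and `U`, so the squared differences are dominated by `U ^ 2`.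
  refine tendsto_tsum_of_dominated_convergence hU2 (fun q => ?_) (Eventually.of_forall ?_)
  · have := hU q
    unfold HasSum at this
    rw [SummationFilter.unconditional_filter] at this
    exact (this.sub_const (U q)).pow 2
  · intro S q
    have h0 : 0 ≤ ∑ i ∈ S, u i q := Finset.sum_nonneg fun i _ => hu i q
    have h1 : ∑ i ∈ S, u i q ≤ U q := sum_le_hasSum S (fun i _ => hu i q) (hU q)
    rw [Real.norm_eq_abs, abs_of_nonneg (sq_nonneg _)]
    nlinarith

theorem tsum_mul_le_mul_tsum_sq {u v : α → ℝ≥0∞} {C : ℝ≥0∞} (h : ∀ q, u q ≤ C * v q) :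
    ∑' q, u q * v q ≤ C * ∑' q, v q ^ 2 := by
  rw [← ENNReal.tsum_mul_left]
  refine ENNReal.tsum_le_tsum fun q => ?_
  rw [sq, ← mul_assoc]
  gcongr
  exact h q

end Cone

/-! ### Weighted series over the preimages of a point -/

/-- The comparisons by prefixing, cutting or completing words have this form: an injection between
words under which single terms are comparable. -/
theorem tsum_le_mul_tsum_of_injective {ι κ : Type*} {T : Set ι} {φ : T → κ}
    (hφ : Function.Injective φ) {u : ι → ℝ≥0∞} {v : κ → ℝ≥0∞} {C : ℝ≥0∞}
    (h0 : ∀ i ∉ T, u i = 0) (h : ∀ i : T, u i ≤ C * v (φ i)) :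
    ∑' i, u i ≤ C * ∑' k, v k := by
  have h1 : ∑' i, u i = ∑' i : T, u i :=
    (tsum_subtype_eq_of_support_subset fun i hi => by
      by_contra hT; exact hi (h0 i hT)).symm
  rw [h1, ← ENNReal.tsum_mul_left]
  exact (ENNReal.tsum_le_tsum h).trans
    (ENNReal.tsum_comp_le_tsum_of_injective hφ fun k => C * v k)

section Series

variable {W : Type*} {τ : W → W → Prop} {G : Type*} [Group G] {I : Type*} {H : I → Subgroup G}

/-- The words `v` with last letter `a`, represented by their lengths (minus one) and by the points
`vx`. -/
abbrev Preimage (a : W) (x : MarkovShift τ) : Type _ :=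
  Σ n : ℕ, {y : MarkovShift τ // shift^[n + 1] y = x ∧ y.1 n = a}

theorem Preimage.ext' {a : W} {x : MarkovShift τ} {p q : Preimage a x} (h : p.1 = q.1)
    (h' : p.2.1 = q.2.1) : p = q := by
  obtain ⟨n, y, hy⟩ := p
  obtain ⟨m, z, hz⟩ := q
  obtain rfl : n = m := h
  obtain rfl : y = z := h'
  rfl

/-- The contribution of one word to the coordinate `q` of a weighted series. -/
def seriesTerm (R : MarkovShift τ → ℝ) (s : W → G) (f : QuotientSum H) (b : ℕ → ℝ≥0∞)
    (q : Σ i, G ⧸ H i) (n : ℕ) (y : MarkovShift τ) : ℝ≥0∞ :=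
  b n * ENNReal.ofReal (birkhoffProd R n y) * ENNReal.ofReal (f ((wordValue s y 0 n)⁻¹ • q))

open Classical in
/-- The coordinate `q` of `∑ b_n R_n(vx) ρ(s(v)) f`, the sum being over the words `v` with last
letter `a` and `vx ∈ S`. -/
def series (R : MarkovShift τ → ℝ) (s : W → G) (a : W) (x : MarkovShift τ) (f : QuotientSum H)
    (b : ℕ → ℝ≥0∞) (S : Set (MarkovShift τ)) (q : Σ i, G ⧸ H i) : ℝ≥0∞ :=
  ∑' p : Preimage a x, if p.2.1 ∈ S then seriesTerm R s f b q (p.1 + 1) p.2.1 else 0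

variable {R : MarkovShift τ → ℝ} {s : W → G} {a : W} {x : MarkovShift τ} {f : QuotientSum H}

theorem series_le_mul {b b' : ℕ → ℝ≥0∞} {C : ℝ≥0∞} (h : ∀ n, b n ≤ C * b' n)
    {S S' : Set (MarkovShift τ)} (hS : S ⊆ S') (q : Σ i, G ⧸ H i) :
    series R s a x f b S q ≤ C * series R s a x f b' S' q := by
  classical
  rw [series, series, ← ENNReal.tsum_mul_left]
  refine ENNReal.tsum_le_tsum fun p => ?_
  by_cases hp : p.2.1 ∈ S
  · rw [if_pos hp, if_pos (hS hp), seriesTerm, seriesTerm, ← mul_assoc, ← mul_assoc]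
    gcongr
    exact h _
  · rw [if_neg hp]; exact zero_le

theorem series_mono {b b' : ℕ → ℝ≥0∞} (h : ∀ n, b n ≤ b' n)
    {S S' : Set (MarkovShift τ)} (hS : S ⊆ S') (q : Σ i, G ⧸ H i) :
    series R s a x f b S q ≤ series R s a x f b' S' q := by
  have := series_le_mul (R := R) (s := s) (a := a) (x := x) (f := f) (b := b) (b' := b') (C := 1)
    (by simpa using h) hS q
  simpa using this

theorem series_add (b b' : ℕ → ℝ≥0∞) (S : Set (MarkovShift τ)) (q : Σ i, G ⧸ H i) :
    series R s a x f (fun n => b n + b' n) S q =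
      series R s a x f b S q + series R s a x f b' S q := by
  classical
  rw [series, series, series, ← ENNReal.tsum_add]
  refine tsum_congr fun p => ?_
  split_ifs
  · simp only [seriesTerm]; ring
  · simp

theorem series_univ_eq [Fintype W] (b : ℕ → ℝ≥0∞) (q : Σ i, G ⧸ H i) :
    series R s a x f b Set.univ q = ∑ B : W, series R s a x f b {y | y.1 0 = B} q := by
  classical
  simp only [series]
  rw [← Summable.tsum_finsetSum fun _ _ => ENNReal.summable]
  refine tsum_congr fun p => ?_
  simp

/-- Prepending `k` letters multiplies the product of `R` by at least `r ^ k` and translates the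
coordinate by the value of the prefix. -/
theorem seriesTerm_shift_le {r : ℝ} (hr : 0 < r) (hRr : ∀ y, r ≤ R y)
    {y z : MarkovShift τ} {k m : ℕ} (hyz : ∀ i < k, y.1 i = z.1 i) {b b' : ℕ → ℝ≥0∞} {C : ℝ≥0∞}
    (hb : ∀ n, b n ≤ C * ENNReal.ofReal (r ^ k) * b' (n + k)) (q : Σ i, G ⧸ H i) :
    seriesTerm R s f b ((wordValue s z 0 k)⁻¹ • q) m (shift^[k] y) ≤
      C * seriesTerm R s f b' q (m + k) y := by
  have hprod : r ^ k * birkhoffProd R m (shift^[k] y) ≤ birkhoffProd R (k + m) y := by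
    rw [birkhoffProd_add]
    have := birkhoffProd_pos (fun y => hr.trans_le (hRr y)) m (shift^[k] y)
    gcongr
    exact pow_le_birkhoffProd hr hRr _ _
  have hz : wordValue s y 0 k = wordValue s z 0 k :=
    wordValue_congr s fun i hi => hyz i (by omega)
  rw [seriesTerm, seriesTerm, Nat.add_comm m k, wordValue_add, hz, mul_inv_rev, mul_smul,
    ← mul_assoc]
  refine mul_le_mul_left ?_ _
  calc b m * ENNReal.ofReal (birkhoffProd R m (shift^[k] y))
      ≤ (C * ENNReal.ofReal (r ^ k) * b' (m + k)) *
        ENNReal.ofReal (birkhoffProd R m (shift^[k] y)) := by gcongr; exact hb _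
    _ = C * b' (k + m) * ENNReal.ofReal (r ^ k * birkhoffProd R m (shift^[k] y)) := by
      rw [ENNReal.ofReal_mul (by positivity), Nat.add_comm k]; ring
    _ ≤ C * b' (k + m) * ENNReal.ofReal (birkhoffProd R (k + m) y) := by gcongr
    _ = _ := by ring

/-- Distortion replaces the factor of the prefix by its value at the fixed point `z`, so the
constant does not depend on the continuation of the word. -/
theorem seriesTerm_le_shift (hRpos : ∀ y, 0 < R y) {D : ℝ}
    (hdist : ∀ (n : ℕ) (y z : MarkovShift τ), (∀ i < n, y.1 i = z.1 i) →
      birkhoffProd R n y ≤ D * birkhoffProd R n z)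
    {y z : MarkovShift τ} {n m : ℕ} (hyz : ∀ i < n, y.1 i = z.1 i) {b b' : ℕ → ℝ≥0∞} {C : ℝ≥0∞}
    (hb : ∀ m, b (m + n) * ENNReal.ofReal (D * birkhoffProd R n z) ≤ C * b' m)
    (q : Σ i, G ⧸ H i) :
    seriesTerm R s f b q (m + n) y ≤
      C * seriesTerm R s f b' ((wordValue s z 0 n)⁻¹ • q) m (shift^[n] y) := by
  have hpos := birkhoffProd_pos hRpos m (shift^[n] y)
  have hprod : birkhoffProd R (n + m) y ≤
      (D * birkhoffProd R n z) * birkhoffProd R m (shift^[n] y) := by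
    rw [birkhoffProd_add]
    exact mul_le_mul_of_nonneg_right (hdist n _ z hyz) hpos.le
  have hz : wordValue s y 0 n = wordValue s z 0 n :=
    wordValue_congr s fun i hi => hyz i (by omega)
  rw [seriesTerm, seriesTerm, Nat.add_comm m n, wordValue_add, hz, mul_inv_rev, mul_smul,
    ← mul_assoc]
  refine mul_le_mul_left ?_ _
  calc b (n + m) * ENNReal.ofReal (birkhoffProd R (n + m) y)
      ≤ b (n + m) * ENNReal.ofReal
        ((D * birkhoffProd R n z) * birkhoffProd R m (shift^[n] y)) := by gcongr
    _ = b (m + n) * ENNReal.ofReal (D * birkhoffProd R n z) *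
        ENNReal.ofReal (birkhoffProd R m (shift^[n] y)) := by
      rw [Nat.add_comm n, ENNReal.ofReal_mul' hpos.le, mul_assoc]
    _ ≤ C * b' m * ENNReal.ofReal (birkhoffProd R m (shift^[n] y)) := by
      exact mul_le_mul_left (hb m) _
    _ = _ := by ring

/-- Prefixing a fixed word of value `g`. -/
theorem series_letter_translate_le {r : ℝ} (hr : 0 < r) (hRr : ∀ y, r ≤ R y)
    {z : MarkovShift τ} {k : ℕ} {b b' : ℕ → ℝ≥0∞} {C : ℝ≥0∞}
    (hb : ∀ n, b n ≤ C * ENNReal.ofReal (r ^ k) * b' (n + k)) (q : Σ i, G ⧸ H i) :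
    series R s a x f b {y | y.1 0 = z.1 k} ((wordValue s z 0 k)⁻¹ • q) ≤
      C * series R s a x f b' {y | y.1 0 = z.1 0} q := by
  classical
  let φ : {p : Preimage a x | p.2.1 ∈ {y : MarkovShift τ | y.1 0 = z.1 k}} → Preimage a x :=
    fun p => ⟨p.1.1 + k, glue z k p.1.2.1 p.2.symm, by
      rw [show p.1.1 + k + 1 = p.1.1 + 1 + k by omega, Function.iterate_add_apply,
        shift_iterate_glue, p.1.2.2.1], by rw [glue_apply_add, p.1.2.2.2]⟩
  have hs : ∀ p, shift^[k] (φ p).2.1 = p.1.2.1 := fun p => shift_iterate_glue p.2.symm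
  refine tsum_le_mul_tsum_of_injective (φ := φ) ?_ (fun p hp => if_neg hp) fun p => ?_
  · intro p p' h
    refine Subtype.ext (Preimage.ext' ?_ ?_)
    · have : p.1.1 + k = p'.1.1 + k := congrArg Sigma.fst h
      omega
    · rw [← hs p, ← hs p', h]
  · have h0 : (φ p).2.1 ∈ {y : MarkovShift τ | y.1 0 = z.1 0} :=
      glue_apply_le p.2.symm (Nat.zero_le _)
    have hp : p.1.2.1 ∈ {y : MarkovShift τ | y.1 0 = z.1 k} := p.2
    have := seriesTerm_shift_le (s := s) (f := f) hr hRr (y := (φ p).2.1) (z := z) (k := k)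
      (m := p.1.1 + 1) (fun i hi => glue_apply_lt p.2.symm hi) hb q
    rw [hs] at this
    rw [if_pos hp, if_pos h0]
    convert this using 3
    change p.1.1 + k + 1 = _
    omega

/-- Removing a fixed prefix. -/
theorem series_cylinder_le (hRpos : ∀ y, 0 < R y) {D : ℝ}
    (hdist : ∀ (n : ℕ) (y z : MarkovShift τ), (∀ i < n, y.1 i = z.1 i) →
      birkhoffProd R n y ≤ D * birkhoffProd R n z)
    {z : MarkovShift τ} {n : ℕ} {b b' : ℕ → ℝ≥0∞} {C : ℝ≥0∞} (hb0 : ∀ m ≤ n, b m = 0)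
    (hb : ∀ m, b (m + n) * ENNReal.ofReal (D * birkhoffProd R n z) ≤ C * b' m)
    (q : Σ i, G ⧸ H i) :
    series R s a x f b {y | ∀ i < n, y.1 i = z.1 i} q ≤
      C * series R s a x f b' Set.univ ((wordValue s z 0 n)⁻¹ • q) := by
  classical
  -- The word has length `p.1 + 1`, so `n ≤ p.1` leaves a nonempty word after the cut, still ending
  -- in `a`; shorter words carry coefficient `0` by `hb0`.
  let T : Set (Preimage a x) := {p | n ≤ p.1 ∧ ∀ i < n, p.2.1.1 i = z.1 i}
  let φ : T → Preimage a x := fun p => ⟨p.1.1 - n, shift^[n] p.1.2.1, by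
      have := p.2.1
      rw [← Function.iterate_add_apply, show p.1.1 - n + 1 + n = p.1.1 + 1 by omega,
        p.1.2.2.1], by
      have := p.2.1
      rw [shift_iterate_apply, Nat.sub_add_cancel this, p.1.2.2.2]⟩
  refine tsum_le_mul_tsum_of_injective (φ := φ) (T := T) ?_ (fun p hp => ?_) fun p => ?_
  · intro p p' h
    have h1 : p.1.1 - n = p'.1.1 - n := congrArg Sigma.fst h
    have h2 : shift^[n] p.1.2.1 = shift^[n] p'.1.2.1 :=
      congrArg (fun w : Preimage a x => w.2.1) h
    have h3 := p.2.1
    have h4 := p'.2.1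
    refine Subtype.ext (Preimage.ext' (by omega) (ext_of_prefix_of_shift n (fun i hi => ?_) h2))
    rw [p.2.2 i hi, p'.2.2 i hi]
  · by_cases hc : p.2.1 ∈ {y : MarkovShift τ | ∀ i < n, y.1 i = z.1 i}
    · have : ¬ n ≤ p.1 := fun h => hp ⟨h, hc⟩
      rw [if_pos hc, seriesTerm, hb0 _ (by omega)]
      simp
    · exact if_neg hc
  · have hn := p.2.1
    have hp : p.1.2.1 ∈ {y : MarkovShift τ | ∀ i < n, y.1 i = z.1 i} := p.2.2
    have := seriesTerm_le_shift (s := s) (f := f) hRpos hdist (y := p.1.2.1) (z := z)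
      (m := (φ p).1 + 1) p.2.2 hb q
    rw [if_pos hp, if_pos (Set.mem_univ _)]
    convert this using 2
    change _ = p.1.1 - n + 1 + n
    omega

theorem finite_preimage [Finite W] (n : ℕ) (P : MarkovShift τ → Prop) :
    Finite {y : MarkovShift τ // shift^[n] y = x ∧ P y} := by
  refine Finite.of_injective (β := Fin n → W) (fun y i => y.1.1 i) fun y z h => ?_
  refine Subtype.ext (ext_of_prefix_of_shift n (fun i hi => ?_) (y.2.1.trans z.2.1.symm))
  exact congrFun h ⟨i, hi⟩

/-- The total weight of finitely many lengths is finite. -/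
theorem tsum_weight_ne_top [Finite W] {b : ℕ → ℝ≥0∞} (hb : ∀ n, b n ≠ ∞) {N : ℕ}
    (hbN : ∀ n ≥ N, b n = 0) :
    ∑' p : Preimage a x, b (p.1 + 1) * ENNReal.ofReal (birkhoffProd R (p.1 + 1) p.2.1) ≠ ∞ := by
  have : Finite {p : Preimage a x // p.1 < N} := by
    have := fun n => finite_preimage (x := x) (n + 1) (fun y : MarkovShift τ => y.1 n = a)
    let φ : {p : Preimage a x // p.1 < N} →
      Σ n : Fin N, {y : MarkovShift τ // shift^[n.1 + 1] y = x ∧ y.1 n.1 = a} :=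
      fun p => ⟨⟨p.1.1, p.2⟩, p.1.2⟩
    refine Finite.of_injective φ fun p q h => Subtype.ext (Preimage.ext' ?_ ?_)
    · exact congrArg (fun w => (w.1 : ℕ)) h
    · exact congrArg (fun w : Σ n : Fin N,
        {y : MarkovShift τ // shift^[n.1 + 1] y = x ∧ y.1 n.1 = a} => w.2.1) h
  have h1 : ∑' p : Preimage a x, b (p.1 + 1) * ENNReal.ofReal (birkhoffProd R (p.1 + 1) p.2.1) =
      ∑' p : {p : Preimage a x | p.1 < N},
        b (p.1.1 + 1) * ENNReal.ofReal (birkhoffProd R (p.1.1 + 1) p.1.2.1) := by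
    refine (tsum_subtype_eq_of_support_subset (f := fun p : Preimage a x =>
      b (p.1 + 1) * ENNReal.ofReal (birkhoffProd R (p.1 + 1) p.2.1)) fun p hp => ?_).symm
    by_contra hN
    refine hp ?_
    have : N ≤ p.1 := not_lt.1 hN
    simp [hbN (p.1 + 1) (by omega)]
  rw [h1]
  have : Finite ↑{p : Preimage a x | p.1 < N} := this
  have := Fintype.ofFinite ↑{p : Preimage a x | p.1 < N}
  rw [tsum_fintype]
  exact ENNReal.sum_ne_top.2 fun p _ => ENNReal.mul_ne_top (hb _) ENNReal.ofReal_ne_top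

end Series

/-! ### The vectors `φ_c[t] ∗ f` as weighted series -/

theorem tsum_iSup_of_monotone {α : Type*} {u : ℕ → α → ℝ≥0∞} (hu : Monotone u) :
    ∑' q, ⨆ n, u n q = ⨆ n, ∑' q, u n q := by
  let _ : MeasurableSpace α := ⊤
  simp_rw [← lintegral_count]
  exact lintegral_iSup (fun n => measurable_from_top) hu

theorem tsum_subtype_eq_tsum_ite {α : Type*} (P : α → Prop) [DecidablePred P] (F : α → ℝ≥0∞) :
    ∑' y : {y // P y}, F y = ∑' y, if P y then F y else 0 :=
  (tsum_subtype {y | P y} F).trans (tsum_congr fun y => by simp [Set.indicator_apply])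

section PhiVec

variable {W : Type*} {τ : W → W → Prop} {G : Type*} [Group G] {I : Type*} {H : I → Subgroup G}

/-- The value at `h` of the `G`-density with coefficients `b`. -/
def groupWeight (R : MarkovShift τ → ℝ) (s : W → G) (A a : W) (x : MarkovShift τ) (b : ℕ → ℝ≥0∞)
    (h : G) : ℝ≥0∞ :=
  ∑' n : ℕ, ∑' y : {y : MarkovShift τ //
      shift^[n + 1] y = x ∧ y.1 0 = A ∧ y.1 (n + 1 - 1) = a ∧ wordValue s y 0 (n + 1) = h},
    b (n + 1) * ENNReal.ofReal (birkhoffProd R (n + 1) y.1)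

/-- The coefficients `t⁻ⁿ c_n`. -/
def coeff (c : ℕ → ℝ) (t : ℝ) (n : ℕ) : ℝ≥0∞ := ENNReal.ofReal ((t ^ n)⁻¹ * c n)

/-- The coefficients of index at most `N`. -/
def truncate (b : ℕ → ℝ≥0∞) (N n : ℕ) : ℝ≥0∞ := if n ≤ N then b n else 0

/-- The square of the norm of a weighted series. -/
def normSq (R : MarkovShift τ → ℝ) (s : W → G) (A a : W) (x : MarkovShift τ) (f : QuotientSum H)
    (b : ℕ → ℝ≥0∞) : ℝ≥0∞ :=
  ∑' q, series R s a x f b {y | y.1 0 = A} q ^ 2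

variable {R : MarkovShift τ → ℝ} {s : W → G} {A a : W} {x : MarkovShift τ} {f : QuotientSum H}

open Classical in
-- Fubini: words are grouped according to their value. This is the passage between the `G`-density
-- and sums over words.
theorem tsum_groupWeight_mul (b : ℕ → ℝ≥0∞) (F : G → ℝ≥0∞) :
    ∑' h, groupWeight R s A a x b h * F h =
      ∑' p : Preimage a x, if p.2.1.1 0 = A then
        b (p.1 + 1) * ENNReal.ofReal (birkhoffProd R (p.1 + 1) p.2.1) *
          F (wordValue s p.2.1 0 (p.1 + 1)) else 0 := by
  rw [ENNReal.tsum_sigma']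
  simp_rw [groupWeight, ← ENNReal.tsum_mul_right]
  rw [ENNReal.tsum_comm]
  refine tsum_congr fun n => ?_
  have h1 : ∀ h : G, ∑' y : {y : MarkovShift τ //
      shift^[n + 1] y = x ∧ y.1 0 = A ∧ y.1 (n + 1 - 1) = a ∧ wordValue s y 0 (n + 1) = h},
      b (n + 1) * ENNReal.ofReal (birkhoffProd R (n + 1) y.1) * F h =
      ∑' y : MarkovShift τ, if shift^[n + 1] y = x ∧ y.1 0 = A ∧ y.1 (n + 1 - 1) = a ∧
        wordValue s y 0 (n + 1) = h then
          b (n + 1) * ENNReal.ofReal (birkhoffProd R (n + 1) y) * F h else 0 := fun h =>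
    tsum_subtype_eq_tsum_ite (fun y : MarkovShift τ => shift^[n + 1] y = x ∧ y.1 0 = A ∧
        y.1 (n + 1 - 1) = a ∧ wordValue s y 0 (n + 1) = h)
      (fun y => b (n + 1) * ENNReal.ofReal (birkhoffProd R (n + 1) y) * F h)
  have h2 : (∑' y : {y : MarkovShift τ // shift^[n + 1] y = x ∧ y.1 n = a},
      if y.1.1 0 = A then b (n + 1) * ENNReal.ofReal (birkhoffProd R (n + 1) y.1) *
          F (wordValue s y.1 0 (n + 1)) else 0) =
      ∑' y : MarkovShift τ, if shift^[n + 1] y = x ∧ y.1 n = a then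
        (if y.1 0 = A then b (n + 1) * ENNReal.ofReal (birkhoffProd R (n + 1) y) *
          F (wordValue s y 0 (n + 1)) else 0) else 0 :=
    tsum_subtype_eq_tsum_ite (fun y : MarkovShift τ => shift^[n + 1] y = x ∧ y.1 n = a)
      (fun y => if y.1 0 = A then b (n + 1) * ENNReal.ofReal (birkhoffProd R (n + 1) y) *
          F (wordValue s y 0 (n + 1)) else 0)
  simp_rw [h1]
  rw [ENNReal.tsum_comm]
  refine Eq.trans ?_ h2.symm
  refine tsum_congr fun y => ?_
  rw [tsum_eq_single (wordValue s y 0 (n + 1))]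
  · simp only [Nat.add_sub_cancel, and_true]
    by_cases hA : y.1 0 = A <;> simp [hA]
  · intro h hh
    rw [if_neg]
    rintro ⟨-, -, -, h4⟩
    exact hh h4.symm

theorem series_eq_tsum_groupWeight (b : ℕ → ℝ≥0∞) (q : Σ i, G ⧸ H i) :
    series R s a x f b {y | y.1 0 = A} q =
      ∑' h, groupWeight R s A a x b h * ENNReal.ofReal (f (h⁻¹ • q)) := by
  rw [tsum_groupWeight_mul b fun h => ENNReal.ofReal (f (h⁻¹ • q))]
  rfl

theorem tsum_groupWeight_le (b : ℕ → ℝ≥0∞) :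
    ∑' h, groupWeight R s A a x b h ≤
      ∑' p : Preimage a x, b (p.1 + 1) * ENNReal.ofReal (birkhoffProd R (p.1 + 1) p.2.1) := by
  classical
  have := tsum_groupWeight_mul (R := R) (s := s) (A := A) (a := a) (x := x) b fun _ => 1
  simp only [mul_one] at this
  rw [this]
  refine ENNReal.tsum_le_tsum fun p => ?_
  split_ifs
  · exact le_rfl
  · exact zero_le

theorem ofReal_phiTerm [Finite W] (hRpos : ∀ y, 0 < R y) {c : ℕ → ℝ} (hc : ∀ n, 0 ≤ c n) {t : ℝ}
    (ht : 0 < t) (n : ℕ) (g : G) :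
    ENNReal.ofReal (phiTerm R s A a x c t n g) =
      ∑' y : {y : MarkovShift τ //
        shift^[n] y = x ∧ y.1 0 = A ∧ y.1 (n - 1) = a ∧ wordValue s y 0 n = g},
      coeff c t n * ENNReal.ofReal (birkhoffProd R n y.1) := by
  have : Finite {y : MarkovShift τ //
      shift^[n] y = x ∧ y.1 0 = A ∧ y.1 (n - 1) = a ∧ wordValue s y 0 n = g} :=
    finite_preimage _ _
  have := Fintype.ofFinite {y : MarkovShift τ //
      shift^[n] y = x ∧ y.1 0 = A ∧ y.1 (n - 1) = a ∧ wordValue s y 0 n = g}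
  rw [phiTerm, ENNReal.ofReal_mul (mul_nonneg (by positivity) (hc n)), ENNReal.tsum_mul_left,
    tsum_fintype, tsum_fintype, ENNReal.ofReal_sum_of_nonneg]
  · rfl
  · exact fun y _ => (birkhoffProd_pos hRpos _ _).le

theorem phiTerm_nonneg (hRpos : ∀ y, 0 < R y) {c : ℕ → ℝ} (hc : ∀ n, 0 ≤ c n) {t : ℝ}
    (ht : 0 < t) (n : ℕ) (g : G) : 0 ≤ phiTerm R s A a x c t n g :=
  mul_nonneg (mul_nonneg (by positivity) (hc n))
    (tsum_nonneg fun y => (birkhoffProd_pos hRpos _ _).le)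

theorem ofReal_phiPartial [Finite W] (hRpos : ∀ y, 0 < R y) {c : ℕ → ℝ} (hc : ∀ n, 0 ≤ c n)
    {t : ℝ} (ht : 0 < t) (N : ℕ) (g : G) :
    ENNReal.ofReal (phiPartial R s A a x c N t g) =
      groupWeight R s A a x (truncate (coeff c t) N) g := by
  rw [phiPartial, ENNReal.ofReal_sum_of_nonneg fun n _ => phiTerm_nonneg hRpos hc ht n g,
    groupWeight, tsum_eq_sum (s := Finset.range N)]
  · rw [Finset.range_eq_Ico, Finset.sum_Ico_add' (fun n => ∑' y : {y : MarkovShift τ //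
      shift^[n] y = x ∧ y.1 0 = A ∧ y.1 (n - 1) = a ∧ wordValue s y 0 n = g},
      truncate (coeff c t) N n * ENNReal.ofReal (birkhoffProd R n y.1)) 0 N 1]
    refine Finset.sum_congr (by ext n; simp) fun n hn => ?_
    rw [ofReal_phiTerm hRpos hc ht, truncate, if_pos]
    simp at hn; omega
  · intro n hn
    simp only [Finset.mem_range, not_lt] at hn
    simp [truncate, show ¬ n + 1 ≤ N by omega]

/-- Finiteness is needed because the real `tsum` in `phi` takes the value `0` when the series
diverges. -/
theorem ofReal_phi [Finite W] (hRpos : ∀ y, 0 < R y) {c : ℕ → ℝ} (hc : ∀ n, 0 ≤ c n)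
    {t : ℝ} (ht : 0 < t) {g : G} (hg : groupWeight R s A a x (coeff c t) g ≠ ∞) :
    ENNReal.ofReal (phi R s A a x c t g) = groupWeight R s A a x (coeff c t) g := by
  have h : groupWeight R s A a x (coeff c t) g =
      ∑' n, ENNReal.ofReal (phiTerm R s A a x c t (n + 1) g) := by
    simp_rw [ofReal_phiTerm hRpos hc ht]; rfl
  have h0 := fun n => phiTerm_nonneg (s := s) (A := A) (a := a) (x := x) hRpos hc ht (n + 1) g
  rw [h] at hg ⊢
  rw [phi, ENNReal.ofReal_tsum_of_nonneg h0]
  have := ENNReal.summable_toReal hg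
  simpa only [ENNReal.toReal_ofReal (h0 _)] using this

theorem phi_nonneg (hRpos : ∀ y, 0 < R y) {c : ℕ → ℝ} (hc : ∀ n, 0 ≤ c n) {t : ℝ}
    (ht : 0 < t) (g : G) : 0 ≤ phi R s A a x c t g :=
  tsum_nonneg fun _ => phiTerm_nonneg hRpos hc ht _ g

theorem phiPartial_nonneg (hRpos : ∀ y, 0 < R y) {c : ℕ → ℝ} (hc : ∀ n, 0 ≤ c n) {t : ℝ}
    (ht : 0 < t) (N : ℕ) (g : G) : 0 ≤ phiPartial R s A a x c N t g :=
  Finset.sum_nonneg fun _ _ => phiTerm_nonneg hRpos hc ht _ g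

theorem rho_apply (g : G) (v : QuotientSum H) (q : Σ i, G ⧸ H i) : rho H g v q = v (g⁻¹ • q) := rfl

theorem smul_rho_nonneg (hf : InCone f) {φ : G → ℝ} (hφ : ∀ h, 0 ≤ φ h) (h : G)
    (q : Σ i, G ⧸ H i) : 0 ≤ (φ h • rho H h f) q := by
  rw [lp.coeFn_smul, Pi.smul_apply, rho_apply]
  exact mul_nonneg (hφ h) (hf _)

theorem ofReal_smul_rho {φ : G → ℝ} (hφ : ∀ h, 0 ≤ φ h) (h : G)
    (q : Σ i, G ⧸ H i) : ENNReal.ofReal ((φ h • rho H h f) q) =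
      ENNReal.ofReal (φ h) * ENNReal.ofReal (f (h⁻¹ • q)) := by
  rw [lp.coeFn_smul, Pi.smul_apply, rho_apply, smul_eq_mul, ENNReal.ofReal_mul (hφ h)]

theorem conv_nonneg (hf : InCone f) {φ : G → ℝ} (hφ : ∀ h, 0 ≤ φ h) : InCone (conv φ f) := by
  intro q
  by_cases hs : Summable fun h => φ h • rho H h f
  · have h := (hs.hasSum.mapL (lp.evalCLM ℝ (fun _ : (Σ i, G ⧸ H i) => ℝ) 2 q))
    have h' : HasSum (fun h => (φ h • rho H h f) q) (conv φ f q) := h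
    rw [← h'.tsum_eq]
    exact tsum_nonneg fun h => smul_rho_nonneg hf hφ h q
  -- Without summability `conv` is `0` by convention, which still lies in the cone.
  · rw [conv, tsum_eq_zero_of_not_summable hs]
    simp

theorem ofReal_conv_apply (hf : InCone f) {φ : G → ℝ} (hφ : ∀ h, 0 ≤ φ h)
    (hs : Summable fun h => φ h • rho H h f) {b : ℕ → ℝ≥0∞}
    (hb : ∀ h, ENNReal.ofReal (φ h) = groupWeight R s A a x b h) (q : Σ i, G ⧸ H i) :
    ENNReal.ofReal (conv φ f q) = series R s a x f b {y | y.1 0 = A} q := by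
  rw [conv, tsum_apply_of_summable hs (fun h q => smul_rho_nonneg hf hφ h q),
    series_eq_tsum_groupWeight]
  simp_rw [ofReal_smul_rho hφ, hb]

theorem ofReal_inner_conv (hf : InCone f) {φ : G → ℝ} (hφ : ∀ h, 0 ≤ φ h)
    (hs : Summable fun h => φ h • rho H h f) {b : ℕ → ℝ≥0∞}
    (hb : ∀ h, ENNReal.ofReal (φ h) = groupWeight R s A a x b h) :
    ENNReal.ofReal (inner ℝ (conv φ f) (conv φ f)) = normSq R s A a x f b := by
  rw [ofReal_inner_eq_tsum (conv_nonneg hf hφ) (conv_nonneg hf hφ), normSq]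
  simp_rw [ofReal_conv_apply hf hφ hs hb, sq]

theorem summable_smul_rho {φ : G → ℝ} (hφ : ∀ h, 0 ≤ φ h)
    (h : ∑' h, ENNReal.ofReal (φ h) ≠ ∞) : Summable fun h => φ h • rho H h f := by
  refine Summable.of_norm ?_
  have := ENNReal.summable_toReal h
  simp only [ENNReal.toReal_ofReal (hφ _)] at this
  refine (this.mul_right ‖f‖).congr fun h => ?_
  rw [norm_smul, LinearIsometryEquiv.norm_map, Real.norm_of_nonneg (hφ h)]

/-- `ρ` is isometric, so a density of finite total mass gives a norm-convergent convolution with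
`f`. -/
theorem normSq_ne_top (hf : InCone f) {b : ℕ → ℝ≥0∞}
    (hb : ∑' p : Preimage a x, b (p.1 + 1) * ENNReal.ofReal (birkhoffProd R (p.1 + 1) p.2.1) ≠ ∞) :
    normSq R s A a x f b ≠ ∞ := by
  have h1 : ∑' h, groupWeight R s A a x b h ≠ ∞ := ne_top_of_le_ne_top hb (tsum_groupWeight_le b)
  have h2 : ∀ h, ENNReal.ofReal (groupWeight R s A a x b h).toReal = groupWeight R s A a x b h :=
    fun h => ENNReal.ofReal_toReal (ENNReal.ne_top_of_tsum_ne_top h1 h)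
  have h3 : ∀ h, 0 ≤ (groupWeight R s A a x b h).toReal := fun h => ENNReal.toReal_nonneg
  rw [← ofReal_inner_conv hf h3 (summable_smul_rho h3 (by simpa only [h2] using h1)) h2]
  exact ENNReal.ofReal_ne_top

theorem coeff_ne_top (c : ℕ → ℝ) (t : ℝ) (n : ℕ) : coeff c t n ≠ ∞ := ENNReal.ofReal_ne_top

theorem truncate_ne_top {b : ℕ → ℝ≥0∞} (hb : ∀ n, b n ≠ ∞) (N n : ℕ) : truncate b N n ≠ ∞ := by
  unfold truncate; split_ifs
  · exact hb n
  · simp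

theorem truncate_tsum_ne_top [Finite W] {b : ℕ → ℝ≥0∞} (hb : ∀ n, b n ≠ ∞) (N : ℕ) :
    ∑' p : Preimage a x, truncate b N (p.1 + 1) *
      ENNReal.ofReal (birkhoffProd R (p.1 + 1) p.2.1) ≠ ∞ :=
  tsum_weight_ne_top (truncate_ne_top hb N) (N := N + 1) fun n hn => if_neg (by omega)

theorem ofReal_inner_phiPartial [Finite W] (hRpos : ∀ y, 0 < R y) (hf : InCone f) {c : ℕ → ℝ}
    (hc : ∀ n, 0 ≤ c n) {t : ℝ} (ht : 0 < t) (N : ℕ) :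
    ENNReal.ofReal (inner ℝ (conv (phiPartial R s A a x c N t) f)
      (conv (phiPartial R s A a x c N t) f)) =
      normSq R s A a x f (truncate (coeff c t) N) := by
  have h := fun g => ofReal_phiPartial (s := s) (A := A) (a := a) (x := x) hRpos hc ht N g
  have h0 := fun g => phiPartial_nonneg (s := s) (A := A) (a := a) (x := x) hRpos hc ht N g
  refine ofReal_inner_conv hf h0 (summable_smul_rho h0 ?_) h
  simp_rw [h]
  exact ne_top_of_le_ne_top (truncate_tsum_ne_top (coeff_ne_top c t) N) (tsum_groupWeight_le _)

theorem exists_pos_of_ne_zero (hf : InCone f) (hf0 : f ≠ 0) : ∃ q, 0 < f q := by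
  by_contra! h
  exact hf0 (by ext q; exact le_antisymm (h q) (hf q))

/-- If `f q₀ > 0`, the coordinate at `g • q₀` contains the density at `g` times `f q₀`, so a finite
norm makes the density finite at every `g`. Summability is then monotone convergence in the cone.
From here on `normSq` stands for the true squared norm. -/
theorem summable_phi [Finite W] (hRpos : ∀ y, 0 < R y) (hf : InCone f) (hf0 : f ≠ 0) {c : ℕ → ℝ}
    (hc : ∀ n, 0 ≤ c n) {t : ℝ} (ht : 0 < t) (h : normSq R s A a x f (coeff c t) ≠ ∞) :
    (∀ g, ENNReal.ofReal (phi R s A a x c t g) = groupWeight R s A a x (coeff c t) g) ∧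
    Summable fun g => phi R s A a x c t g • rho H g f := by
  have hfin : ∀ q, series R s a x f (coeff c t) {y | y.1 0 = A} q ≠ ∞ := fun q hq => by
    refine ENNReal.ne_top_of_tsum_ne_top h q ?_
    rw [hq]; simp
  obtain ⟨q₀, hq₀⟩ := exists_pos_of_ne_zero hf hf0
  have hw : ∀ g, groupWeight R s A a x (coeff c t) g ≠ ∞ := fun g hg => by
    have h1 := hfin (g • q₀)
    rw [series_eq_tsum_groupWeight] at h1
    refine ENNReal.ne_top_of_tsum_ne_top h1 g ?_
    rw [hg, inv_smul_smul]
    exact ENNReal.top_mul (ENNReal.ofReal_pos.2 hq₀).ne'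
  have heq := fun g => ofReal_phi hRpos hc ht (hw g)
  have h0 := fun g => phi_nonneg (s := s) (A := A) (a := a) (x := x) hRpos hc ht g
  refine ⟨heq, summable_of_tsum_sq_ne_top (fun g q => smul_rho_nonneg hf h0 g q) ?_⟩
  simp_rw [ofReal_smul_rho h0, heq, ← series_eq_tsum_groupWeight]
  exact h

theorem phiVec_nonneg (hRpos : ∀ y, 0 < R y) (hf : InCone f) {c : ℕ → ℝ}
    (hc : ∀ n, 0 ≤ c n) {t : ℝ} (ht : 0 < t) : InCone (phiVec R s A a x f c t) :=
  conv_nonneg hf (phi_nonneg hRpos hc ht)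

theorem ofReal_phiVec_apply [Finite W] (hRpos : ∀ y, 0 < R y) (hf : InCone f) (hf0 : f ≠ 0)
    {c : ℕ → ℝ} (hc : ∀ n, 0 ≤ c n) {t : ℝ} (ht : 0 < t)
    (h : normSq R s A a x f (coeff c t) ≠ ∞) (q : Σ i, G ⧸ H i) :
    ENNReal.ofReal (phiVec R s A a x f c t q) =
      series R s a x f (coeff c t) {y | y.1 0 = A} q :=
  have h' := summable_phi hRpos hf hf0 hc ht h
  ofReal_conv_apply hf (phi_nonneg hRpos hc ht) h'.2 h'.1 q

theorem ofReal_inner_phiVec [Finite W] (hRpos : ∀ y, 0 < R y) (hf : InCone f) (hf0 : f ≠ 0)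
    {c : ℕ → ℝ} (hc : ∀ n, 0 ≤ c n) {t : ℝ} (ht : 0 < t)
    (h : normSq R s A a x f (coeff c t) ≠ ∞) :
    ENNReal.ofReal (inner ℝ (phiVec R s A a x f c t) (phiVec R s A a x f c t)) =
      normSq R s A a x f (coeff c t) :=
  have h' := summable_phi hRpos hf hf0 hc ht h
  ofReal_inner_conv hf (phi_nonneg hRpos hc ht) h'.2 h'.1

/-! ### Monotonicity in the coefficients and truncation -/

theorem normSq_mono {b b' : ℕ → ℝ≥0∞} {C : ℝ≥0∞} (h : ∀ n, b n ≤ C * b' n) :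
    normSq R s A a x f b ≤ C ^ 2 * normSq R s A a x f b' := by
  rw [normSq, normSq, ← ENNReal.tsum_mul_left]
  refine ENNReal.tsum_le_tsum fun q => ?_
  rw [← mul_pow]
  exact pow_le_pow_left' (series_le_mul h subset_rfl q) 2

theorem truncate_le (b : ℕ → ℝ≥0∞) (N n : ℕ) : truncate b N n ≤ b n := by
  unfold truncate; split_ifs
  · exact le_rfl
  · exact zero_le

theorem truncate_mono (b : ℕ → ℝ≥0∞) {N M : ℕ} (h : N ≤ M) (n : ℕ) :
    truncate b N n ≤ truncate b M n := by
  unfold truncate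
  split_ifs
  · exact le_rfl
  · omega
  · exact zero_le
  · exact le_rfl

theorem iSup_truncate (b : ℕ → ℝ≥0∞) (n : ℕ) : ⨆ N, truncate b N n = b n :=
  le_antisymm (iSup_le fun N => truncate_le b N n)
    (le_iSup_of_le n (by rw [truncate, if_pos le_rfl]))

/-- Monotone convergence, first in the sum over words and then in the sum over coordinates. -/
theorem normSq_eq_iSup (b : ℕ → ℝ≥0∞) :
    normSq R s A a x f b = ⨆ N, normSq R s A a x f (truncate b N) := by
  classical
  have hmono : ∀ q, Monotone fun N => series R s a x f (truncate b N) {y | y.1 0 = A} q :=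
    fun q N M h => series_mono (truncate_mono b h) subset_rfl q
  have h1 : ∀ q, series R s a x f b {y | y.1 0 = A} q =
      ⨆ N, series R s a x f (truncate b N) {y | y.1 0 = A} q := by
    intro q
    simp only [series]
    rw [← tsum_iSup_of_monotone]
    · refine tsum_congr fun p => ?_
      by_cases hp : p.2.1 ∈ {y : MarkovShift τ | y.1 0 = A}
      · simp only [if_pos hp, seriesTerm]
        rw [← ENNReal.iSup_mul, ← ENNReal.iSup_mul, iSup_truncate]
      · simp only [if_neg hp, ciSup_const]
    · intro N M h p
      dsimp only
      split_ifs
      · unfold seriesTerm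
        have := truncate_mono b h (p.1 + 1)
        gcongr
      · exact le_rfl
  simp only [normSq]
  rw [← tsum_iSup_of_monotone]
  · refine tsum_congr fun q => ?_
    rw [h1]
    simp_rw [sq, ENNReal.iSup_mul, ENNReal.mul_iSup]
    refine le_antisymm (iSup_le fun i => iSup_le fun j => ?_) (iSup_mono fun i => ?_)
    · exact le_iSup_of_le (max i j) (mul_le_mul' (hmono q (le_max_left _ _))
        (hmono q (le_max_right _ _)))
    · exact le_iSup (fun j => series R s a x f (truncate b i) {y | y.1 0 = A} q *
        series R s a x f (truncate b j) {y | y.1 0 = A} q) i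
  · exact fun N M h q => pow_le_pow_left' (hmono q h) 2

/-- The parameters `t` in the definition of the decay exponent are those at which the series
converges in norm. -/
theorem bddAbove_iff_normSq_ne_top [Finite W] (hRpos : ∀ y, 0 < R y) (hf : InCone f) {c : ℕ → ℝ}
    (hc : ∀ n, 0 ≤ c n) {t : ℝ} (ht : 0 < t) :
    BddAbove (Set.range fun N : ℕ => inner ℝ (conv (phiPartial R s A a x c N t) f)
      (conv (phiPartial R s A a x c N t) f)) ↔ normSq R s A a x f (coeff c t) ≠ ∞ := by
  have key := fun N => ofReal_inner_phiPartial (s := s) (A := A) (a := a) (x := x)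
    hRpos hf hc ht N
  rw [normSq_eq_iSup]
  simp_rw [← key]
  constructor
  · rintro ⟨K, hK⟩
    refine ne_top_of_le_ne_top (b := ENNReal.ofReal K) ENNReal.ofReal_ne_top (iSup_le fun N => ?_)
    exact ENNReal.ofReal_le_ofReal (hK ⟨N, rfl⟩)
  · intro h
    refine ⟨(⨆ N, ENNReal.ofReal (inner ℝ (conv (phiPartial R s A a x c N t) f)
      (conv (phiPartial R s A a x c N t) f))).toReal, ?_⟩
    rintro _ ⟨N, rfl⟩
    exact (ENNReal.ofReal_le_iff_le_toReal h).1 (le_iSup (fun N => ENNReal.ofReal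
      (inner ℝ (conv (phiPartial R s A a x c N t) f) (conv (phiPartial R s A a x c N t) f))) N)

end PhiVec

/-! ### The decay exponent -/

theorem SlowlyIncreasing.nonneg {c : ℕ → ℝ} (hc : SlowlyIncreasing c) (n : ℕ) : 0 ≤ c n :=
  (hc.pos n).le

/-- Subexponential growth is what keeps the weight `c` from moving the critical parameter. -/
theorem SlowlyIncreasing.exists_le_mul_pow {c : ℕ → ℝ} (hc : SlowlyIncreasing c) {l : ℝ}
    (hl : 1 < l) : ∃ C : ℝ, 0 < C ∧ ∀ n, c n ≤ C * l ^ n := by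
  obtain ⟨N, hN⟩ := eventually_atTop.1 ((hc.slow 1).eventually_le_const hl)
  refine ⟨c N, hc.pos N, fun n => ?_⟩
  rcases le_total n N with h | h
  · exact (hc.mono h).trans (le_mul_of_one_le_right (hc.pos N).le (one_le_pow₀ hl.le))
  · have key : ∀ k, c (N + k) ≤ c N * l ^ k := by
      intro k
      induction k with
      | zero => simp
      | succ k ih =>
        have h1 := hN (N + k) (by omega)
        rw [div_le_iff₀ (hc.pos _)] at h1
        calc c (N + (k + 1)) ≤ l * c (N + k) := h1
          _ ≤ l * (c N * l ^ k) := by gcongr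
          _ = c N * l ^ (k + 1) := by ring
    obtain ⟨k, rfl⟩ := Nat.exists_eq_add_of_le h
    refine (key k).trans ?_
    have := (hc.pos N).le
    gcongr
    · exact hl.le
    · omega

/-- A slowly increasing function that dominates `(1 + 1/(j+1))ⁿ` up to prescribed thresholds. -/
theorem exists_slowlyIncreasing_ge (M : ℕ → ℕ) :
    ∃ c : ℕ → ℝ, SlowlyIncreasing c ∧
      ∀ j : ℕ, ∀ n ≤ M j, (1 + 1 / ((j : ℝ) + 1)) ^ n ≤ c n := by
  have hex : ∀ i, ∃ j, i < max (M j) (j + 1) := fun i => ⟨i, by simp⟩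
  -- `J i` is the first `j` whose threshold lies beyond `i`; the maximum with `j + 1` ensures that
  -- one exists. Since `J` tends to infinity, the factors `1 + 1/(J i + 1)` of `c` tend to 1, while
  -- those with `i < M j` are at least `1 + 1/(j + 1)`.
  let J : ℕ → ℕ := fun i => Nat.find (hex i)
  have hJ : ∀ i j, i < M j → J i ≤ j := fun i j h =>
    Nat.find_min' (hex i) (lt_of_lt_of_le h (le_max_left _ _))
  have hJtop : Tendsto J atTop atTop := by
    rw [tendsto_atTop]
    intro j₀
    filter_upwards [eventually_ge_atTop ((Finset.range j₀).sup fun j => max (M j) (j + 1))]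
      with i hi
    refine (Nat.le_find_iff (hex i) j₀).2 fun j hj => not_lt.2 (le_trans ?_ hi)
    exact Finset.le_sup (f := fun j => max (M j) (j + 1)) (Finset.mem_range.2 hj)
  let c : ℕ → ℝ := fun n => ∏ i ∈ Finset.range n, (1 + 1 / ((J i : ℝ) + 1))
  have hfac : ∀ i, (1 : ℝ) ≤ 1 + 1 / ((J i : ℝ) + 1) := fun i =>
    le_add_of_nonneg_right (by positivity)
  have hcpos : ∀ n, 0 < c n := fun n => Finset.prod_pos fun i _ => by linarith [hfac i]
  have hsucc : ∀ n, c (n + 1) = c n * (1 + 1 / ((J n : ℝ) + 1)) := fun n =>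
    Finset.prod_range_succ _ _
  have hone : Tendsto (fun n => c (n + 1) / c n) atTop (𝓝 1) := by
    have h1 : Tendsto (fun n => 1 + 1 / ((J n : ℝ) + 1)) atTop (𝓝 (1 + 0)) :=
      (tendsto_one_div_add_atTop_nhds_zero_nat.comp hJtop).const_add 1
    rw [add_zero] at h1
    refine h1.congr fun n => ?_
    rw [hsucc, mul_div_cancel_left₀ _ (hcpos n).ne']
  refine ⟨c, ⟨hcpos, monotone_nat_of_le_succ fun n => ?_, fun k => ?_⟩, fun j n hn => ?_⟩
  · rw [hsucc]
    exact le_mul_of_one_le_right (hcpos n).le (hfac n)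
  · induction k with
    | zero =>
      refine tendsto_const_nhds.congr fun n => ?_
      rw [Nat.add_zero, div_self (hcpos n).ne']
    | succ k ih =>
      have h1 := (hone.comp (tendsto_add_atTop_nat k)).mul ih
      rw [one_mul] at h1
      refine h1.congr fun n => ?_
      exact div_mul_div_cancel₀ (hcpos _).ne'
  · calc (1 + 1 / ((j : ℝ) + 1)) ^ n = ∏ i ∈ Finset.range n, (1 + 1 / ((j : ℝ) + 1)) := by simp
      _ ≤ c n := by
        refine Finset.prod_le_prod (fun i _ => by positivity) fun i hi => ?_
        have : J i ≤ j := hJ i j ((Finset.mem_range.1 hi).trans_le hn)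
        gcongr

section Exponent

variable {W : Type*} {τ : W → W → Prop} {G : Type*} [Group G] {I : Type*} {H : I → Subgroup G}
  {R : MarkovShift τ → ℝ} {s : W → G} {A a : W} {x : MarkovShift τ} {f : QuotientSum H}

/-- The point `ax`. -/
def cons (a : W) (x : MarkovShift τ) (hx : τ a (x.1 0)) : MarkovShift τ :=
  ⟨fun i => Nat.casesOn i a fun j => x.1 j, fun i => by
    cases i with
    | zero => exact hx
    | succ i => exact x.2 i⟩

theorem shift_cons (hx : τ a (x.1 0)) : shift (cons a x hx) = x := rfl

theorem cons_zero (hx : τ a (x.1 0)) : (cons a x hx).1 0 = a := rfl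

theorem exists_preimage [Finite W] [TopologicalSpace W] [DiscreteTopology W]
    (hlive : ∀ B : W, ∃ y : MarkovShift τ, y.1 0 = B) (hmix : IsMixing τ) (hx : τ a (x.1 0)) :
    ∃ M : ℕ, ∀ m ≥ M, ∃ p : Preimage a x, p.1 = m ∧ p.2.1.1 0 = A := by
  obtain ⟨M, -, hM⟩ := exists_uniform_connector hlive hmix
  refine ⟨M, fun m hm => ?_⟩
  obtain ⟨p, hp0, hpm⟩ := hM m hm A a
  have h : p.1 m = (cons a x hx).1 0 := hpm
  refine ⟨⟨m, glue p m (cons a x hx) h, ?_, ?_⟩, rfl, ?_⟩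
  · rw [Function.iterate_succ_apply', shift_iterate_glue, shift_cons]
  · rw [glue_apply_le h le_rfl, hpm]
  · rw [← hp0]
    exact glue_apply_le h (Nat.zero_le _)

/-- By mixing, words from `A` to `a` exist in every large length; a single one of length `m + 1`
contributes at least `(r / t) ^ (m + 1) * f q₀` to some coordinate, and this is unbounded. -/
theorem normSq_eq_top_of_lt [Finite W] [TopologicalSpace W] [DiscreteTopology W]
    (hlive : ∀ B : W, ∃ y : MarkovShift τ, y.1 0 = B) (hmix : IsMixing τ) (hx : τ a (x.1 0))
    {r : ℝ} (hr : 0 < r) (hRr : ∀ y, r ≤ R y)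
    (hf : InCone f) (hf0 : f ≠ 0) {t : ℝ} (ht : 0 < t) (htr : t < r) :
    normSq R s A a x f (coeff (fun _ => 1) t) = ∞ := by
  classical
  obtain ⟨q₀, hq₀⟩ := exists_pos_of_ne_zero hf hf0
  obtain ⟨M, hM⟩ := exists_preimage (A := A) hlive hmix hx
  have hlow : ∀ m ≥ M, ENNReal.ofReal ((r / t) ^ (m + 1) * f q₀) ^ 2 ≤
      normSq R s A a x f (coeff (fun _ => 1) t) := by
    intro m hm
    obtain ⟨p, rfl, hpA⟩ := hM m hm
    let q := wordValue s p.2.1 0 (p.1 + 1) • q₀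
    refine le_trans ?_ (ENNReal.le_tsum q)
    refine pow_le_pow_left' ?_ 2
    refine le_trans ?_ (ENNReal.le_tsum p)
    have hp : p.2.1 ∈ {y : MarkovShift τ | y.1 0 = A} := hpA
    rw [if_pos hp, seriesTerm, inv_smul_smul, coeff,
      ← ENNReal.ofReal_mul (by positivity), ← ENNReal.ofReal_mul (mul_nonneg (by positivity)
        (birkhoffProd_pos (fun y => hr.trans_le (hRr y)) _ _).le)]
    refine ENNReal.ofReal_le_ofReal ?_
    have := pow_le_birkhoffProd hr hRr (p.1 + 1) p.2.1
    rw [div_pow, mul_one, div_eq_inv_mul]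
    gcongr
  refine ENNReal.eq_top_of_forall_nnreal_le fun K => ?_
  have h1 : Tendsto (fun m : ℕ => (r / t) ^ (m + 1) * f q₀) atTop atTop :=
    ((tendsto_pow_atTop_atTop_of_one_lt ((one_lt_div ht).2 htr)).comp
      (tendsto_add_atTop_nat 1)).atTop_mul_const hq₀
  obtain ⟨m, hm1, hm2⟩ := ((h1.eventually_ge_atTop ((K : ℝ) + 1)).and
    (eventually_ge_atTop M)).exists
  refine le_trans ?_ (hlow m hm2)
  rw [← ENNReal.ofReal_coe_nnreal, ← ENNReal.ofReal_pow (by positivity)]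
  refine ENNReal.ofReal_le_ofReal ?_
  have hK : (0 : ℝ) ≤ K := K.2
  nlinarith

theorem exists_normSq_ne_top [Finite W] (hRpos : ∀ y, 0 < R y) {r : ℝ} (hRr : ∀ y, R y ≤ r)
    (hf : InCone f) :
    ∃ t : ℝ, 0 < t ∧ normSq R s A a x f (coeff (fun _ => 1) t) ≠ ∞ := by
  have := Fintype.ofFinite W
  have hr : 0 < r := (hRpos x).trans_le (hRr x)
  have hW : (0 : ℝ) < Fintype.card W := by
    have : Nonempty W := ⟨a⟩
    exact_mod_cast Fintype.card_pos
  -- At most `card W ^ n` words have length `n`, each with product at most `r ^ n`, so length `n`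
  -- has total weight at most `2⁻ⁿ`.
  set t : ℝ := 2 * Fintype.card W * r with ht
  have ht0 : 0 < t := by positivity
  refine ⟨t, ht0, normSq_ne_top hf ?_⟩
  rw [ENNReal.tsum_sigma']
  have hle : ∀ n : ℕ, ∑' y : {y : MarkovShift τ // shift^[n + 1] y = x ∧ y.1 n = a},
      coeff (fun _ => 1) t (n + 1) * ENNReal.ofReal (birkhoffProd R (n + 1) y.1) ≤
      ENNReal.ofReal ((1 / 2) ^ (n + 1)) := by
    intro n
    calc ∑' y : {y : MarkovShift τ // shift^[n + 1] y = x ∧ y.1 n = a},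
        coeff (fun _ => 1) t (n + 1) * ENNReal.ofReal (birkhoffProd R (n + 1) y.1)
        ≤ ∑' y : {y : MarkovShift τ // shift^[n + 1] y = x ∧ y.1 n = a},
          ENNReal.ofReal ((t ^ (n + 1))⁻¹ * r ^ (n + 1)) := by
          refine ENNReal.tsum_le_tsum fun y => ?_
          rw [coeff, ← ENNReal.ofReal_mul (by positivity), mul_one]
          refine ENNReal.ofReal_le_ofReal ?_
          gcongr
          exact birkhoffProd_le_pow hRpos hRr _ _
      _ ≤ ∑' u : Fin (n + 1) → W, ENNReal.ofReal ((t ^ (n + 1))⁻¹ * r ^ (n + 1)) := by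
          refine ENNReal.tsum_comp_le_tsum_of_injective
            (f := fun (y : {y : MarkovShift τ // shift^[n + 1] y = x ∧ y.1 n = a})
              (i : Fin (n + 1)) => y.1.1 i) (fun y z h => ?_)
            (fun _ => ENNReal.ofReal ((t ^ (n + 1))⁻¹ * r ^ (n + 1)))
          exact Subtype.ext (ext_of_prefix_of_shift (n + 1)
            (fun i hi => congrFun h ⟨i, hi⟩) (y.2.1.trans z.2.1.symm))
      _ = ENNReal.ofReal ((1 / 2) ^ (n + 1)) := by
          rw [tsum_fintype, Finset.sum_const, Finset.card_univ, Fintype.card_fun, Fintype.card_fin,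
            nsmul_eq_mul, ← ENNReal.ofReal_natCast, ← ENNReal.ofReal_mul (by positivity)]
          congr 1
          rw [ht]
          push_cast
          rw [mul_pow, mul_pow, one_div_pow]
          field_simp
  refine ne_top_of_le_ne_top ?_ (ENNReal.tsum_le_tsum hle)
  rw [← ENNReal.ofReal_tsum_of_nonneg (fun n => by positivity)]
  · exact ENNReal.ofReal_ne_top
  · exact (summable_nat_add_iff 1).2 (summable_geometric_of_lt_one (by norm_num) (by norm_num))

theorem mem_decaySet_iff [Finite W] (hRpos : ∀ y, 0 < R y) (hf : InCone f) (t : ℝ) :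
    t ∈ {t : ℝ | 0 < t ∧ BddAbove (Set.range fun N : ℕ =>
      inner ℝ (conv (phiPartial R s A a x (fun _ => 1) N t) f)
        (conv (phiPartial R s A a x (fun _ => 1) N t) f))} ↔
      0 < t ∧ normSq R s A a x f (coeff (fun _ => 1) t) ≠ ∞ :=
  and_congr_right fun ht => bddAbove_iff_normSq_ne_top hRpos hf (fun _ => zero_le_one) ht

theorem decayExponent_eq [Finite W] (hRpos : ∀ y, 0 < R y) (hf : InCone f) :
    decayExponent R s A a x f =
      sInf {t : ℝ | 0 < t ∧ normSq R s A a x f (coeff (fun _ => 1) t) ≠ ∞} := by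
  rw [decayExponent]
  congr 1
  ext t
  exact mem_decaySet_iff hRpos hf t

theorem le_decayExponent [Finite W] [TopologicalSpace W] [DiscreteTopology W]
    (hlive : ∀ B : W, ∃ y : MarkovShift τ, y.1 0 = B) (hmix : IsMixing τ) (hx : τ a (x.1 0))
    {r r' : ℝ} (hr : 0 < r) (hRr : ∀ y, r ≤ R y) (hRr' : ∀ y, R y ≤ r')
    (hf : InCone f) (hf0 : f ≠ 0) : r ≤ decayExponent R s A a x f := by
  have hRpos : ∀ y, 0 < R y := fun y => hr.trans_le (hRr y)
  rw [decayExponent_eq hRpos hf]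
  refine le_csInf (exists_normSq_ne_top hRpos hRr' hf) fun t ht => ?_
  by_contra! hlt
  exact ht.2 (normSq_eq_top_of_lt hlive hmix hx hr hRr hf hf0 ht.1 hlt)

theorem normSq_coeff_one_eq_top [Finite W] (hRpos : ∀ y, 0 < R y) (hf : InCone f) {t : ℝ}
    (ht : 0 < t) (hlt : t < decayExponent R s A a x f) :
    normSq R s A a x f (coeff (fun _ => 1) t) = ∞ := by
  by_contra h
  rw [decayExponent_eq hRpos hf] at hlt
  have hmem : t ∈ {t : ℝ | 0 < t ∧ normSq R s A a x f (coeff (fun _ => 1) t) ≠ ∞} := ⟨ht, h⟩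
  exact absurd (csInf_le ⟨0, fun u hu => hu.1.le⟩ hmem) (not_le.2 hlt)

/-- Between the exponent and `t` lies a parameter `t₀` of convergence for `c = 1`, and `c` grows
more slowly than `(t / t₀) ^ n`. -/
theorem normSq_coeff_ne_top [Finite W] (hRpos : ∀ y, 0 < R y) {r : ℝ} (hRr : ∀ y, R y ≤ r)
    (hf : InCone f) {c : ℕ → ℝ} (hc : SlowlyIncreasing c) {t : ℝ}
    (hlt : decayExponent R s A a x f < t) : normSq R s A a x f (coeff c t) ≠ ∞ := by
  rw [decayExponent_eq hRpos hf] at hlt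
  obtain ⟨t₀, ⟨ht₀, hfin⟩, hlt'⟩ := exists_lt_of_csInf_lt (exists_normSq_ne_top hRpos hRr hf) hlt
  obtain ⟨C, hC, hle⟩ := hc.exists_le_mul_pow ((one_lt_div ht₀).2 hlt')
  have ht : 0 < t := ht₀.trans hlt'
  have : ∀ n, coeff c t n ≤ ENNReal.ofReal C * coeff (fun _ => 1) t₀ n := fun n => by
    rw [coeff, coeff, ← ENNReal.ofReal_mul hC.le]
    refine ENNReal.ofReal_le_ofReal ?_
    calc (t ^ n)⁻¹ * c n ≤ (t ^ n)⁻¹ * (C * (t / t₀) ^ n) := by gcongr; exact hle n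
      _ = _ := by rw [div_pow]; field_simp
  exact ne_top_of_le_ne_top (ENNReal.mul_ne_top (by simp) hfin) (normSq_mono this)

/-- A slowly increasing weight that makes the series diverge at the decay exponent. -/
theorem exists_slowlyIncreasing_normSq_eq_top [Finite W] (hRpos : ∀ y, 0 < R y) (hf : InCone f)
    (hγ : 0 < decayExponent R s A a x f) :
    ∃ c : ℕ → ℝ, SlowlyIncreasing c ∧
      normSq R s A a x f (coeff c (decayExponent R s A a x f)) = ∞ := by
  set γ := decayExponent R s A a x f with hγdef
  -- Below `γ` the unweighted series diverges, so a truncation already exceeds `j`. On that range of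
  -- lengths the weight `c` will make up for replacing `γ / (1 + 1/(j + 1))` by `γ`.
  have hex : ∀ j : ℕ, ∃ N : ℕ, (j : ℝ≥0∞) <
      normSq R s A a x f (truncate (coeff (fun _ => 1) (γ / (1 + 1 / ((j : ℝ) + 1)))) N) := by
    intro j
    have h1 : (1 : ℝ) < 1 + 1 / ((j : ℝ) + 1) := lt_add_of_pos_right _ (by positivity)
    have h2 := normSq_coeff_one_eq_top (s := s) (A := A) (a := a) (x := x) hRpos hf
      (t := γ / (1 + 1 / ((j : ℝ) + 1))) (by positivity) (div_lt_self hγ h1)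
    rw [normSq_eq_iSup] at h2
    refine lt_iSup_iff.1 ?_
    rw [h2]
    exact ENNReal.natCast_lt_top j
  choose M hM using hex
  obtain ⟨c, hc, hge⟩ := exists_slowlyIncreasing_ge M
  refine ⟨c, hc, ENNReal.eq_top_of_forall_nnreal_le fun K => ?_⟩
  obtain ⟨j, hj⟩ := exists_nat_ge K
  calc (K : ℝ≥0∞) ≤ j := by exact_mod_cast hj
    _ ≤ _ := (hM j).le
    _ ≤ 1 ^ 2 * normSq R s A a x f (coeff c γ) := normSq_mono fun n => by
      rw [one_mul, truncate]
      split_ifs with hn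
      · refine ENNReal.ofReal_le_ofReal ?_
        have h1 := hge j n hn
        rw [div_pow, inv_div, mul_one, div_eq_inv_mul]
        gcongr
      · exact zero_le
    _ = _ := by rw [one_pow, one_mul]

/-- Lower semicontinuity: a long truncation is already large at `γ`, and its coefficients depend
continuously on the parameter. -/
theorem tendsto_inner_phiVec_atTop [Finite W] (hRpos : ∀ y, 0 < R y) {r : ℝ}
    (hRr : ∀ y, R y ≤ r) (hf : InCone f) (hf0 : f ≠ 0) {c : ℕ → ℝ} (hc : SlowlyIncreasing c)
    (hγ : 0 < decayExponent R s A a x f)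
    (htop : normSq R s A a x f (coeff c (decayExponent R s A a x f)) = ∞) :
    Tendsto (fun u : ℝ => inner ℝ (phiVec R s A a x f c u) (phiVec R s A a x f c u))
      (𝓝[>] (decayExponent R s A a x f)) atTop := by
  set γ := decayExponent R s A a x f with hγdef
  rw [tendsto_atTop]
  intro K
  -- Near `γ` the coefficients up to `N` change by a factor of at most 2, hence the squared norm by
  -- at most 4.
  have h1 : ∃ N, ENNReal.ofReal (4 * K) < normSq R s A a x f (truncate (coeff c γ) N) := by
    rw [normSq_eq_iSup] at htop
    refine lt_iSup_iff.1 ?_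
    rw [htop]
    exact ENNReal.ofReal_lt_top
  obtain ⟨N, hN⟩ := h1
  have h2 : Tendsto (fun t : ℝ => (t / γ) ^ N) (𝓝[>] γ) (𝓝 1) := by
    have : Tendsto (fun t : ℝ => (t / γ) ^ N) (𝓝 γ) (𝓝 ((γ / γ) ^ N)) :=
      ((continuous_id.div_const γ).pow N).tendsto γ
    rw [div_self hγ.ne', one_pow] at this
    exact this.mono_left nhdsWithin_le_nhds
  filter_upwards [h2.eventually_le_const (show (1 : ℝ) < 2 by norm_num), self_mem_nhdsWithin]
    with t ht htγ
  have htγ' : γ < t := htγ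
  have ht0 : 0 < t := hγ.trans htγ'
  have hfin := normSq_coeff_ne_top (s := s) (A := A) (a := a) (x := x) hRpos hRr hf hc htγ'
  have h3 : ∀ n, truncate (coeff c γ) N n ≤ ENNReal.ofReal 2 * coeff c t n := fun n => by
    rw [truncate]
    split_ifs with hn
    · rw [coeff, coeff, ← ENNReal.ofReal_mul (by norm_num)]
      refine ENNReal.ofReal_le_ofReal ?_
      have h4 : (t / γ) ^ n ≤ 2 :=
        (pow_le_pow_right₀ ((one_le_div hγ).2 htγ'.le) hn).trans ht
      rw [div_pow, div_le_iff₀ (by positivity)] at h4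
      rw [← mul_assoc]
      refine mul_le_mul_of_nonneg_right ?_ (hc.nonneg n)
      rw [← div_eq_mul_inv, le_div_iff₀ (by positivity), inv_mul_le_iff₀ (by positivity)]
      linarith
    · exact zero_le
  have h5 := hN.le.trans (normSq_mono h3)
  rw [← ofReal_inner_phiVec hRpos hf hf0 hc.nonneg ht0 hfin, ← ENNReal.ofReal_pow (by norm_num),
    ← ENNReal.ofReal_mul (by norm_num)] at h5
  have h6 := (ENNReal.ofReal_le_ofReal_iff (mul_nonneg (by norm_num)
    real_inner_self_nonneg)).1 h5
  linarith

end Exponent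

/-! ### Estimates for the approximating measures -/

section Approx

variable {W : Type*} {τ : W → W → Prop} {G : Type*} [Group G] {I : Type*} {H : I → Subgroup G}
  {R : MarkovShift τ → ℝ} {s : W → G} {A a : W} {x : MarkovShift τ} {f : QuotientSum H}

theorem le_pow_mul_add {b : ℕ → ℝ≥0∞} {T : ℝ≥0∞} (hb : ∀ n, b n ≤ T * b (n + 1)) (n k : ℕ) :
    b n ≤ T ^ k * b (n + k) := by
  induction k with
  | zero => simp
  | succ k ih =>
    calc b n ≤ T ^ k * b (n + k) := ih
      _ ≤ T ^ k * (T * b (n + k + 1)) := mul_le_mul_right (hb _) _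
      _ = _ := by rw [← mul_assoc, ← pow_succ]; rfl

/-- Since `T` only has to bound `t`, lengthening words by a fixed amount costs a constant uniform
along the sequence `t_k`. -/
theorem coeff_le_mul_succ {c : ℕ → ℝ} (hc : SlowlyIncreasing c) {t T : ℝ} (ht : 0 < t)
    (htT : t ≤ T) (n : ℕ) : coeff c t n ≤ ENNReal.ofReal T * coeff c t (n + 1) := by
  rw [coeff, coeff, ← ENNReal.ofReal_mul (ht.le.trans htT)]
  refine ENNReal.ofReal_le_ofReal ?_
  have h0 := hc.nonneg (n + 1)
  calc (t ^ n)⁻¹ * c n ≤ (t ^ n)⁻¹ * c (n + 1) := by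
        gcongr; exact hc.mono (Nat.le_succ n)
    _ = t * ((t ^ (n + 1))⁻¹ * c (n + 1)) := by rw [pow_succ]; field_simp
    _ ≤ _ := by gcongr

theorem measurable_letter [MeasurableSpace W] (i : ℕ) :
    Measurable fun y : MarkovShift τ => y.1 i :=
  (measurable_pi_apply i).comp measurable_subtype_coe

theorem rho_nonneg {v : QuotientSum H} (hv : InCone v) (g : G) : InCone (rho H g v) :=
  fun q => hv (g⁻¹ • q)

theorem ofReal_inner_rho_phiVec [Finite W] (hRpos : ∀ y, 0 < R y) (hf : InCone f) (hf0 : f ≠ 0)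
    {c : ℕ → ℝ} (hc : ∀ n, 0 ≤ c n) {t : ℝ} (ht : 0 < t)
    (h : normSq R s A a x f (coeff c t) ≠ ∞) {v : QuotientSum H} (hv : InCone v) (g : G) :
    ENNReal.ofReal (inner ℝ (rho H g v) (phiVec R s A a x f c t)) =
      ∑' q, ENNReal.ofReal (v (g⁻¹ • q)) * series R s a x f (coeff c t) {y | y.1 0 = A} q := by
  rw [ofReal_inner_eq_tsum (rho_nonneg hv g) (phiVec_nonneg hRpos hf hc ht)]
  simp_rw [ofReal_phiVec_apply hRpos hf hf0 hc ht h, rho_apply]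

theorem ofReal_inner_rho_phiVec_self [Finite W] (hRpos : ∀ y, 0 < R y) (hf : InCone f)
    (hf0 : f ≠ 0) {c : ℕ → ℝ} (hc : ∀ n, 0 ≤ c n) {t : ℝ} (ht : 0 < t)
    (h : normSq R s A a x f (coeff c t) ≠ ∞) (g : G) :
    ENNReal.ofReal (inner ℝ (rho H g (phiVec R s A a x f c t)) (phiVec R s A a x f c t)) =
      ∑' q, series R s a x f (coeff c t) {y | y.1 0 = A} (g⁻¹ • q) *
        series R s a x f (coeff c t) {y | y.1 0 = A} q := by
  rw [ofReal_inner_rho_phiVec hRpos hf hf0 hc ht h (phiVec_nonneg hRpos hf hc ht)]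
  simp_rw [ofReal_phiVec_apply hRpos hf hf0 hc ht h]

theorem inner_phiVec_pos_iff [Finite W] (hRpos : ∀ y, 0 < R y) (hf : InCone f)
    (hf0 : f ≠ 0) {c : ℕ → ℝ} (hc : ∀ n, 0 ≤ c n) {t : ℝ} (ht : 0 < t)
    (h : normSq R s A a x f (coeff c t) ≠ ∞) :
    0 < inner ℝ (phiVec R s A a x f c t) (phiVec R s A a x f c t) ↔
      normSq R s A a x f (coeff c t) ≠ 0 := by
  rw [← ofReal_inner_phiVec hRpos hf hf0 hc ht h, ENNReal.ofReal_ne_zero_iff]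

/-- The pairing of a weighted series with `φ_c[t] ∗ f`. -/
theorem tsum_series_mul_eq [Finite W] (hRpos : ∀ y, 0 < R y) (hf : InCone f) (hf0 : f ≠ 0)
    {c : ℕ → ℝ} (hc : ∀ n, 0 ≤ c n) {t : ℝ} (ht : 0 < t)
    (h : normSq R s A a x f (coeff c t) ≠ ∞) (b : ℕ → ℝ≥0∞) (S : Set (MarkovShift τ))
    [DecidablePred (· ∈ S)] :
    ∑' q, series R s a x f b S q * series R s a x f (coeff c t) {y | y.1 0 = A} q =
      ∑' p : Preimage a x, if p.2.1 ∈ S then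
        b (p.1 + 1) * ENNReal.ofReal (birkhoffProd R (p.1 + 1) p.2.1) *
        ENNReal.ofReal (inner ℝ (rho H (wordValue s p.2.1 0 (p.1 + 1)) f)
          (phiVec R s A a x f c t)) else 0 := by
  rw [show (∑' q, series R s a x f b S q * series R s a x f (coeff c t) {y | y.1 0 = A} q) =
    ∑' q, ∑' p : Preimage a x, (if p.2.1 ∈ S then seriesTerm R s f b q (p.1 + 1) p.2.1 else 0) *
      series R s a x f (coeff c t) {y | y.1 0 = A} q from tsum_congr fun q => by
        rw [ENNReal.tsum_mul_right, series]
        congr 1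
        exact tsum_congr fun p => by by_cases hp : p.2.1 ∈ S <;> simp [hp]]
  rw [ENNReal.tsum_comm]
  refine tsum_congr fun p => ?_
  split_ifs
  · rw [ofReal_inner_rho_phiVec hRpos hf hf0 hc ht h hf, ← ENNReal.tsum_mul_left]
    refine tsum_congr fun q => ?_
    rw [seriesTerm, mul_assoc]
  · simp

theorem approxMeasure_apply [MeasurableSpace W] [Finite W] (hRpos : ∀ y, 0 < R y) (hf : InCone f)
    (hf0 : f ≠ 0) {c : ℕ → ℝ} (hc : ∀ n, 0 ≤ c n) {t : ℝ} (ht : 0 < t)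
    (h : normSq R s A a x f (coeff c t) ≠ ∞)
    (hpos : 0 < inner ℝ (phiVec R s A a x f c t) (phiVec R s A a x f c t))
    {S : Set (MarkovShift τ)} (hS : MeasurableSet S) :
    approxMeasure R s A a x f c t S =
      (∑' q, series R s a x f (coeff c t) S q *
        series R s a x f (coeff c t) {y | y.1 0 = A} q) / normSq R s A a x f (coeff c t) := by
  classical
  rw [tsum_series_mul_eq hRpos hf hf0 hc ht h, div_eq_mul_inv, ← ENNReal.tsum_mul_right,
    ENNReal.tsum_sigma', approxMeasure, Measure.sum_apply _ hS]
  refine tsum_congr fun n => ?_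
  rw [Measure.sum_apply _ hS]
  refine tsum_congr fun y => ?_
  rw [Measure.smul_apply, Measure.dirac_apply' _ hS, smul_eq_mul]
  by_cases hy : y.1 ∈ S
  · simp only [hy, Set.indicator_of_mem, Pi.one_apply, mul_one, if_true]
    rw [← ofReal_inner_phiVec hRpos hf hf0 hc ht h, ← div_eq_mul_inv,
      ENNReal.ofReal_mul (mul_nonneg (mul_nonneg (by positivity) (hc _))
        (birkhoffProd_pos hRpos _ _).le),
      ENNReal.ofReal_mul (mul_nonneg (by positivity) (hc _)), ENNReal.ofReal_div_of_pos hpos,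
      mul_div_assoc]
    rfl
  · simp [hy]

/-- On `[A]` the weighted series is `Q` itself, so the pairing is `⟨Q, Q⟩ / ⟨Q, Q⟩`. In particular
the approximating measures are nonzero. -/
theorem approxMeasure_letter [MeasurableSpace W] [MeasurableSingletonClass W] [Finite W]
    (hRpos : ∀ y, 0 < R y) (hf : InCone f)
    (hf0 : f ≠ 0) {c : ℕ → ℝ} (hc : ∀ n, 0 ≤ c n) {t : ℝ} (ht : 0 < t)
    (h : normSq R s A a x f (coeff c t) ≠ ∞)
    (hpos : 0 < inner ℝ (phiVec R s A a x f c t) (phiVec R s A a x f c t)) :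
    approxMeasure R s A a x f c t {y | y.1 0 = A} = 1 := by
  have hS : MeasurableSet {y : MarkovShift τ | y.1 0 = A} := by
    rw [show {y : MarkovShift τ | y.1 0 = A} = (fun y : MarkovShift τ => y.1 0) ⁻¹' {A} from rfl]
    exact measurable_letter 0 (measurableSet_singleton A)
  rw [approxMeasure_apply hRpos hf hf0 hc ht h hpos hS]
  simp_rw [← sq]
  exact ENNReal.div_self ((inner_phiVec_pos_iff hRpos hf hf0 hc ht h).1 hpos) h

/-- The part of the series of bounded length is negligible. -/
theorem tsum_series_truncate_le [Finite W] (hRpos : ∀ y, 0 < R y) (hf : InCone f) (hf0 : f ≠ 0)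
    {c : ℕ → ℝ} (hc : ∀ n, 0 ≤ c n) {t : ℝ} (ht : 0 < t)
    (h : normSq R s A a x f (coeff c t) ≠ ∞) (b : ℕ → ℝ≥0∞) (S : Set (MarkovShift τ)) :
    ∑' q, series R s a x f b S q * series R s a x f (coeff c t) {y | y.1 0 = A} q ≤
      (∑' p : Preimage a x, b (p.1 + 1) * ENNReal.ofReal (birkhoffProd R (p.1 + 1) p.2.1)) *
        ENNReal.ofReal (‖f‖ * ‖phiVec R s A a x f c t‖) := by
  classical
  rw [tsum_series_mul_eq hRpos hf hf0 hc ht h, ← ENNReal.tsum_mul_right]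
  refine ENNReal.tsum_le_tsum fun p => ?_
  split_ifs
  · gcongr
    refine (real_inner_le_norm _ _).trans ?_
    rw [LinearIsometryEquiv.norm_map]
  · exact zero_le

/-- The cylinder estimate before the limit. The first term accounts for words of length at most `N +
n` and is evaluated at a fixed `u ≤ t`, so that apart from `‖Q‖` it is independent of `t`; the
second comes from deleting the prefix of longer words. -/
theorem approxMeasure_cylinder_le [MeasurableSpace W] [MeasurableSingletonClass W] [Finite W]
    (hRpos : ∀ y, 0 < R y) {D : ℝ} (hD : 0 < D)
    (hdist : ∀ (n : ℕ) (y z : MarkovShift τ), (∀ i < n, y.1 i = z.1 i) →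
      birkhoffProd R n y ≤ D * birkhoffProd R n z)
    (hf : InCone f) (hf0 : f ≠ 0) {c : ℕ → ℝ} (hc : SlowlyIncreasing c) {t u : ℝ} (hu : 0 < u)
    (hut : u ≤ t) (h : normSq R s A a x f (coeff c t) ≠ ∞)
    (hpos : 0 < inner ℝ (phiVec R s A a x f c t) (phiVec R s A a x f c t))
    {C : ℝ} (hC0 : 0 ≤ C) (hC : ∀ q : Σ i, G ⧸ H i, series R s a x f (coeff c t) Set.univ q ≤
      ENNReal.ofReal C * series R s a x f (coeff c t) {y | y.1 0 = A} q)
    (z : MarkovShift τ) (n N : ℕ) (hN : ∀ m ≥ N, c (m + n) ≤ 2 * c m) :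
    approxMeasure R s A a x f c t {y | ∀ i < n, y.1 i = z.1 i} ≤
      ENNReal.ofReal (
        (∑' p : Preimage a x, truncate (coeff c u) (N + n) (p.1 + 1) *
          ENNReal.ofReal (birkhoffProd R (p.1 + 1) p.2.1)).toReal * ‖f‖ /
            ‖phiVec R s A a x f c t‖ +
        2 * (t ^ n)⁻¹ * (D * birkhoffProd R n z) * C *
          matrixCoeff R s A a x f c t (wordValue s z 0 n)) := by
  have ht : 0 < t := hu.trans_le hut
  have hRn := birkhoffProd_pos hRpos n z
  set S : Set (MarkovShift τ) := {y | ∀ i < n, y.1 i = z.1 i} with hSdef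
  have hS : MeasurableSet S := by
    rw [show S = ⋂ i ∈ Set.Iio n, (fun y : MarkovShift τ => y.1 i) ⁻¹' {z.1 i} by
      ext y; simp [hSdef]]
    exact MeasurableSet.biInter (Set.finite_Iio n).countable fun i _ =>
      measurable_letter i (measurableSet_singleton _)
  set Q := phiVec R s A a x f c t with hQ
  set g := wordValue s z 0 n with hg
  set Φ := series R s a x f (coeff c t) {y | y.1 0 = A} with hΦ
  set w := ∑' p : Preimage a x, truncate (coeff c u) (N + n) (p.1 + 1) *
          ENNReal.ofReal (birkhoffProd R (p.1 + 1) p.2.1) with hw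
  have hwtop : w ≠ ∞ := truncate_tsum_ne_top (coeff_ne_top c u) _
  let head := truncate (coeff c t) (N + n)
  let tail : ℕ → ℝ≥0∞ := fun m => if m ≤ N + n then 0 else coeff c t m
  have hsplit : coeff c t = fun m => head m + tail m := by
    funext m
    simp only [head, tail, truncate]
    split_ifs <;> simp
  -- Cauchy–Schwarz makes the short words linear in `‖Q‖`, whereas the normalisation is quadratic.
  have hhead : ∑' q, series R s a x f head S q * Φ q ≤ ENNReal.ofReal (w.toReal * (‖f‖ * ‖Q‖)) := by
    refine (tsum_series_truncate_le hRpos hf hf0 hc.nonneg ht h head S).trans ?_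
    rw [ENNReal.ofReal_mul ENNReal.toReal_nonneg, ENNReal.ofReal_toReal hwtop]
    refine mul_le_mul_left (ENNReal.tsum_le_tsum fun p => mul_le_mul_left ?_ _) _
    simp only [head, truncate]
    split_ifs
    · refine ENNReal.ofReal_le_ofReal ?_
      have := hc.nonneg (p.1 + 1)
      gcongr
    · exact le_rfl
  -- Cutting the prefix gives the `g`-translate of the series over all words, which `hC` bounds by
  -- `C` times the `g`-translate of `Q`.
  have htail : ∑' q, series R s a x f tail S q * Φ q ≤
      ENNReal.ofReal (2 * (t ^ n)⁻¹ * (D * birkhoffProd R n z) * C * inner ℝ (rho H g Q) Q) := by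
    have h1 : ∀ q, series R s a x f tail S q ≤
        ENNReal.ofReal (2 * (t ^ n)⁻¹ * (D * birkhoffProd R n z)) *
          series R s a x f (coeff c t) Set.univ (g⁻¹ • q) := fun q => by
      refine series_cylinder_le hRpos hdist (fun m hm => if_pos (by omega)) (fun m => ?_) q
      split_ifs with hm
      · simp
      · rw [coeff, coeff, ← ENNReal.ofReal_mul (mul_nonneg (by positivity) (hc.nonneg _)),
          ← ENNReal.ofReal_mul (by positivity)]
        refine ENNReal.ofReal_le_ofReal ?_
        have h2 := hN m (by omega)
        calc (t ^ (m + n))⁻¹ * c (m + n) * (D * birkhoffProd R n z)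
            ≤ (t ^ (m + n))⁻¹ * (2 * c m) * (D * birkhoffProd R n z) := by gcongr
          _ = _ := by rw [pow_add, mul_inv]; ring
    rw [ENNReal.ofReal_mul (by positivity), ENNReal.ofReal_mul (by positivity),
      ofReal_inner_rho_phiVec_self hRpos hf hf0 hc.nonneg ht h, ← ENNReal.tsum_mul_left]
    refine ENNReal.tsum_le_tsum fun q => ?_
    rw [← mul_assoc]
    refine mul_le_mul_left ((h1 q).trans ?_) _
    rw [mul_assoc (ENNReal.ofReal _) (ENNReal.ofReal C)]
    exact mul_le_mul_right (hC _) _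
  have hsum : ∑' q, series R s a x f (coeff c t) S q * Φ q ≤
      ENNReal.ofReal (w.toReal * (‖f‖ * ‖Q‖) +
        2 * (t ^ n)⁻¹ * (D * birkhoffProd R n z) * C * inner ℝ (rho H g Q) Q) := by
    have hin : 0 ≤ inner ℝ (rho H g Q) Q :=
      inner_nonneg_of_nonneg (rho_nonneg (phiVec_nonneg hRpos hf hc.nonneg ht) g)
        (phiVec_nonneg hRpos hf hc.nonneg ht)
    rw [ENNReal.ofReal_add (by positivity) (by positivity)]
    refine le_trans (le_of_eq ?_) (add_le_add hhead htail)
    rw [← ENNReal.tsum_add]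
    refine tsum_congr fun q => ?_
    rw [← add_mul, ← series_add, ← hsplit]
  rw [approxMeasure_apply hRpos hf hf0 hc.nonneg ht h hpos hS,
    ← ofReal_inner_phiVec hRpos hf hf0 hc.nonneg ht h]
  refine (ENNReal.div_le_div_right hsum _).trans (le_of_eq ?_)
  rw [← ENNReal.ofReal_div_of_pos hpos, matrixCoeff]
  congr 1
  have hQn : 0 < ‖Q‖ := by
    rw [real_inner_self_eq_norm_sq] at hpos
    exact norm_pos_iff.2 fun h0 => by simp [h0] at hpos
  rw [add_div, ← hQ, mul_div_assoc _ _ (inner ℝ Q Q), real_inner_self_eq_norm_sq]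
  congr 1
  · field_simp
  · rw [mul_div_assoc]

variable [TopologicalSpace W] [DiscreteTopology W]

/-- The series over the words starting with `B`, translated by `g`, is dominated by the series over
the words starting with `A`. -/
theorem exists_series_letter_le (hlive : ∀ B : W, ∃ y : MarkovShift τ, y.1 0 = B)
    (htrans : IsTransitiveSkew τ s) {r : ℝ} (hr : 0 < r) (hRr : ∀ y, r ≤ R y) {T : ℝ≥0∞}
    (hT : T ≠ ∞) (a : W) (x : MarkovShift τ) (f : QuotientSum H) (A B : W) (g : G) :
    ∃ C : ℝ≥0∞, C ≠ ∞ ∧ ∀ b : ℕ → ℝ≥0∞, (∀ n, b n ≤ T * b (n + 1)) → ∀ q : Σ i, G ⧸ H i,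
      series R s a x f b {y | y.1 0 = B} (g⁻¹ • q) ≤ C * series R s a x f b {y | y.1 0 = A} q := by
  obtain ⟨p, k, rfl, rfl, rfl⟩ := exists_connector hlive htrans A B g
  have hrk : ENNReal.ofReal (r ^ k) ≠ 0 := (ENNReal.ofReal_pos.2 (by positivity)).ne'
  refine ⟨T ^ k * (ENNReal.ofReal (r ^ k))⁻¹,
    ENNReal.mul_ne_top (ENNReal.pow_ne_top hT) (ENNReal.inv_ne_top.2 hrk), fun b hb q => ?_⟩
  refine series_letter_translate_le hr hRr (fun n => ?_) q
  rw [mul_assoc (T ^ k), ENNReal.inv_mul_cancel hrk ENNReal.ofReal_ne_top, mul_one]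
  exact le_pow_mul_add hb n k

/-- Finitely many first letters, each reached from `A` by a connecting word of value 1. This bounds
both the cylinders and the total mass of the approximating measures. -/
theorem exists_series_univ_le [Finite W] (hlive : ∀ B : W, ∃ y : MarkovShift τ, y.1 0 = B)
    (htrans : IsTransitiveSkew τ s) {r : ℝ} (hr : 0 < r) (hRr : ∀ y, r ≤ R y) {T : ℝ≥0∞}
    (hT : T ≠ ∞) (a : W) (x : MarkovShift τ) (f : QuotientSum H) (A : W) :
    ∃ C : ℝ≥0∞, C ≠ ∞ ∧ ∀ b : ℕ → ℝ≥0∞, (∀ n, b n ≤ T * b (n + 1)) → ∀ q : Σ i, G ⧸ H i,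
      series R s a x f b Set.univ q ≤ C * series R s a x f b {y | y.1 0 = A} q := by
  have := Fintype.ofFinite W
  choose C hC hle using fun B => exists_series_letter_le hlive htrans hr hRr hT a x f A B 1
  refine ⟨∑ B, C B, ENNReal.sum_ne_top.2 fun B _ => hC B, fun b hb q => ?_⟩
  rw [series_univ_eq, Finset.sum_mul]
  refine Finset.sum_le_sum fun B _ => ?_
  simpa using hle B b hb q

end Approx

/-! ### The limit measure -/

section Limit

variable {W : Type*} {τ : W → W → Prop} {G : Type*} [Group G] {I : Type*} {H : I → Subgroup G}
  {R : MarkovShift τ → ℝ} {s : W → G} {A a : W} {x : MarkovShift τ} {f : QuotientSum H}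
  {c t : ℕ → ℝ} {Υ : G → ℝ}

theorem matrixCoeff_nonneg (hRpos : ∀ y, 0 < R y) (hf : InCone f) {c : ℕ → ℝ}
    (hc : ∀ n, 0 ≤ c n) {t : ℝ} (ht : 0 < t) (g : G) : 0 ≤ matrixCoeff R s A a x f c t g :=
  div_nonneg (inner_nonneg_of_nonneg (rho_nonneg (phiVec_nonneg hRpos hf hc ht) g)
    (phiVec_nonneg hRpos hf hc ht)) real_inner_self_nonneg

theorem exists_continuousMap_indicator {X : Type*} [TopologicalSpace X] {S : Set X}
    (hS : IsClopen S) : ∃ F : C(X, ℝ), ∀ z, F z = S.indicator 1 z := by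
  have h := (LocallyConstant.charFn ℝ hS).continuous
  rw [LocallyConstant.coe_charFn] at h
  exact ⟨⟨S.indicator 1, h⟩, fun _ => rfl⟩

variable [MeasurableSpace W] {ν : Measure (MarkovShift τ)}

/-- Borel–Cantelli. The inequality at stage `n` depends only on the first `j + n` letters, so the
exceptional set is a union of cylinders, and on each of these `Υ` may be replaced by the larger `ψ
n` in the cylinder estimate. -/
theorem ae_eventually_le_of_tsum_ne_top [Finite W] [IsFiniteMeasure ν] {j : ℕ} {C : ℝ} (hC : 0 ≤ C)
    {p : (n : ℕ) → MarkovShift τ → ℝ} (hp : ∀ n z, 0 ≤ p n z)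
    (hν : ∀ (z : MarkovShift τ) (n : ℕ), ν.real {y | ∀ i < j + n, y.1 i = z.1 i} ≤
      C * p n z * Υ (wordValue s z j n)) {ψ : ℕ → G → ℝ}
    (hψ : ∑' n, ∑' u : Words τ (j + n),
      ENNReal.ofReal (p n u.rep * ψ n (wordValue s u.rep j n)) ≠ ∞) :
    ∀ᵐ z ∂ν, ∃ N : ℕ, ∀ n ≥ N, ψ n (wordValue s z j n) ≤ Υ (wordValue s z j n) := by
  let bad : ℕ → Set (MarkovShift τ) := fun n =>
    {z | Υ (wordValue s z j n) < ψ n (wordValue s z j n)}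
  have hbad : ∀ n, ν (bad n) ≤ ENNReal.ofReal C * ∑' u : Words τ (j + n),
      ENNReal.ofReal (p n u.rep * ψ n (wordValue s u.rep j n)) := by
    intro n
    have hsub : bad n ⊆ ⋃ u : Words τ (j + n), (bad n ∩ {y | ∀ i < j + n, y.1 i = u.rep.1 i}) := by
      intro z hz
      exact Set.mem_iUnion.2 ⟨wordOf z (j + n), hz, fun i hi => (rep_wordOf z hi).symm⟩
    refine (measure_mono hsub).trans ((measure_iUnion_le _).trans ?_)
    rw [← ENNReal.tsum_mul_left]
    refine ENNReal.tsum_le_tsum fun u => ?_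
    by_cases hu : u.rep ∈ bad n
    · have hu' : Υ (wordValue s u.rep j n) < ψ n (wordValue s u.rep j n) := hu
      calc ν (bad n ∩ {y | ∀ i < j + n, y.1 i = u.rep.1 i})
          ≤ ν {y | ∀ i < j + n, y.1 i = u.rep.1 i} := measure_mono Set.inter_subset_right
        _ = ENNReal.ofReal (ν.real {y | ∀ i < j + n, y.1 i = u.rep.1 i}) :=
          (ENNReal.ofReal_toReal (measure_ne_top ν _)).symm
        _ ≤ ENNReal.ofReal (C * (p n u.rep * ψ n (wordValue s u.rep j n))) := by
          refine ENNReal.ofReal_le_ofReal ((hν u.rep n).trans ?_)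
          rw [mul_assoc]
          have := hp n u.rep
          gcongr
        _ = _ := ENNReal.ofReal_mul hC
    · have : bad n ∩ {y | ∀ i < j + n, y.1 i = u.rep.1 i} = ∅ := by
        rw [Set.eq_empty_iff_forall_notMem]
        rintro z ⟨hz1, hz2⟩
        refine hu ?_
        have h := wordValue_congr s (j := j) (n := n) hz2
        have hz : Υ (wordValue s z j n) < ψ n (wordValue s z j n) := hz1
        rw [h] at hz
        exact hz
      rw [this, measure_empty]
      exact zero_le
  have hsum : ∑' n, ν (bad n) ≠ ∞ := by
    refine ne_top_of_le_ne_top ?_ (ENNReal.tsum_le_tsum hbad)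
    rw [ENNReal.tsum_mul_left]
    exact ENNReal.mul_ne_top ENNReal.ofReal_ne_top hψ
  filter_upwards [ae_eventually_notMem hsum] with z hz
  obtain ⟨N, hN⟩ := eventually_atTop.1 hz
  exact ⟨N, fun n hn => not_lt.1 (hN n hn)⟩

variable [TopologicalSpace W]

theorem IsTwistedLimit.tendsto_param_gt (hlim : IsTwistedLimit R s A a x f c t Υ ν) :
    Tendsto t atTop (𝓝[>] (decayExponent R s A a x f)) :=
  tendsto_nhdsWithin_iff.2 ⟨hlim.tendsto_param, Eventually.of_forall hlim.lt_param⟩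

theorem IsTwistedLimit.exists_le (hlim : IsTwistedLimit R s A a x f c t Υ ν) :
    ∃ T : ℝ, ∀ k, t k ≤ T := by
  obtain ⟨T, hT⟩ := hlim.tendsto_param.bddAbove_range
  exact ⟨T, fun k => hT ⟨k, rfl⟩⟩

theorem IsTwistedLimit.nonneg (hlim : IsTwistedLimit R s A a x f c t Υ ν) (hRpos : ∀ y, 0 < R y)
    (hf : InCone f) (hγ : 0 < decayExponent R s A a x f) (g : G) : 0 ≤ Υ g :=
  ge_of_tendsto' (hlim.tendsto_coeff g) fun k =>
    matrixCoeff_nonneg hRpos hf hlim.slowlyIncreasing.nonneg (hγ.trans (hlim.lt_param k)) g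

variable [DiscreteTopology W] [Finite W]

/-- `⟨ρ(gh) Q, Q⟩ = ⟨ρ(h) Q, ρ(g⁻¹) Q⟩`, and `ρ(g⁻¹) Q ≤ C Q` coordinatewise by prefixing a loop at
`A` of value `g⁻¹`. -/
theorem IsTwistedLimit.exists_coeff_mul_le (hlim : IsTwistedLimit R s A a x f c t Υ ν)
    (hlive : ∀ B : W, ∃ y : MarkovShift τ, y.1 0 = B) (htrans : IsTransitiveSkew τ s)
    {r r' : ℝ} (hr : 0 < r) (hRr : ∀ y, r ≤ R y) (hRr' : ∀ y, R y ≤ r')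
    (hf : InCone f) (hf0 : f ≠ 0) (hγ : 0 < decayExponent R s A a x f) (g : G) :
    ∃ C : ℝ, 0 ≤ C ∧ ∀ h : G, Υ (g * h) ≤ C * Υ h := by
  have hRpos : ∀ y, 0 < R y := fun y => hr.trans_le (hRr y)
  have hc := hlim.slowlyIncreasing
  obtain ⟨T, hT⟩ := hlim.exists_le
  obtain ⟨C, hCtop, hC⟩ := exists_series_letter_le hlive htrans hr hRr
    (ENNReal.ofReal_ne_top (r := T)) a x f A A g⁻¹
  refine ⟨C.toReal, ENNReal.toReal_nonneg, fun h => ?_⟩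
  refine le_of_tendsto_of_tendsto' (hlim.tendsto_coeff (g * h))
    ((hlim.tendsto_coeff h).const_mul C.toReal) fun k => ?_
  have htk := hlim.lt_param k
  have ht0 : 0 < t k := hγ.trans htk
  have hfin := normSq_coeff_ne_top (s := s) (A := A) (a := a) (x := x) hRpos hRr' hf hc htk
  have hQ := phiVec_nonneg (s := s) (A := A) (a := a) (x := x) hRpos hf hc.nonneg ht0
  rw [matrixCoeff, matrixCoeff, ← mul_div_assoc]
  refine div_le_div_of_nonneg_right ?_ real_inner_self_nonneg
  have hin := inner_nonneg_of_nonneg (rho_nonneg hQ h) hQ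
  rw [← ENNReal.ofReal_le_ofReal_iff (by positivity), ENNReal.ofReal_mul ENNReal.toReal_nonneg,
    ENNReal.ofReal_toReal hCtop, ofReal_inner_rho_phiVec_self hRpos hf hf0 hc.nonneg ht0 hfin,
    ofReal_inner_rho_phiVec_self hRpos hf hf0 hc.nonneg ht0 hfin, ← ENNReal.tsum_mul_left,
    ← (MulAction.toPerm g).tsum_eq]
  refine ENNReal.tsum_le_tsum fun q => ?_
  have h1 := hC _ (coeff_le_mul_succ hc ht0 (hT k)) q
  rw [inv_inv] at h1
  simp only [MulAction.toPerm_apply, mul_inv_rev, mul_smul, inv_smul_smul]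
  calc _ ≤ _ := mul_le_mul_right h1 _
    _ = _ := by ring

variable [BorelSpace W]

/-- Indicators of clopen sets are continuous, hence admissible test functions for weak-*
convergence. -/
theorem IsTwistedLimit.tendsto_measureReal (hlim : IsTwistedLimit R s A a x f c t Υ ν)
    {S : Set (MarkovShift τ)} (hS : IsClopen S) :
    Tendsto (fun k => (approxMeasure R s A a x f c (t k)).real S) atTop (𝓝 (ν.real S)) := by
  obtain ⟨F, hF⟩ := exists_continuousMap_indicator hS
  have h := hlim.tendsto_measure F
  simp_rw [hF, integral_indicator_one hS.isOpen.measurableSet] at h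
  exact h

/-- The limit of `approxMeasure_cylinder_le` with `u = γ`: the short words vanish because `‖Q_k‖ →
∞`. The threshold `N` depends on `n`, but it enters only that vanishing term. -/
theorem IsTwistedLimit.exists_measure_cylinder_le (hlim : IsTwistedLimit R s A a x f c t Υ ν)
    (hlive : ∀ B : W, ∃ y : MarkovShift τ, y.1 0 = B) (htrans : IsTransitiveSkew τ s)
    {r r' : ℝ} (hr : 0 < r) (hRr : ∀ y, r ≤ R y) (hRr' : ∀ y, R y ≤ r') {D : ℝ} (hD : 0 < D)
    (hdist : ∀ (n : ℕ) (y z : MarkovShift τ), (∀ i < n, y.1 i = z.1 i) →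
      birkhoffProd R n y ≤ D * birkhoffProd R n z)
    (hf : InCone f) (hf0 : f ≠ 0) (hγ : 0 < decayExponent R s A a x f) :
    ∃ C : ℝ, 0 ≤ C ∧ ∀ (z : MarkovShift τ) (n : ℕ), ν.real {y | ∀ i < n, y.1 i = z.1 i} ≤
      C * (decayExponent R s A a x f ^ n)⁻¹ * birkhoffProd R n z * Υ (wordValue s z 0 n) := by
  set γ := decayExponent R s A a x f with hγdef
  have hRpos : ∀ y, 0 < R y := fun y => hr.trans_le (hRr y)
  have hc := hlim.slowlyIncreasing
  obtain ⟨T, hT⟩ := hlim.exists_le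
  obtain ⟨C, hCtop, hC⟩ := exists_series_univ_le hlive htrans hr hRr
    (ENNReal.ofReal_ne_top (r := T)) a x f A
  refine ⟨2 * D * C.toReal, by positivity, fun z n => ?_⟩
  obtain ⟨N, hN⟩ := eventually_atTop.1
    ((hc.slow n).eventually_le_const (show (1 : ℝ) < 2 by norm_num))
  have hN' : ∀ m ≥ N, c (m + n) ≤ 2 * c m := fun m hm =>
    (div_le_iff₀ (hc.pos m)).1 (hN m hm)
  have hdiv := hlim.diverges.comp hlim.tendsto_param_gt
  have hnorm : Tendsto (fun k => ‖phiVec R s A a x f c (t k)‖) atTop atTop := by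
    refine (Real.tendsto_sqrt_atTop.comp hdiv).congr fun k => ?_
    simp only [Function.comp_apply]
    rw [real_inner_self_eq_norm_sq, Real.sqrt_sq (norm_nonneg _)]
  set w := (∑' p : Preimage a x, truncate (coeff c γ) (N + n) (p.1 + 1) *
          ENNReal.ofReal (birkhoffProd R (p.1 + 1) p.2.1)).toReal
  have hrhs : Tendsto (fun k => w * ‖f‖ / ‖phiVec R s A a x f c (t k)‖ +
        2 * (t k ^ n)⁻¹ * (D * birkhoffProd R n z) * C.toReal *
          matrixCoeff R s A a x f c (t k) (wordValue s z 0 n)) atTop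
      (𝓝 (0 + 2 * (γ ^ n)⁻¹ * (D * birkhoffProd R n z) * C.toReal *
          Υ (wordValue s z 0 n))) := by
    refine (hnorm.const_div_atTop _).add (Tendsto.mul ?_ (hlim.tendsto_coeff _))
    refine Tendsto.mul_const _ (Tendsto.mul_const _ (Tendsto.const_mul _ ?_))
    exact (hlim.tendsto_param.pow n).inv₀ (by positivity)
  have hle : ∀ᶠ k in atTop, (approxMeasure R s A a x f c (t k)).real {y | ∀ i < n, y.1 i = z.1 i} ≤
      w * ‖f‖ / ‖phiVec R s A a x f c (t k)‖ +
        2 * (t k ^ n)⁻¹ * (D * birkhoffProd R n z) * C.toReal *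
          matrixCoeff R s A a x f c (t k) (wordValue s z 0 n) := by
    filter_upwards [hdiv.eventually_gt_atTop 0] with k hk
    have htk := hlim.lt_param k
    have ht0 : 0 < t k := hγ.trans htk
    have hRn := (birkhoffProd_pos hRpos n z).le
    have hm := matrixCoeff_nonneg (s := s) (A := A) (a := a) (x := x) hRpos hf hc.nonneg ht0
      (wordValue s z 0 n)
    refine ENNReal.toReal_le_of_le_ofReal (by positivity) ?_
    refine approxMeasure_cylinder_le hRpos hD hdist hf hf0 hc hγ htk.le
      (normSq_coeff_ne_top hRpos hRr' hf hc htk) hk ENNReal.toReal_nonneg (fun q => ?_) z n N hN'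
    rw [ENNReal.ofReal_toReal hCtop]
    exact hC _ (coeff_le_mul_succ hc ht0 (hT k)) q
  have := le_of_tendsto_of_tendsto
    (hlim.tendsto_measureReal (isClopen_cylinder z.1 n)) hrhs hle
  refine this.trans (le_of_eq ?_)
  ring

/-- Cylinders on which the letters `x_j ⋯ x_{j+n-1}` spell a given word have small measure when `Υ`
is small on this word. -/
theorem IsTwistedLimit.exists_measure_le (hlim : IsTwistedLimit R s A a x f c t Υ ν)
    (hlive : ∀ B : W, ∃ y : MarkovShift τ, y.1 0 = B) (htrans : IsTransitiveSkew τ s)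
    {r r' : ℝ} (hr : 0 < r) (hRr : ∀ y, r ≤ R y) (hRr' : ∀ y, R y ≤ r') {D : ℝ} (hD : 0 < D)
    (hdist : ∀ (n : ℕ) (y z : MarkovShift τ), (∀ i < n, y.1 i = z.1 i) →
      birkhoffProd R n y ≤ D * birkhoffProd R n z)
    (hf : InCone f) (hf0 : f ≠ 0) (hγ : 0 < decayExponent R s A a x f) (j : ℕ) :
    ∃ C : ℝ, 0 ≤ C ∧ ∀ (z : MarkovShift τ) (n : ℕ), ν.real {y | ∀ i < j + n, y.1 i = z.1 i} ≤
      C * ((decayExponent R s A a x f ^ (j + n))⁻¹ * birkhoffProd R (j + n) z) *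
        Υ (wordValue s z j n) := by
  have hRpos : ∀ y, 0 < R y := fun y => hr.trans_le (hRr y)
  have hΥ := hlim.nonneg hRpos hf hγ
  obtain ⟨C, hC0, hC⟩ := hlim.exists_measure_cylinder_le hlive htrans hr hRr hRr' hD hdist hf hf0 hγ
  choose K hK0 hK using hlim.exists_coeff_mul_le hlive htrans hr hRr hRr' hf hf0 hγ
  -- There are finitely many words of length `j`, so the constants for deleting them can be summed
  -- into one.
  have := Fintype.ofFinite (Words τ j)
  refine ⟨C * ∑ u : Words τ j, K (wordValue s u.rep 0 j),
    mul_nonneg hC0 (Finset.sum_nonneg fun u _ => hK0 _), fun z n => (hC z _).trans ?_⟩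
  have h1 : wordValue s z 0 j = wordValue s (wordOf z j).rep 0 j :=
    wordValue_congr s fun i hi => (rep_wordOf z (by omega)).symm
  have h2 : K (wordValue s z 0 j) ≤ ∑ u : Words τ j, K (wordValue s u.rep 0 j) := by
    rw [h1]
    exact Finset.single_le_sum (f := fun u : Words τ j => K (wordValue s u.rep 0 j))
      (fun u _ => hK0 _) (Finset.mem_univ _)
  have h3 : Υ (wordValue s z 0 (j + n)) ≤
      (∑ u : Words τ j, K (wordValue s u.rep 0 j)) * Υ (wordValue s z j n) := by
    rw [wordValue_add, wordValue_shift s z j n]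
    exact (hK _ _).trans (mul_le_mul_of_nonneg_right h2 (hΥ _))
  have hp := (birkhoffProd_pos hRpos (j + n) z).le
  calc _ ≤ C * (decayExponent R s A a x f ^ (j + n))⁻¹ * birkhoffProd R (j + n) z *
        ((∑ u : Words τ j, K (wordValue s u.rep 0 j)) * Υ (wordValue s z j n)) := by gcongr
    _ = _ := by ring

end Limit

/-! ### Series over all words -/

section WordSeries

variable {W : Type*} {τ : W → W → Prop} {G : Type*} [Group G] {I : Type*} {H : I → Subgroup G}
  {R : MarkovShift τ → ℝ} {s : W → G} {A a : W} {x : MarkovShift τ} {f : QuotientSum H}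

variable [TopologicalSpace W] [DiscreteTopology W]

/-- Words between two prescribed letters are completed to words from `A` to `a` of the same
value. -/
theorem exists_wordSeries_letters_le (hlive : ∀ B : W, ∃ y : MarkovShift τ, y.1 0 = B)
    (htrans : IsTransitiveSkew τ s) (hx : τ a (x.1 0)) {r : ℝ} (hr : 0 < r) (hRr : ∀ y, r ≤ R y)
    {D : ℝ} (hD : 0 < D)
    (hdist : ∀ (n : ℕ) (y z : MarkovShift τ), (∀ i < n, y.1 i = z.1 i) →
      birkhoffProd R n y ≤ D * birkhoffProd R n z)
    {b : ℕ → ℝ≥0∞} {T : ℝ≥0∞} (hT : T ≠ ∞) (hb : ∀ n, b n ≤ T * b (n + 1))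
    (f : QuotientSum H) (A B E : W) [DecidableEq W] :
    ∃ C : ℝ≥0∞, C ≠ ∞ ∧ ∀ q : Σ i, G ⧸ H i,
      (∑' w : Σ m, Words τ m, if w.2.rep.1 0 = B ∧ w.2.rep.1 w.1 = E then
        seriesTerm R s f b q w.1 w.2.rep else 0) ≤
        C * series R s a x f b {y | y.1 0 = A} q := by
  classical
  have hRpos : ∀ y, 0 < R y := fun y => hr.trans_le (hRr y)
  obtain ⟨p, k, hp0, hpk, hpv⟩ := exists_connector hlive htrans A B 1
  -- The letter `a` is appended after this connector, so the completed suffix has value `(s a)⁻¹ * s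
  -- a = 1`.
  obtain ⟨e, l, he0, hel, hev⟩ := exists_connector hlive htrans E a (s a)⁻¹
  have hcons : e.1 l = (cons a x hx).1 0 := hel
  let e' : MarkovShift τ := glue e l (cons a x hx) hcons
  have he'0 : e'.1 0 = E := by rw [← he0]; exact glue_apply_le hcons (Nat.zero_le _)
  have he's : shift^[l + 1] e' = x := by
    rw [Function.iterate_succ_apply', shift_iterate_glue, shift_cons]
  have he'l : e'.1 l = a := by rw [← hel]; exact glue_apply_le hcons le_rfl
  have he'v : wordValue s e' 0 (l + 1) = 1 := by
    rw [wordValue_add, shift_iterate_glue, wordValue_succ, wordValue_zero, cons_zero,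
      wordValue_congr s (z := e) fun i hi => glue_apply_lt hcons (by omega), hev]
    simp
  -- `E` is the letter that follows the word in its representative, not its last letter; this also
  -- makes sense for the empty word.
  let S : Set (Σ m, Words τ m) := {w | w.2.rep.1 0 = B ∧ w.2.rep.1 w.1 = E}
  let y₁ : S → MarkovShift τ := fun w => glue w.1.2.rep w.1.1 e' (by rw [he'0]; exact w.2.2)
  have hy₁0 : ∀ w, (y₁ w).1 0 = B := fun w =>
    (glue_apply_le (by rw [he'0]; exact w.2.2) (Nat.zero_le _)).trans w.2.1
  have hy₁s : ∀ w, shift^[w.1.1] (y₁ w) = e' := fun w =>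
    shift_iterate_glue (by rw [he'0]; exact w.2.2)
  have hy₁l : ∀ w, ∀ i < w.1.1, (y₁ w).1 i = w.1.2.rep.1 i := fun w i hi =>
    glue_apply_lt (by rw [he'0]; exact w.2.2) hi
  let y₂ : S → MarkovShift τ := fun w => glue p k (y₁ w) (by rw [hpk, hy₁0])
  have hy₂0 : ∀ w, (y₂ w).1 0 = A := fun w =>
    (glue_apply_le (by rw [hpk, hy₁0]) (Nat.zero_le _)).trans hp0
  have hy₂s : ∀ w, shift^[k] (y₂ w) = y₁ w := fun w => shift_iterate_glue (by rw [hpk, hy₁0])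
  have hy₂l : ∀ w, ∀ i < k, (y₂ w).1 i = p.1 i := fun w i hi =>
    glue_apply_lt (by rw [hpk, hy₁0]) hi
  have hy₂e : ∀ w, shift^[w.1.1 + k] (y₂ w) = e' := fun w => by
    rw [Function.iterate_add_apply, hy₂s, hy₁s]
  let φ : S → Preimage a x := fun w => ⟨l + (w.1.1 + k), y₂ w, by
      rw [show l + (w.1.1 + k) + 1 = (l + 1) + (w.1.1 + k) by omega,
        Function.iterate_add_apply shift (l + 1) (w.1.1 + k), hy₂e, he's], by
      rw [← shift_iterate_apply, hy₂e, he'l]⟩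
  have hφ : Function.Injective φ := by
    intro w w' h
    have h1 : l + (w.1.1 + k) = l + (w'.1.1 + k) := congrArg Sigma.fst h
    have h2 : y₂ w = y₂ w' := congrArg (fun v : Preimage a x => v.2.1) h
    have h3 : y₁ w = y₁ w' := by rw [← hy₂s w, ← hy₂s w', h2]
    obtain ⟨⟨m, u⟩, hu⟩ := w
    obtain ⟨⟨m', u'⟩, hu'⟩ := w'
    obtain rfl : m = m' := by simp only at h1; omega
    have : u = u' := Words.ext_rep fun i hi => by
      rw [← hy₁l ⟨⟨m, u⟩, hu⟩ i hi, ← hy₁l ⟨⟨m, u'⟩, hu'⟩ i hi, h3]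
    subst this
    rfl
  have hrk : 0 < r ^ (k + (l + 1)) := by positivity
  refine ⟨ENNReal.ofReal (D * (r ^ (k + (l + 1)))⁻¹) * T ^ (k + (l + 1)),
    ENNReal.mul_ne_top ENNReal.ofReal_ne_top (ENNReal.pow_ne_top hT), fun q => ?_⟩
  refine tsum_le_mul_tsum_of_injective (φ := φ) hφ (fun w hw => if_neg hw) fun w => ?_
  have hA : (φ w).2.1 ∈ {y : MarkovShift τ | y.1 0 = A} := hy₂0 w
  have hw : w.1.2.rep.1 0 = B ∧ w.1.2.rep.1 w.1.1 = E := w.2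
  rw [if_pos hw, if_pos hA]
  have hlen : (φ w).1 + 1 = k + (w.1.1 + (l + 1)) := by
    change l + (w.1.1 + k) + 1 = _; omega
  have hval : wordValue s (y₂ w) 0 (k + (w.1.1 + (l + 1))) = wordValue s w.1.2.rep 0 w.1.1 := by
    rw [wordValue_add, hy₂s, wordValue_add, hy₁s, he'v,
      wordValue_congr s (z := p) fun i hi => hy₂l w i (by omega), hpv, one_mul, mul_one]
    exact wordValue_congr s fun i hi => hy₁l w i (by omega)
  have hprod : birkhoffProd R w.1.1 w.1.2.rep ≤
      D * (r ^ (k + (l + 1)))⁻¹ * birkhoffProd R (k + (w.1.1 + (l + 1))) (y₂ w) := by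
    rw [birkhoffProd_add, hy₂s, birkhoffProd_add, hy₁s]
    have h1 := pow_le_birkhoffProd hr hRr k (y₂ w)
    have h2 := pow_le_birkhoffProd hr hRr (l + 1) e'
    have h3 := hdist w.1.1 w.1.2.rep (y₁ w) fun i hi => (hy₁l w i hi).symm
    have h4 := birkhoffProd_pos hRpos w.1.1 (y₁ w)
    have h5 := birkhoffProd_pos hRpos k (y₂ w)
    calc birkhoffProd R w.1.1 w.1.2.rep ≤ D * birkhoffProd R w.1.1 (y₁ w) := h3
      _ = D * (r ^ (k + (l + 1)))⁻¹ * (r ^ k * (birkhoffProd R w.1.1 (y₁ w) * r ^ (l + 1))) := by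
        rw [pow_add]; field_simp
      _ ≤ _ := by gcongr
  have hterm : seriesTerm R s f b q w.1.1 w.1.2.rep ≤
      ENNReal.ofReal (D * (r ^ (k + (l + 1)))⁻¹) * T ^ (k + (l + 1)) *
        seriesTerm R s f b q (k + (w.1.1 + (l + 1))) (y₂ w) := by
    rw [seriesTerm, seriesTerm, hval, ← mul_assoc]
    refine mul_le_mul_left ?_ _
    calc b w.1.1 * ENNReal.ofReal (birkhoffProd R w.1.1 w.1.2.rep)
        ≤ (T ^ (k + (l + 1)) * b (w.1.1 + (k + (l + 1)))) *
          ENNReal.ofReal (D * (r ^ (k + (l + 1)))⁻¹ *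
            birkhoffProd R (k + (w.1.1 + (l + 1))) (y₂ w)) :=
          mul_le_mul' (le_pow_mul_add hb _ _) (ENNReal.ofReal_le_ofReal hprod)
      _ = _ := by
        rw [ENNReal.ofReal_mul (by positivity),
          show w.1.1 + (k + (l + 1)) = k + (w.1.1 + (l + 1)) by omega]
        ring
  refine hterm.trans (le_of_eq ?_)
  congr 2
  exact hlen.symm

theorem exists_wordSeries_le [Finite W] (hlive : ∀ B : W, ∃ y : MarkovShift τ, y.1 0 = B)
    (htrans : IsTransitiveSkew τ s) (hx : τ a (x.1 0)) {r : ℝ} (hr : 0 < r) (hRr : ∀ y, r ≤ R y)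
    {D : ℝ} (hD : 0 < D)
    (hdist : ∀ (n : ℕ) (y z : MarkovShift τ), (∀ i < n, y.1 i = z.1 i) →
      birkhoffProd R n y ≤ D * birkhoffProd R n z)
    {b : ℕ → ℝ≥0∞} {T : ℝ≥0∞} (hT : T ≠ ∞) (hb : ∀ n, b n ≤ T * b (n + 1))
    (f : QuotientSum H) (A : W) :
    ∃ C : ℝ≥0∞, C ≠ ∞ ∧ ∀ q : Σ i, G ⧸ H i,
      ∑' w : Σ m, Words τ m, seriesTerm R s f b q w.1 w.2.rep ≤
        C * series R s a x f b {y | y.1 0 = A} q := by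
  classical
  have := Fintype.ofFinite W
  choose C hC hle using fun v : W × W =>
    exists_wordSeries_letters_le hlive htrans hx hr hRr hD hdist hT hb f A v.1 v.2
  refine ⟨∑ v, C v, ENNReal.sum_ne_top.2 fun v _ => hC v, fun q => ?_⟩
  rw [Finset.sum_mul]
  refine le_trans (le_of_eq ?_) (Finset.sum_le_sum fun v _ => hle v q)
  rw [← Summable.tsum_finsetSum fun _ _ => ENNReal.summable]
  refine tsum_congr fun w => ?_
  rw [Finset.sum_eq_single (w.2.rep.1 0, w.2.rep.1 w.1)]
  · simp
  · rintro ⟨B, E⟩ - hne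
    rw [if_neg]
    rintro ⟨rfl, rfl⟩
    exact hne rfl
  · simp

theorem slowlyIncreasing_one : SlowlyIncreasing fun _ => 1 :=
  ⟨fun _ => one_pos, monotone_const, fun k => by simp⟩

/-- Completing words to words from `A` to `a` bounds the sum over all words coordinatewise by a
multiple of `φ[t] ∗ f`, an `ℓ²` vector for `t` above the exponent; pairing it with `v` is finite. -/
theorem tsum_words_inner_ne_top [Finite W] (hlive : ∀ B : W, ∃ y : MarkovShift τ, y.1 0 = B)
    (htrans : IsTransitiveSkew τ s) (hx : τ a (x.1 0)) {r r' : ℝ} (hr : 0 < r)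
    (hRr : ∀ y, r ≤ R y) (hRr' : ∀ y, R y ≤ r') {D : ℝ} (hD : 0 < D)
    (hdist : ∀ (n : ℕ) (y z : MarkovShift τ), (∀ i < n, y.1 i = z.1 i) →
      birkhoffProd R n y ≤ D * birkhoffProd R n z)
    (hf : InCone f) (hf0 : f ≠ 0) {t : ℝ} (ht : 0 < t) (hlt : decayExponent R s A a x f < t)
    {v : QuotientSum H} (hv : InCone v) :
    ∑' m, ∑' u : Words τ m, ENNReal.ofReal ((t ^ m)⁻¹ * birkhoffProd R m u.rep *
      inner ℝ (rho H (wordValue s u.rep 0 m) f) v) ≠ ∞ := by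
  have hRpos : ∀ y, 0 < R y := fun y => hr.trans_le (hRr y)
  have h1 := slowlyIncreasing_one
  have hfin := normSq_coeff_ne_top (s := s) (A := A) (a := a) (x := x) hRpos hRr' hf h1 hlt
  obtain ⟨C, hC, hle⟩ := exists_wordSeries_le hlive htrans hx hr hRr hD hdist
    (ENNReal.ofReal_ne_top (r := t)) (coeff_le_mul_succ h1 ht le_rfl) f A
  have hQ := phiVec_nonneg (s := s) (A := A) (a := a) (x := x) hRpos hf h1.nonneg ht
  have hterm : ∀ (m : ℕ) (u : Words τ m), ENNReal.ofReal ((t ^ m)⁻¹ * birkhoffProd R m u.rep *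
      inner ℝ (rho H (wordValue s u.rep 0 m) f) v) =
      ∑' q, seriesTerm R s f (coeff (fun _ => 1) t) q m u.rep * ENNReal.ofReal (v q) := by
    intro m u
    have hp := (birkhoffProd_pos hRpos m u.rep).le
    rw [ENNReal.ofReal_mul (by positivity), ENNReal.ofReal_mul (by positivity),
      ofReal_inner_eq_tsum (rho_nonneg hf _) hv, ← ENNReal.tsum_mul_left]
    refine tsum_congr fun q => ?_
    rw [seriesTerm, coeff, mul_one, rho_apply]
    ring
  simp_rw [hterm]
  have hswap : ∑' m, ∑' u : Words τ m, ∑' q,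
        seriesTerm R s f (coeff (fun _ => 1) t) q m u.rep * ENNReal.ofReal (v q) =
      ∑' q, (∑' w : Σ m, Words τ m, seriesTerm R s f (coeff (fun _ => 1) t) q w.1 w.2.rep) *
        ENNReal.ofReal (v q) := by
    simp_rw [← ENNReal.tsum_mul_right]
    rw [ENNReal.tsum_comm, ENNReal.tsum_sigma']
  rw [hswap]
  have hbound : ∑' q, (∑' w : Σ m, Words τ m,
      seriesTerm R s f (coeff (fun _ => 1) t) q w.1 w.2.rep) * ENNReal.ofReal (v q) ≤
      C * ENNReal.ofReal (inner ℝ (phiVec R s A a x f (fun _ => 1) t) v) := by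
    rw [ofReal_inner_eq_tsum hQ hv, ← ENNReal.tsum_mul_left]
    refine ENNReal.tsum_le_tsum fun q => ?_
    rw [ofReal_phiVec_apply hRpos hf hf0 h1.nonneg ht hfin, ← mul_assoc]
    exact mul_le_mul_left (hle q) _
  exact ne_top_of_le_ne_top (ENNReal.mul_ne_top hC ENNReal.ofReal_ne_top) hbound

/-- A version of `tsum_words_inner_ne_top` in which the first `j` letters of the words are dropped
from the group elements. -/
theorem tsum_words_inner_drop_ne_top [Finite W]
    (hlive : ∀ B : W, ∃ y : MarkovShift τ, y.1 0 = B)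
    (htrans : IsTransitiveSkew τ s) (hx : τ a (x.1 0)) {r r' : ℝ} (hr : 0 < r)
    (hRr : ∀ y, r ≤ R y) (hRr' : ∀ y, R y ≤ r') {D : ℝ} (hD : 0 < D)
    (hdist : ∀ (n : ℕ) (y z : MarkovShift τ), (∀ i < n, y.1 i = z.1 i) →
      birkhoffProd R n y ≤ D * birkhoffProd R n z)
    (hf : InCone f) (hf0 : f ≠ 0) {t : ℝ} (ht : 0 < t) (hlt : decayExponent R s A a x f < t)
    {v : QuotientSum H} (hv : InCone v) (j : ℕ) :
    ∑' n, ∑' u : Words τ (j + n), ENNReal.ofReal ((t ^ (j + n))⁻¹ * birkhoffProd R (j + n) u.rep *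
      inner ℝ (rho H (wordValue s u.rep j n) f) v) ≠ ∞ := by
  have hRpos : ∀ y, 0 < R y := fun y => hr.trans_le (hRr y)
  have := Fintype.ofFinite (Words τ j)
  -- By unitarity the missing prefix is transferred to `v`. Summing over the finitely many prefixes
  -- gives one vector of the cone that serves for all words.
  let v' : QuotientSum H := ∑ e : Words τ j, rho H (wordValue s e.rep 0 j) v
  have hv' : InCone v' := fun q => by
    simp only [v', lp.coeFn_sum, Finset.sum_apply]
    exact Finset.sum_nonneg fun e _ => rho_nonneg hv _ q
  refine ne_top_of_le_ne_top (tsum_words_inner_ne_top hlive htrans hx hr hRr hRr' hD hdist hf hf0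
    ht hlt hv') ?_
  refine le_trans ?_ (ENNReal.tsum_comp_le_tsum_of_injective (add_right_injective j)
    fun m => ∑' u : Words τ m, ENNReal.ofReal ((t ^ m)⁻¹ * birkhoffProd R m u.rep *
      inner ℝ (rho H (wordValue s u.rep 0 m) f) v'))
  refine ENNReal.tsum_le_tsum fun n => ENNReal.tsum_le_tsum fun u => ?_
  refine ENNReal.ofReal_le_ofReal ?_
  have hp := (birkhoffProd_pos hRpos (j + n) u.rep).le
  refine mul_le_mul_of_nonneg_left ?_ (by positivity)
  have h1 : wordValue s u.rep 0 j = wordValue s (wordOf u.rep j).rep 0 j :=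
    wordValue_congr s fun i hi => (rep_wordOf u.rep (by omega)).symm
  have h2 : inner ℝ (rho H (wordValue s u.rep j n) f) v =
      inner ℝ (rho H (wordValue s u.rep 0 (j + n)) f) (rho H (wordValue s u.rep 0 j) v) := by
    rw [wordValue_add, ← wordValue_shift, map_mul]
    exact (LinearIsometryEquiv.inner_map_map (rho H (wordValue s u.rep 0 j)) _ _).symm
  rw [h2, h1]
  simp only [v', inner_sum]
  exact Finset.single_le_sum (f := fun e : Words τ j =>
    inner ℝ (rho H (wordValue s u.rep 0 (j + n)) f) (rho H (wordValue s e.rep 0 j) v))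
    (fun e _ => inner_nonneg_of_nonneg (rho_nonneg hf _) (rho_nonneg hv _)) (Finset.mem_univ _)

end WordSeries

/-! ### Existence of the limits -/

section Existence

variable {W : Type*} {τ : W → W → Prop} {G : Type*} [Group G] {I : Type*} {H : I → Subgroup G}
  {R : MarkovShift τ → ℝ} {s : W → G} {A a : W} {x : MarkovShift τ} {f : QuotientSum H}

theorem abs_matrixCoeff_le_one (c : ℕ → ℝ) (t : ℝ) (g : G) :
    |matrixCoeff R s A a x f c t g| ≤ 1 := by
  rw [matrixCoeff, abs_div, abs_of_nonneg real_inner_self_nonneg]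
  refine div_le_one_of_le₀ ?_ real_inner_self_nonneg
  refine (abs_real_inner_le_norm _ _).trans ?_
  rw [LinearIsometryEquiv.norm_map, real_inner_self_eq_norm_mul_norm]

variable [TopologicalSpace W] [DiscreteTopology W] [MeasurableSpace W] [BorelSpace W]

/-- Finite measures of total mass between `1` and `C` on a compact space, together with bounded
functions on a countable set, converge along a subsequence. -/
theorem exists_subseq_tendsto {X : Type*} [TopologicalSpace X] [CompactSpace X]
    [TopologicalSpace.MetrizableSpace X] [MeasurableSpace X] [BorelSpace X]
    {ι : Type*} [Countable ι] {u : ℕ → ι → ℝ} (hu : ∀ k i, |u k i| ≤ 1)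
    {M : ℕ → Measure X} {C : ℝ≥0∞} (hC : C ≠ ∞) (hM : ∀ k, M k Set.univ ≤ C)
    (hM' : ∀ k, M k Set.univ ≠ 0) :
    ∃ (κ : ℕ → ℕ) (v : ι → ℝ) (ν : Measure X), StrictMono κ ∧ IsFiniteMeasure ν ∧
      (∀ i, Tendsto (fun k => u (κ k) i) atTop (𝓝 (v i))) ∧
      ∀ F : C(X, ℝ), Tendsto (fun k => ∫ z, F z ∂(M (κ k))) atTop (𝓝 (∫ z, F z ∂ν)) := by
  let : MetricSpace X := TopologicalSpace.metrizableSpaceMetric X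
  have hMtop : ∀ k, M k Set.univ ≠ ∞ := fun k => ne_top_of_le_ne_top hC (hM k)
  let P : ℕ → ProbabilityMeasure X := fun k => ⟨(M k Set.univ)⁻¹ • M k, ⟨by
    rw [Measure.smul_apply, smul_eq_mul, ENNReal.inv_mul_cancel (hM' k) (hMtop k)]⟩⟩
  -- The measures are normalised in order to use compactness of the probability measures; their
  -- masses are kept as a separate coordinate and multiplied back in the limit.
  let w : ℕ → (ι → ℝ) × ProbabilityMeasure X × ℝ := fun k => (u k, P k, (M k Set.univ).toReal)
  have hK : IsCompact ((Set.univ.pi fun _ : ι => Set.Icc (-1 : ℝ) 1) ×ˢ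
      ((Set.univ : Set (ProbabilityMeasure X)) ×ˢ Set.Icc (0 : ℝ) C.toReal)) :=
    (isCompact_univ_pi fun _ => isCompact_Icc).prod (isCompact_univ.prod isCompact_Icc)
  obtain ⟨⟨v, Q, m⟩, -, κ, hκ, hlim⟩ := hK.tendsto_subseq (x := w) fun k =>
    ⟨fun i _ => abs_le.1 (hu k i), Set.mem_univ _, ENNReal.toReal_nonneg,
      ENNReal.toReal_mono hC (hM k)⟩
  have h1 := (continuous_fst.tendsto _).comp hlim
  have h2 := ((continuous_fst.comp continuous_snd).tendsto _).comp hlim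
  have h3 := ((continuous_snd.comp continuous_snd).tendsto _).comp hlim
  refine ⟨κ, v, ENNReal.ofReal m • (Q : Measure X), hκ, ?_, fun i => ?_, fun F => ?_⟩
  · exact Measure.smul_finite _ ENNReal.ofReal_ne_top
  · exact (tendsto_pi_nhds.1 h1) i
  · have hm : 0 ≤ m := ge_of_tendsto' h3 fun k => ENNReal.toReal_nonneg
    have h4 := ProbabilityMeasure.tendsto_iff_forall_integral_tendsto.1 h2
      (BoundedContinuousFunction.mkOfCompact F)
    have h5 := h3.mul h4
    rw [integral_smul_measure, ENNReal.toReal_ofReal hm]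
    refine h5.congr fun k => ?_
    have h6 : (P (κ k) : Measure X) = (M (κ k) Set.univ)⁻¹ • M (κ k) := rfl
    change (M (κ k) Set.univ).toReal * ∫ z, F z ∂(P (κ k) : Measure X) = _
    rw [h6, integral_smul_measure, ENNReal.toReal_inv, smul_eq_mul, ← mul_assoc,
      mul_inv_cancel₀ (ENNReal.toReal_ne_zero.2 ⟨hM' _, hMtop _⟩), one_mul]

theorem exists_isTwistedLimit [CompactSpace (MarkovShift τ)] [Finite W] [Countable G]
    (hlive : ∀ B : W, ∃ y : MarkovShift τ, y.1 0 = B) (htrans : IsTransitiveSkew τ s)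
    {r r' : ℝ} (hr : 0 < r) (hRr : ∀ y, r ≤ R y) (hRr' : ∀ y, R y ≤ r')
    (hf : InCone f) (hf0 : f ≠ 0) (hγ : 0 < decayExponent R s A a x f) :
    ∃ (c : ℕ → ℝ) (t : ℕ → ℝ) (Υ : G → ℝ) (ν : Measure (MarkovShift τ)),
      IsTwistedLimit R s A a x f c t Υ ν := by
  set γ := decayExponent R s A a x f with hγdef
  have hRpos : ∀ y, 0 < R y := fun y => hr.trans_le (hRr y)
  obtain ⟨c, hc, htop⟩ := exists_slowlyIncreasing_normSq_eq_top (s := s) (A := A) (a := a) (x := x)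
    hRpos hf hγ
  have hdiv := tendsto_inner_phiVec_atTop (s := s) (A := A) (a := a) (x := x)
    hRpos hRr' hf hf0 hc hγ htop
  have hlim0 : Tendsto (fun k : ℕ => γ + 1 / ((k : ℝ) + 1)) atTop (𝓝[>] γ) := by
    refine tendsto_nhdsWithin_iff.2 ⟨?_, Eventually.of_forall fun k => ?_⟩
    · simpa using tendsto_one_div_add_atTop_nhds_zero_nat.const_add γ
    · exact lt_add_of_pos_right γ (by positivity)
  -- Starting the sequence at `k₀` makes every `⟨Q_k, Q_k⟩` positive, so all the normalisations are
  -- genuine divisions.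
  obtain ⟨k₀, hk₀⟩ := eventually_atTop.1 ((hdiv.comp hlim0).eventually_gt_atTop 0)
  let t₀ : ℕ → ℝ := fun k => γ + 1 / (((k + k₀ : ℕ) : ℝ) + 1)
  have ht₀ : Tendsto t₀ atTop (𝓝[>] γ) := hlim0.comp (tendsto_add_atTop_nat k₀)
  have hgt : ∀ k, γ < t₀ k := fun k => lt_add_of_pos_right γ (by positivity)
  have hpos0 : ∀ k, 0 < t₀ k := fun k => hγ.trans (hgt k)
  have hle : ∀ k, t₀ k ≤ γ + 1 := fun k => by
    refine add_le_add le_rfl (div_le_one_of_le₀ ?_ (by positivity))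
    exact le_add_of_nonneg_left (by positivity)
  have hfin : ∀ k, normSq R s A a x f (coeff c (t₀ k)) ≠ ∞ := fun k =>
    normSq_coeff_ne_top hRpos hRr' hf hc (hgt k)
  have hinner : ∀ k, 0 < inner ℝ (phiVec R s A a x f c (t₀ k)) (phiVec R s A a x f c (t₀ k)) :=
    fun k => hk₀ (k + k₀) (by omega)
  obtain ⟨C, hCtop, hC⟩ := exists_series_univ_le hlive htrans hr hRr
    (ENNReal.ofReal_ne_top (r := γ + 1)) a x f A
  have : TopologicalSpace.MetrizableSpace (MarkovShift τ) :=
    have := TopologicalSpace.metrizableSpace_of_t3_secondCountable (ℕ → W)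
    IsEmbedding.subtypeVal.metrizableSpace
  obtain ⟨κ, Υ, ν, hκ, hνfin, hcoeff, hmeas⟩ := exists_subseq_tendsto
    (u := fun k g => matrixCoeff R s A a x f c (t₀ k) g)
    (fun k g => abs_matrixCoeff_le_one c (t₀ k) g)
    (M := fun k => approxMeasure R s A a x f c (t₀ k)) hCtop (fun k => by
      rw [approxMeasure_apply hRpos hf hf0 hc.nonneg (hpos0 k) (hfin k) (hinner k)
        MeasurableSet.univ]
      refine ENNReal.div_le_of_le_mul (tsum_mul_le_mul_tsum_sq fun q => ?_)
      exact hC _ (coeff_le_mul_succ hc (hpos0 k) (hle k)) q) (fun k h0 => by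
      have h1 := approxMeasure_letter hRpos hf hf0 hc.nonneg (hpos0 k) (hfin k) (hinner k)
      rw [measure_mono_null (Set.subset_univ _) h0] at h1
      exact zero_ne_one h1)
  have hκt := ht₀.comp hκ.tendsto_atTop
  exact ⟨c, t₀ ∘ κ, Υ, ν, hc, hdiv, fun k => hgt _, (tendsto_nhdsWithin_iff.1 hκt).1, hcoeff,
    hνfin, hmeas⟩

end Existence

end

end TwistedDecay

open TwistedDecay

/-! ### The theorem: Borel–Cantelli applied to the two families of thresholds -/

theorem mainTheorem8
    {W : Type*} [Countable W] [TopologicalSpace W] [DiscreteTopology W]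
    [MeasurableSpace W] [BorelSpace W]
    (τ : W → W → Prop) [CompactSpace (MarkovShift τ)]
    (hlive : ∀ B : W, ∃ y : MarkovShift τ, y.1 0 = B)
    (hmix : IsMixing τ)
    (R : MarkovShift τ → ℝ) (hRpos : ∀ y, 0 < R y)
    (hR : LocallyHolder fun y => Real.log (R y))
    (hP : ∀ B : W, gurevicPressure R B = 0)
    {G : Type*} [Group G] [Countable G] (s : W → G)
    (htrans : IsTransitiveSkew τ s)
    {I : Type*} [Countable I] (H : I → Subgroup G)
    (A a : W) (x : MarkovShift τ) (hx : τ a (x.1 0))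
    (f : QuotientSum H) (hf : InCone f) (hf0 : f ≠ 0)
    (hγ : decayExponent R s A a x f < 1) :
    (∃ (c : ℕ → ℝ) (t : ℕ → ℝ) (Υ : G → ℝ) (ν : MeasureTheory.Measure (MarkovShift τ)),
      IsTwistedLimit R s A a x f c t Υ ν) ∧
    ∀ (c : ℕ → ℝ) (t : ℕ → ℝ) (Υ : G → ℝ) (ν : MeasureTheory.Measure (MarkovShift τ)),
      IsTwistedLimit R s A a x f c t Υ ν →
      ∀ j : ℕ, j ≤ 1 →
        (∀ ε : ℝ, 0 < ε → ε < 1 → ∀ v : QuotientSum H, InCone v →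
          ∀ᵐ z ∂ν, ∃ N : ℕ, ∀ n ≥ N,
            inner ℝ (rho H (wordValue s z j n) f) v ≤
              ((1 - ε) ^ n)⁻¹ * Υ (wordValue s z j n)) ∧
        (∀ᵐ z ∂ν, ∃ N : ℕ, ∀ n ≥ N,
          ((n : ℝ) ^ 2)⁻¹ * decayExponent R s A a x f ^ n ≤ Υ (wordValue s z j n)) := by
  have hfinW : Finite W := finite_alphabet hlive
  have hneW : Nonempty W := ⟨a⟩
  obtain ⟨L, -, hL⟩ := exists_bounds hR
  obtain ⟨D, hD, hdist⟩ := exists_distortion hRpos hR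
  obtain ⟨K, hK, hwords⟩ := exists_wordSum_le hlive hmix hRpos hR hP
  have hr : 0 < Real.exp (-L) := Real.exp_pos _
  have hRr : ∀ y, Real.exp (-L) ≤ R y := fun y => by
    rw [← Real.exp_log (hRpos y)]
    exact Real.exp_le_exp.2 (abs_le.1 (hL y)).1
  have hRr' : ∀ y, R y ≤ Real.exp L := fun y => by
    rw [← Real.exp_log (hRpos y)]
    exact Real.exp_le_exp.2 (abs_le.1 (hL y)).2
  have hγ0 : 0 < decayExponent R s A a x f :=
    hr.trans_le (le_decayExponent hlive hmix hx hr hRr hRr' hf hf0)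
  refine ⟨exists_isTwistedLimit hlive htrans hr hRr hRr' hf hf0 hγ0,
    fun c t Υ ν hlim j _ => ?_⟩
  have hνfin := hlim.finite
  set γ := decayExponent R s A a x f with hγdef
  obtain ⟨C, hC, hmeas⟩ := hlim.exists_measure_le hlive htrans hr hRr hRr' hD hdist hf hf0 hγ0 j
  have hp : ∀ n z, 0 ≤ (γ ^ (j + n))⁻¹ * birkhoffProd R (j + n) z := fun n z =>
    mul_nonneg (by positivity) (birkhoffProd_pos hRpos _ _).le
  constructor
  · intro ε hε0 hε1 v hv
    have h1ε : 0 < 1 - ε := by linarith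
    -- `γ⁻ⁿ (1 - ε)ⁿ = t⁻ⁿ` for `t = γ / (1 - ε)`, a parameter above the exponent.
    have hlt : γ < γ / (1 - ε) := (lt_div_iff₀ h1ε).2 (by nlinarith)
    have hsum := tsum_words_inner_drop_ne_top hlive htrans hx hr hRr hRr' hD hdist hf hf0
      (hγ0.trans hlt) hlt hv j
    have hae := ae_eventually_le_of_tsum_ne_top (s := s) (Υ := Υ) hC
      (p := fun n z => (γ ^ (j + n))⁻¹ * birkhoffProd R (j + n) z) hp hmeas
      (ψ := fun n g => (1 - ε) ^ n * inner ℝ (rho H g f) v) (by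
        -- The cylinders have length `j + n` but the threshold only has `(1 - ε) ^ n`; the
        -- discrepancy is this constant.
        have hfac : (ENNReal.ofReal ((1 - ε) ^ j)⁻¹) ≠ ∞ := ENNReal.ofReal_ne_top
        refine ne_top_of_le_ne_top (ENNReal.mul_ne_top hfac hsum) ?_
        simp_rw [← ENNReal.tsum_mul_left]
        refine ENNReal.tsum_le_tsum fun n => ENNReal.tsum_le_tsum fun u => ?_
        rw [← ENNReal.ofReal_mul (by positivity)]
        refine ENNReal.ofReal_le_ofReal (le_of_eq ?_)
        rw [div_pow, inv_div, pow_add (1 - ε)]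
        field_simp)
    filter_upwards [hae] with z hz
    obtain ⟨N, hN⟩ := hz
    exact ⟨N, fun n hn => (le_inv_mul_iff₀ (by positivity)).2 (hN n hn)⟩
  · refine ae_eventually_le_of_tsum_ne_top (s := s) (Υ := Υ) hC
      (p := fun n z => (γ ^ (j + n))⁻¹ * birkhoffProd R (j + n) z) hp hmeas
      -- At `n = 0` the inverse is `0` by convention, so that term is harmless.
      (ψ := fun n _ => ((n : ℝ) ^ 2)⁻¹ * γ ^ n) ?_
    have hle : ∀ n : ℕ, ∑' u : Words τ (j + n), ENNReal.ofReal
        ((γ ^ (j + n))⁻¹ * birkhoffProd R (j + n) u.rep * (((n : ℝ) ^ 2)⁻¹ * γ ^ n)) ≤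
        ENNReal.ofReal ((γ ^ j)⁻¹ * K * ((n : ℝ) ^ 2)⁻¹) := by
      intro n
      have h1 : ∀ u : Words τ (j + n), ENNReal.ofReal
          ((γ ^ (j + n))⁻¹ * birkhoffProd R (j + n) u.rep * (((n : ℝ) ^ 2)⁻¹ * γ ^ n)) =
          ENNReal.ofReal ((γ ^ j)⁻¹ * ((n : ℝ) ^ 2)⁻¹) *
            ENNReal.ofReal (birkhoffProd R (j + n) u.rep) := fun u => by
        rw [← ENNReal.ofReal_mul (by positivity)]
        congr 1
        rw [pow_add, mul_inv]
        field_simp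
      simp_rw [h1]
      rw [ENNReal.tsum_mul_left]
      refine (mul_le_mul_right (hwords (j + n)) _).trans (le_of_eq ?_)
      rw [← ENNReal.ofReal_mul (by positivity)]
      congr 1
      ring
    refine ne_top_of_le_ne_top ?_ (ENNReal.tsum_le_tsum hle)
    rw [← ENNReal.ofReal_tsum_of_nonneg (fun n => by positivity)]
    · exact ENNReal.ofReal_ne_top
    · exact ((Real.summable_nat_pow_inv (p := 2)).2 (by norm_num)).mul_left _
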